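/- Let $\mathbf T^2=\mathbf R^2/\mathbf Z^2$, let $B\in\mathscr C^\infty(\mathbf T^2,\mathbf R)$ be a magnetic field whose flux $\widehat B_0=\int_{\mathbf T^2}B\,dx$ belongs to $2\pi\mathbf Z$, and write $x\wedge y=x_1y_2-x_2y_1$. For $m\in\mathbf Z^2$ let $\mathcal T_m^Bu(x)=e^{\frac{i\widehat B_0}{2}m\wedge x}u(x-m)$. Let $\mathscr C^\infty(\mathbf T^2,L)$ (resp. $L^2(\mathbf T^2,L)$) be the space of $u\in\mathscr C^\infty(\mathbf R^2,\mathbf C)$ (resp. $u\in L^2_{\rm loc}(\mathbf R^2,\mathbf C)$) such that $\mathcal T^B_{(1,0)}u=u=\mathcal T^B_{(0,1)}u$, with the norm $\|u\|_{L^2}=\big(\int_{[0,1]^2}|u|^2dx\big)^{1/2}$. Let $S^0$ be the class of all $a\in\mathscr C^\infty(\mathbf T^2\times\mathbf R^2,\mathbf C)$ all of whose derivatives $\partial_x^\gamma\partial_\xi^\beta a$ ($\gamma,\beta\in\mathbf N_0^2$) are bounded. For $h>0$, $\eta\in2\pi\mathbf Z^2$, $\zeta\in\mathbf R^2$ put $$W_h^B(\eta,\zeta)u(x)=e^{\frac{ih\widehat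 B_0}{2}\zeta\wedge x}\,e^{i\eta\cdot(x+\frac{h\zeta}{2})}\,u(x+h\zeta),\qquad \mathcal F(a)(\eta,\zeta)=\int_{\mathbf T^2\times\mathbf R^2}a(x,\xi)e^{-i\eta\cdot x}e^{-i\zeta\cdot\xi}\,dx\,d\xi,$$ and let the magnetic Weyl quantization of $a$ be given, for $u\in\mathscr C^\infty(\mathbf T^2,L)$, by $$\mathsf{Op}_h^B(a)u(x)=\frac1{(2\pi)^2}\sum_{\eta\in2\pi\mathbf Z^2}\int_{\mathbf R^2}\mathcal F(a)(\eta,\zeta)\,W_h^B(\eta,\zeta)u(x)\,d\zeta .$$ For a symbol compactly supported in $\xi$ the integrals and the series converge absolutely; for $a\in S^0$ the formula is understood as an oscillatory integral, that is, as the pointwise limit as $R\to\infty$ of the formula for the symbols $\chi(\xi/R)a(x,\xi)$, for every $\chi\in\mathscr C_c^\infty(\mathbf R^2,\mathbf R)$ with $\chi(0)=1$ (the limit exists and does not depend on $\chi$). **Theorem.** For every $a\in S^0$ and $h\in(0,1]$, the operator $\mathsf{Op}_h^B(a)$ extends uniquely from $\mathscr C^\infty(\mathbf T^2,L)$ to a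 bounded operator on $L^2(\mathbf T^2,L)$. Moreover there are constants $C_0>0$ and $N_0\in\mathbf N$, $N_0>0$, independent of $a$ and $h$, such that for every $a\in S^0$: 1. if $h=1$, then $\displaystyle \|\mathsf{Op}_1^B(a)\|_{L^2\to L^2}\le C_0\sum_{|\gamma|+|\beta|\le N_0}\|\partial_x^\gamma\partial_\xi^\beta a\|_\infty$; 2. for all $h\in(0,1]$, $\displaystyle \|\mathsf{Op}_h^B(a)\|_{L^2\to L^2}\le C_0\sum_{|\gamma|+|\beta|\le N_0}h^{|\beta|}\|\partial_x^\gamma\partial_\xi^\beta a\|_\infty$. -/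

import Mathlib

open MeasureTheory Filter Topology
open scoped ContDiff

noncomputable section

namespace MagneticTorus

/-- The plane `ℝ²`; functions on `𝕋² = ℝ²/ℤ²` are `ℤ²`-periodic functions on it. -/
abbrev Plane : Type := EuclideanSpace ℝ (Fin 2)

/-- The lattice vector of `ℝ²` with integer coordinates `m`. -/
def latticeVec (m : Fin 2 → ℤ) : Plane := WithLp.toLp 2 (fun i => (m i : ℝ))

/-- `x ∧ y = x₁ y₂ - x₂ y₁`. -/
def wedge (x y : Plane) : ℝ := x 0 * y 1 - x 1 * y 0

/-- The fundamental domain `[0,1)²` of `𝕋²`. -/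
def unitSquare : Set Plane := {x | ∀ i, x i ∈ Set.Ico (0 : ℝ) 1}

/-- A smooth real magnetic field on `𝕋²`, as a smooth `ℤ²`-periodic function on `ℝ²`. -/
structure IsMagneticField (B : Plane → ℝ) : Prop where
  smooth : ContDiff ℝ ∞ B
  periodic : ∀ (m : Fin 2 → ℤ) (x : Plane), B (x + latticeVec m) = B x

/-- The total flux (the zeroth Fourier coefficient) of the magnetic field `B`. -/
def flux (B : Plane → ℝ) : ℝ := ∫ x in unitSquare, B x

/-! ### Magnetic translations and the spaces of magnetic-periodic functions

In this section `b` stands for the total flux. -/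

/-- The magnetic translation `T_m u (x) = exp (i b (m ∧ x) / 2) u (x - m)`. -/
def magTranslate (b : ℝ) (m : Fin 2 → ℤ) (u : Plane → ℂ) : Plane → ℂ := fun x =>
  Complex.exp (Complex.I * (b / 2 * wedge (latticeVec m) x : ℝ)) * u (x - latticeVec m)

/-- The smooth functions on `ℝ²` that are invariant under the two generating magnetic
translations. -/
structure SmoothSection (b : ℝ) where
  toFun : Plane → ℂ
  smooth : ContDiff ℝ ∞ toFun
  invariant : ∀ j : Fin 2, magTranslate b (Pi.single j 1) toFun = toFun

lemma ae_translate {p : Plane → Prop} (h : ∀ᵐ x, p x) (v : Plane) : ∀ᵐ x, p (x - v) :=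
  (measurePreserving_sub_right volume v).quasiMeasurePreserving.ae h

/-- `L²(𝕋², L)` as a space of classes of functions on `ℝ²`: the locally square integrable
functions that are invariant under the two generating magnetic translations. -/
def l2Submodule (b : ℝ) : Submodule ℂ (Plane →ₘ[volume] ℂ) where
  carrier := {u | (∀ K : Set Plane, IsCompact K → MemLp u 2 (volume.restrict K)) ∧
    ∀ j : Fin 2, magTranslate b (Pi.single j 1) u =ᵐ[volume] u}
  add_mem' := by
    rintro u v ⟨hu, hu'⟩ ⟨hv, hv'⟩
    refine ⟨fun K hK => ?_, fun j => ?_⟩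
    · exact (memLp_congr_ae (ae_restrict_of_ae (AEEqFun.coeFn_add u v))).2
        ((hu K hK).add (hv K hK))
    · filter_upwards [hu' j, hv' j, AEEqFun.coeFn_add u v,
        ae_translate (AEEqFun.coeFn_add u v) (latticeVec (Pi.single j 1))] with x h1 h2 h3 h4
      simp only [magTranslate] at h1 h2 ⊢
      rw [h3, h4, Pi.add_apply, Pi.add_apply, mul_add, h1, h2]
  zero_mem' := by
    refine ⟨fun K hK => ?_, fun j => ?_⟩
    · exact (memLp_congr_ae (ae_restrict_of_ae AEEqFun.coeFn_zero)).2 MemLp.zero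
    · filter_upwards [AEEqFun.coeFn_zero (α := Plane) (μ := volume) (β := ℂ),
        ae_translate (AEEqFun.coeFn_zero (α := Plane) (μ := volume) (β := ℂ))
          (latticeVec (Pi.single j 1))] with x h3 h4
      simp only [magTranslate]
      rw [h3, h4]
      simp
  smul_mem' := by
    rintro c u ⟨hu, hu'⟩
    refine ⟨fun K hK => ?_, fun j => ?_⟩
    · exact (memLp_congr_ae (ae_restrict_of_ae (AEEqFun.coeFn_smul c u))).2
        ((hu K hK).const_smul c)
    · filter_upwards [hu' j, AEEqFun.coeFn_smul c u,
        ae_translate (AEEqFun.coeFn_smul c u) (latticeVec (Pi.single j 1))] with x h1 h3 h4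
      simp only [magTranslate] at h1 ⊢
      rw [h3, h4, Pi.smul_apply, Pi.smul_apply, mul_smul_comm, h1]

/-- The space `L²(𝕋², L)`. -/
def L2Section (b : ℝ) : Type := ↥(l2Submodule b)

instance (b : ℝ) : AddCommGroup (L2Section b) := inferInstanceAs (AddCommGroup ↥(l2Submodule b))

instance (b : ℝ) : Module ℂ (L2Section b) := inferInstanceAs (Module ℂ ↥(l2Submodule b))

/-- The class of functions on `ℝ²` underlying an element of `L²(𝕋², L)`. -/
def L2Section.toAEEqFun {b : ℝ} (u : L2Section b) : Plane →ₘ[volume] ℂ := u.1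

lemma unitSquare_subset_compact : ∃ K : Set Plane, IsCompact K ∧ unitSquare ⊆ K := by
  refine ⟨Metric.closedBall 0 2, isCompact_closedBall _ _, fun x hx => ?_⟩
  have h0 := hx 0
  have h1 := hx 1
  rw [mem_closedBall_zero_iff, EuclideanSpace.norm_eq, Real.sqrt_le_left (by norm_num)]
  simp only [Fin.sum_univ_two, Real.norm_eq_abs, sq_abs]
  nlinarith [h0.1, h0.2, h1.1, h1.2]

lemma L2Section.memLp_unitSquare {b : ℝ} (u : L2Section b) :
    MemLp u.toAEEqFun 2 (volume.restrict unitSquare) := by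
  obtain ⟨K, hK, hs⟩ := unitSquare_subset_compact
  exact (u.2.1 K hK).mono_measure (Measure.restrict_mono hs le_rfl)

/-- Restriction to the fundamental domain, which carries the norm of `L²(𝕋², L)`. -/
def L2Section.restrict (b : ℝ) : L2Section b →ₗ[ℂ] Lp ℂ 2 (volume.restrict unitSquare) where
  toFun u := u.memLp_unitSquare.toLp
  map_add' u v := by
    rw [← MemLp.toLp_add]
    exact (MemLp.toLp_eq_toLp_iff _ _).2 (ae_restrict_of_ae (AEEqFun.coeFn_add _ _))
  map_smul' c u := by
    rw [RingHom.id_apply, ← MemLp.toLp_const_smul]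
    exact (MemLp.toLp_eq_toLp_iff _ _).2 (ae_restrict_of_ae (AEEqFun.coeFn_smul _ _))

/-- The modulus of an element of `L²(𝕋², L)` is `ℤ²`-periodic. -/
lemma L2Section.norm_periodic {b : ℝ} (u : L2Section b) (m : Fin 2 → ℤ) :
    ∀ᵐ x, ‖u.toAEEqFun (x - latticeVec m)‖ = ‖u.toAEEqFun x‖ := by
  let G : AddSubgroup Plane :=
    { carrier := {v | ∀ᵐ x, ‖u.toAEEqFun (x - v)‖ = ‖u.toAEEqFun x‖}
      add_mem' := by
        intro v w hv hw
        filter_upwards [hv, ae_translate hw v] with x h1 h2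
        rw [← h1, ← h2, sub_sub]
      zero_mem' := by simp
      neg_mem' := by
        intro v hv
        filter_upwards [ae_translate hv (-v)] with x h1
        rw [← h1]
        simp }
  have hgen : ∀ j : Fin 2, latticeVec (Pi.single j 1) ∈ G := by
    intro j
    filter_upwards [u.2.2 j] with x hx
    have := congrArg norm hx
    rw [magTranslate, norm_mul, mul_comm Complex.I, Complex.norm_exp_ofReal_mul_I,
      one_mul] at this
    exact this
  have hm : latticeVec m =
      m 0 • latticeVec (Pi.single 0 1) + m 1 • latticeVec (Pi.single 1 1) := by
    ext i
    fin_cases i <;> simp [latticeVec]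
  have : latticeVec m ∈ G := by
    rw [hm]
    exact G.add_mem (G.zsmul_mem (hgen 0) _) (G.zsmul_mem (hgen 1) _)
  exact this

lemma measurableSet_unitSquare : MeasurableSet unitSquare := by
  have : unitSquare = ⋂ i, (fun x : Plane => x i) ⁻¹' Set.Ico (0 : ℝ) 1 := by
    ext x
    simp [unitSquare]
  rw [this]
  refine MeasurableSet.iInter fun i => ?_
  exact measurableSet_Ico.preimage (by fun_prop)

lemma L2Section.restrict_injective (b : ℝ) : Function.Injective (L2Section.restrict b) := by
  rw [← LinearMap.ker_eq_bot, LinearMap.ker_eq_bot']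
  intro u hu
  have h0 : u.toAEEqFun =ᵐ[volume.restrict unitSquare] 0 := by
    have h1 : u.memLp_unitSquare.toLp = 0 := hu
    exact u.memLp_unitSquare.coeFn_toLp.symm.trans (h1 ▸ Lp.coeFn_zero ℂ 2 _)
  have h1 : ∀ᵐ x : Plane, x ∈ unitSquare → u.toAEEqFun x = 0 :=
    (ae_restrict_iff' measurableSet_unitSquare).1 h0
  have h2 : ∀ᵐ x : Plane, ∀ m : Fin 2 → ℤ,
      x - latticeVec m ∈ unitSquare → u.toAEEqFun (x - latticeVec m) = 0 :=
    ae_all_iff.2 fun m => ae_translate h1 _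
  have h3 : ∀ᵐ x : Plane, ∀ m : Fin 2 → ℤ,
      ‖u.toAEEqFun (x - latticeVec m)‖ = ‖u.toAEEqFun x‖ :=
    ae_all_iff.2 fun m => u.norm_periodic m
  refine Subtype.ext (AEEqFun.ext ?_)
  refine EventuallyEq.trans ?_ (AEEqFun.coeFn_zero (α := Plane) (μ := volume) (β := ℂ)).symm
  filter_upwards [h2, h3] with x hx hx'
  have hmem : x - latticeVec (fun i => ⌊x i⌋) ∈ unitSquare := by
    intro i
    simp only [latticeVec, PiLp.sub_apply]
    exact ⟨Int.fract_nonneg _, Int.fract_lt_one _⟩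
  have := hx' (fun i => ⌊x i⌋)
  rw [hx _ hmem, norm_zero] at this
  exact norm_eq_zero.1 this.symm

/-- The norm of `L²(𝕋², L)` is the `L²` norm over the fundamental domain. -/
instance (b : ℝ) : NormedAddCommGroup (L2Section b) :=
  NormedAddCommGroup.induced (L2Section b) (Lp ℂ 2 (volume.restrict unitSquare))
    (L2Section.restrict b) (L2Section.restrict_injective b)

instance (b : ℝ) : NormedSpace ℂ (L2Section b) :=
  NormedSpace.induced ℂ (L2Section b) (Lp ℂ 2 (volume.restrict unitSquare))
    (L2Section.restrict b)

/-- The inclusion of the smooth magnetic-periodic functions in `L²(𝕋², L)`. -/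
def SmoothSection.toL2 {b : ℝ} (u : SmoothSection b) : L2Section b :=
  ⟨AEEqFun.mk u.toFun u.smooth.continuous.aestronglyMeasurable, by
    have hc := AEEqFun.coeFn_mk u.toFun
      (u.smooth.continuous.aestronglyMeasurable (μ := (volume : Measure Plane)))
    refine ⟨fun K hK => ?_, fun j => ?_⟩
    · refine (memLp_congr_ae (ae_restrict_of_ae hc)).2 ?_
      obtain ⟨C, hC⟩ := hK.exists_bound_of_continuousOn u.smooth.continuous.continuousOn
      have : IsFiniteMeasure (volume.restrict K) :=
        isFiniteMeasure_restrict.2 hK.measure_lt_top.ne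
      exact MemLp.of_bound u.smooth.continuous.aestronglyMeasurable C
        ((ae_restrict_iff' hK.measurableSet).2 (ae_of_all _ hC))
    · filter_upwards [hc, ae_translate hc (latticeVec (Pi.single j 1))] with x h1 h2
      rw [h1, magTranslate, h2]
      exact congrFun (u.invariant j) x⟩

/-! ### Symbols -/

/-- `∂_{x_j} a` for a function `a(x, ξ)`. -/
def dX (j : Fin 2) (a : Plane × Plane → ℂ) : Plane × Plane → ℂ := fun p =>
  fderiv ℝ a p (EuclideanSpace.single j 1, 0)

/-- `∂_{ξ_j} a` for a function `a(x, ξ)`. -/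
def dXi (j : Fin 2) (a : Plane × Plane → ℂ) : Plane × Plane → ℂ := fun p =>
  fderiv ℝ a p (0, EuclideanSpace.single j 1)

/-- `∂_x^γ ∂_ξ^β a`. -/
def symbolDeriv (γ β : Fin 2 → ℕ) (a : Plane × Plane → ℂ) : Plane × Plane → ℂ :=
  (dX 0)^[γ 0] ((dX 1)^[γ 1] ((dXi 0)^[β 0] ((dXi 1)^[β 1] a)))

/-- The class `S⁰`: smooth functions on `𝕋² × ℝ²` all of whose derivatives are bounded. -/
structure IsSymbol (a : Plane × Plane → ℂ) : Prop where
  smooth : ContDiff ℝ ∞ a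
  periodic : ∀ (m : Fin 2 → ℤ) (x ξ : Plane), a (x + latticeVec m, ξ) = a (x, ξ)
  bounded : ∀ γ β : Fin 2 → ℕ, ∃ C : ℝ, ∀ p, ‖symbolDeriv γ β a p‖ ≤ C

/-- The length `|γ|` of a multi-index. -/
def len (γ : Fin 2 → ℕ) : ℕ := γ 0 + γ 1

/-- The supremum norm of a (bounded) function on `𝕋² × ℝ²`. -/
def supNorm (f : Plane × Plane → ℂ) : ℝ := ⨆ p, ‖f p‖

/-- The pairs of multi-indices `(γ, β)` with `|γ| + |β| ≤ N`. -/
def multiIndexPairs (N : ℕ) : Finset ((Fin 2 → ℕ) × (Fin 2 → ℕ)) :=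
  (Fintype.piFinset (fun _ => Finset.range (N + 1)) ×ˢ
    Fintype.piFinset (fun _ => Finset.range (N + 1))).filter
      (fun p => len p.1 + len p.2 ≤ N)

/-! ### The magnetic Weyl quantization -/

/-- The frequency `η = 2πk` with `k ∈ ℤ²`. -/
def freq (k : Fin 2 → ℤ) : Plane := (2 * Real.pi) • latticeVec k

/-- The magnetic Weyl operator
`W_h^B(η, ζ) u (x) = exp (i h b (ζ ∧ x) / 2) exp (i η · (x + h ζ / 2)) u (x + h ζ)`. -/
def weylOp (h b : ℝ) (η ζ : Plane) (u : Plane → ℂ) : Plane → ℂ := fun x =>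
  Complex.exp (Complex.I * (h * b / 2 * wedge ζ x : ℝ)) *
    Complex.exp (Complex.I * (inner ℝ η (x + (h / 2) • ζ) : ℝ)) * u (x + h • ζ)

/-- The Fourier transform of a symbol,
`𝓕(a)(η, ζ) = ∫_{𝕋² × ℝ²} a(x, ξ) exp (-i η · x) exp (-i ζ · ξ) dx dξ`. -/
def symbolFourier (a : Plane × Plane → ℂ) (η ζ : Plane) : ℂ :=
  ∫ p in unitSquare ×ˢ (Set.univ : Set Plane),
    a p * Complex.exp (-Complex.I * (inner ℝ η p.1 : ℝ)) *
      Complex.exp (-Complex.I * (inner ℝ ζ p.2 : ℝ))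

/-- The integrand `𝓕(a)(η, ζ) W_h^B(η, ζ) u (x)` of the quantization formula. -/
def quantIntegrand (h b : ℝ) (a : Plane × Plane → ℂ) (u : Plane → ℂ) (x η ζ : Plane) : ℂ :=
  symbolFourier a η ζ * weylOp h b η ζ u x

/-- `HasQuantSum h b a u x z` says that
`z = (2π)⁻² ∑_{η ∈ 2πℤ²} ∫_{ℝ²} 𝓕(a)(η, ζ) W_h^B(η, ζ) u (x) dζ`, with integrable integrands and
an absolutely convergent series. This is the meaning of the formula for symbols that are
compactly supported in `ξ`. -/
def HasQuantSum (h b : ℝ) (a : Plane × Plane → ℂ) (u : Plane → ℂ) (x : Plane) (z : ℂ) : Prop :=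
  (∀ k : Fin 2 → ℤ, Integrable (quantIntegrand h b a u x (freq k))) ∧
    HasSum (fun k : Fin 2 → ℤ =>
      (1 / (2 * Real.pi) ^ 2 : ℂ) * ∫ ζ, quantIntegrand h b a u x (freq k) ζ) z

/-- The truncated symbol `χ(ξ / R) a(x, ξ)`. -/
def truncate (χ : Plane → ℝ) (R : ℝ) (a : Plane × Plane → ℂ) : Plane × Plane → ℂ := fun p =>
  (χ (R⁻¹ • p.2) : ℂ) * a p

/-- `IsQuantValue h b a u v` says that `v = Op_h^B(a) u`. For `a ∈ S⁰` the defining formula is an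
oscillatory integral: it is the limit as `R → ∞` of the formula for the truncated symbols
`χ(ξ / R) a(x, ξ)`, whatever the smooth compactly supported `χ` with `χ(0) = 1`. -/
def IsQuantValue (h b : ℝ) (a : Plane × Plane → ℂ) (u v : Plane → ℂ) : Prop :=
  ∀ χ : Plane → ℝ, ContDiff ℝ ∞ χ → HasCompactSupport χ → χ 0 = 1 → ∀ x : Plane,
    ∃ s : ℝ → ℂ, (∀ R : ℝ, 0 < R → HasQuantSum h b (truncate χ R a) u x (s R)) ∧
      Tendsto s atTop (𝓝 (v x))

/-- `A` is a bounded operator on `L²(𝕋², L)` that extends `Op_h^B(a)` from the smooth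
magnetic-periodic functions. -/
def IsQuantization (h b : ℝ) (a : Plane × Plane → ℂ) (A : L2Section b →L[ℂ] L2Section b) : Prop :=
  ∀ u : SmoothSection b, ∃ v : Plane → ℂ, IsQuantValue h b a u.toFun v ∧
    (A u.toL2).toAEEqFun =ᵐ[volume] v

end MagneticTorus

end

noncomputable section

namespace MagneticTorus

open scoped ENNReal NNReal

/-! ### Lattice vectors and the wedge product -/

/-! The magnetic field enters only through its flux `b`. The parameter `h` enters the Weyl operator
only through `h ζ`, so the change of variable `ζ ↦ h⁻¹ ζ` identifies the quantization of `a` at `h`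
with that of `a(x, h ξ)` at `h = 1`, and every `ξ`-derivative of the latter carries a factor `h`
(`isQuantization_dilate_iff`, `supNorm_symbolDeriv_dilate`). Only `h = 1` needs an argument.

There, write `u = ∑ u_l` with lattice translates of a smooth bump, and the operator as a sum of
terms `T_k` of frequency `2πk`. The blocks `T_k u_l`, restricted to the unit square in `x`, have
summable `L²` norms; since `x` stays in one cell, no orthogonality is needed. Two facts give this.

Uniform bound (`IsCptSymbol.eLpNorm_quantTerm_le`). With `y = x + ζ` near `l`, the phase splits as
`ζ ∧ x = l ∧ x + (y - l) ∧ x`. The first part is a unimodular factor in `x`; the second is bounded,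
and the power series of its exponential separates `x` from `y`. Each separated term is a Fourier
multiplier, bounded by `sup |a|` through Plancherel (`IsCptSymbol.eLpNorm_multiplier_le`).

Decay (`decay`). Integration by parts in `x` gives powers of `k_j`. Writing `l_j = ζ_j + x_j - (y_j
- l_j)` and trading `ζ_j` for `∂_{ξ_j}` gives powers of `l_j`. Two powers of each of `k_0, k_1, l_0,
l_1` are summable and cost eight derivatives.

For the oscillatory limit the same decay scheme is run pointwise in `x`
(`exists_enorm_quantTerm_le`). Its starting bound comes from `phaseTerm`, which puts the Fourier
transform on the localized section and so makes sense for a merely bounded symbol. The estimates are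
uniform over truncations with `R ≥ 1` (`nrm_truncate_le`), so dominated convergence yields the limit
`limVal`, independent of the cutoff, and Fatou's lemma transfers the `L²` bound to it.

Finally, Weyl operators with `η ∈ 2πℤ²` commute with the magnetic translations, so the limit is
again invariant. Integrality of `b / 2π` makes the extension `magExt` from the unit square
invariant; hence `L²(𝕋², L)` is isometric to `L²` of the square, is complete, and contains the
smooth sections densely. The operator extends by continuity. -/

lemma latticeVec_apply (m : Fin 2 → ℤ) (i : Fin 2) : latticeVec m i = m i := rfl

lemma latticeVec_add (m n : Fin 2 → ℤ) : latticeVec (m + n) = latticeVec m + latticeVec n := by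
  ext i; simp [latticeVec_apply]

lemma latticeVec_sub (m n : Fin 2 → ℤ) : latticeVec (m - n) = latticeVec m - latticeVec n := by
  ext i; simp [latticeVec_apply]

lemma latticeVec_neg (m : Fin 2 → ℤ) : latticeVec (-m) = -latticeVec m := by
  ext i; simp [latticeVec_apply]

lemma latticeVec_zero : latticeVec 0 = 0 := by
  ext i; simp [latticeVec_apply]

lemma latticeVec_single (j : Fin 2) :
    latticeVec (Pi.single j 1) = EuclideanSpace.single j (1 : ℝ) := by
  ext i
  by_cases h : i = j
  · subst h; simp [latticeVec_apply]
  · simp [latticeVec_apply, h]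

lemma wedge_add_left (x y z : Plane) : wedge (x + y) z = wedge x z + wedge y z := by
  simp [wedge]; ring

lemma wedge_add_right (x y z : Plane) : wedge x (y + z) = wedge x y + wedge x z := by
  simp [wedge]; ring

lemma wedge_sub_left (x y z : Plane) : wedge (x - y) z = wedge x z - wedge y z := by
  simp [wedge]; ring

lemma wedge_sub_right (x y z : Plane) : wedge x (y - z) = wedge x y - wedge x z := by
  simp [wedge]; ring

lemma wedge_self (x : Plane) : wedge x x = 0 := by
  simp [wedge]; ring

lemma contDiff_wedge_right (x : Plane) : ContDiff ℝ ∞ (wedge x) := by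
  unfold wedge; fun_prop

lemma contDiff_wedge_left (x : Plane) : ContDiff ℝ ∞ (fun y => wedge y x) := by
  unfold wedge; fun_prop

@[fun_prop]
lemma continuous_wedge {X : Type*} [TopologicalSpace X] {f g : X → Plane} (hf : Continuous f)
    (hg : Continuous g) : Continuous fun x => wedge (f x) (g x) := by
  unfold wedge; fun_prop

/-- The vector `l^⊥` with `l ∧ z = l^⊥ · z`. -/
def perp (x : Plane) : Plane := !₂[-x 1, x 0]

lemma wedge_eq_inner (x y : Plane) : wedge x y = inner ℝ (perp x) y := by
  simp [wedge, perp, PiLp.inner_apply, Fin.sum_univ_two]; ring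

lemma norm_exp_I_mul (t : ℝ) : ‖Complex.exp (Complex.I * (t : ℂ))‖ = 1 := by
  rw [mul_comm, Complex.norm_exp_ofReal_mul_I]

lemma enorm_exp_I_mul (t : ℝ) : ‖Complex.exp (Complex.I * (t : ℂ))‖ₑ = 1 := by
  rw [← ofReal_norm, norm_exp_I_mul, ENNReal.ofReal_one]

/-! ### Functions invariant under the magnetic translations -/

/-- Invariance under the two generating magnetic translations. -/
def IsMagInvariant (b : ℝ) (u : Plane → ℂ) : Prop :=
  ∀ j : Fin 2, magTranslate b (Pi.single j 1) u = u

lemma IsMagInvariant.add_single {b : ℝ} {u : Plane → ℂ} (hu : IsMagInvariant b u) (j : Fin 2)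
    (x : Plane) : u (x + latticeVec (Pi.single j 1)) =
      Complex.exp (Complex.I * (b / 2 * wedge (latticeVec (Pi.single j 1)) x : ℝ)) * u x := by
  conv_lhs => rw [← hu j]
  simp [magTranslate, wedge_add_right, wedge_self]

/-- The phase of the magnetic translation by a lattice vector. -/
def magPhase (b : ℝ) (m : Fin 2 → ℤ) (x : Plane) : ℂ :=
  Complex.exp (Complex.I * (b / 2 * (m 0 * m 1 + wedge (latticeVec m) x) : ℝ))

lemma norm_magPhase (b : ℝ) (m : Fin 2 → ℤ) (x : Plane) : ‖magPhase b m x‖ = 1 :=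
  norm_exp_I_mul _

lemma contDiff_magPhase (b : ℝ) (m : Fin 2 → ℤ) : ContDiff ℝ ∞ (magPhase b m) := by
  unfold magPhase
  have := contDiff_wedge_right (latticeVec m)
  have h2 : ContDiff ℝ ∞ fun x : Plane =>
      ((b / 2 * (m 0 * m 1 + wedge (latticeVec m) x) : ℝ) : ℂ) :=
    Complex.ofRealCLM.contDiff.comp (contDiff_const.mul (contDiff_const.add this))
  exact (contDiff_const.mul h2).cexp

/-- Iterates the generators, moving first by `m 1` in the second direction and then by `m 0` in the
first. The two translations commute only up to a phase, and the term `m 0 * m 1` in `magPhase`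
records this order. The flux may be any real number here. -/
lemma IsMagInvariant.add_lattice {b : ℝ} {u : Plane → ℂ} (hu : IsMagInvariant b u)
    (m : Fin 2 → ℤ) (x : Plane) : u (x + latticeVec m) = magPhase b m x * u x := by
  have e0 : ∀ (n : ℤ) (x : Plane), u (x + latticeVec (Pi.single 0 n)) =
      Complex.exp (Complex.I * (b / 2 * (n * x 1) : ℝ)) * u x := by
    intro n
    induction n using Int.induction_on with
    | zero => intro x; simp [latticeVec_zero]
    | succ i ih =>
      intro x
      have : (Pi.single 0 ((i : ℤ) + 1) : Fin 2 → ℤ) = Pi.single 0 (i : ℤ) + Pi.single 0 1 := by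
        rw [← Pi.single_add]
      rw [this, latticeVec_add, ← add_assoc, hu.add_single, ih, ← mul_assoc, ← Complex.exp_add]
      congr 2
      simp [wedge, latticeVec_apply]; ring
    | pred i ih =>
      intro x
      have h1 := hu.add_single 0 (x + latticeVec (Pi.single 0 (-(i : ℤ) - 1)))
      have : (Pi.single 0 (-(i : ℤ) - 1) : Fin 2 → ℤ) + Pi.single 0 1 = Pi.single 0 (-(i : ℤ)) := by
        rw [← Pi.single_add]; simp
      rw [add_assoc, ← latticeVec_add, this, ih] at h1
      -- A backward step: the generator relation at the shifted point is inverted by multiplying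
      -- with the opposite phase.
      have h2 := congrArg (fun z => Complex.exp (-(Complex.I * ((b / 2 * wedge (latticeVec (Pi.single 0 1)) (x + latticeVec (Pi.single 0 (-(i : ℤ) - 1))) : ℝ) : ℂ))) * z) h1
      simp only [← mul_assoc, ← Complex.exp_add] at h2
      rw [neg_add_cancel, Complex.exp_zero, one_mul] at h2
      rw [← h2]
      congr 2
      simp [wedge, latticeVec_apply]; ring
  have e1 : ∀ (n : ℤ) (x : Plane), u (x + latticeVec (Pi.single 1 n)) =
      Complex.exp (Complex.I * (b / 2 * (-n * x 0) : ℝ)) * u x := by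
    intro n
    induction n using Int.induction_on with
    | zero => intro x; simp [latticeVec_zero]
    | succ i ih =>
      intro x
      have : (Pi.single 1 ((i : ℤ) + 1) : Fin 2 → ℤ) = Pi.single 1 (i : ℤ) + Pi.single 1 1 := by
        rw [← Pi.single_add]
      rw [this, latticeVec_add, ← add_assoc, hu.add_single, ih, ← mul_assoc, ← Complex.exp_add]
      congr 2
      simp [wedge, latticeVec_apply]; ring
    | pred i ih =>
      intro x
      have h1 := hu.add_single 1 (x + latticeVec (Pi.single 1 (-(i : ℤ) - 1)))
      have : (Pi.single 1 (-(i : ℤ) - 1) : Fin 2 → ℤ) + Pi.single 1 1 = Pi.single 1 (-(i : ℤ)) := by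
        rw [← Pi.single_add]; simp
      rw [add_assoc, ← latticeVec_add, this, ih] at h1
      have h2 := congrArg (fun z => Complex.exp (-(Complex.I * ((b / 2 * wedge (latticeVec (Pi.single 1 1)) (x + latticeVec (Pi.single 1 (-(i : ℤ) - 1))) : ℝ) : ℂ))) * z) h1
      simp only [← mul_assoc, ← Complex.exp_add] at h2
      rw [neg_add_cancel, Complex.exp_zero, one_mul] at h2
      rw [← h2]
      congr 2
      simp [wedge, latticeVec_apply]; ring
  have hm : m = Pi.single 1 (m 1) + Pi.single 0 (m 0) := by
    ext i; fin_cases i <;> simp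
  conv_lhs => rw [hm, latticeVec_add, ← add_assoc, e0, e1, ← mul_assoc, ← Complex.exp_add]
  rw [magPhase]
  congr 2
  simp [wedge, latticeVec_apply]; ring

lemma IsMagInvariant.norm_add_lattice {b : ℝ} {u : Plane → ℂ} (hu : IsMagInvariant b u)
    (m : Fin 2 → ℤ) (x : Plane) : ‖u (x + latticeVec m)‖ = ‖u x‖ := by
  rw [hu.add_lattice, norm_mul, norm_magPhase, one_mul]

/-- The integer part of a point of the plane. -/
def floorVec (x : Plane) : Fin 2 → ℤ := fun i => ⌊x i⌋

lemma sub_floorVec_mem (x : Plane) : x - latticeVec (floorVec x) ∈ unitSquare := fun i => by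
  simp only [latticeVec, PiLp.sub_apply, floorVec]
  exact ⟨Int.fract_nonneg _, Int.fract_lt_one _⟩

lemma eq_floorVec_of_sub_mem {x : Plane} {m : Fin 2 → ℤ} (h : x - latticeVec m ∈ unitSquare) :
    m = floorVec x := by
  funext i
  have := h i
  simp only [PiLp.sub_apply, latticeVec_apply] at this
  exact (Int.floor_eq_iff.2 ⟨by linarith [this.1], by linarith [this.2]⟩).symm

lemma floorVec_eq_zero {x : Plane} (h : x ∈ unitSquare) : floorVec x = 0 :=
  (eq_floorVec_of_sub_mem (m := 0) (by simpa [latticeVec_zero] using h)).symm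

lemma floorVec_add (x : Plane) (m : Fin 2 → ℤ) : floorVec (x + latticeVec m) = floorVec x + m := by
  refine (eq_floorVec_of_sub_mem ?_).symm
  rw [latticeVec_add, add_sub_add_right_eq_sub]
  exact sub_floorVec_mem x

lemma IsMagInvariant.bounded {b : ℝ} {u : Plane → ℂ} (hu : IsMagInvariant b u)
    (hc : Continuous u) : ∃ C : ℝ, ∀ x, ‖u x‖ ≤ C := by
  obtain ⟨K, hK, hs⟩ := unitSquare_subset_compact
  obtain ⟨C, hC⟩ := hK.exists_bound_of_continuousOn hc.continuousOn
  refine ⟨C, fun x => ?_⟩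
  have := hu.norm_add_lattice (floorVec x) (x - latticeVec (floorVec x))
  rw [sub_add_cancel] at this
  rw [this]
  exact hC _ (hs (sub_floorVec_mem x))

lemma volume_unitSquare : volume unitSquare = 1 := by
  have h : unitSquare = (MeasurableEquiv.toLp 2 (Fin 2 → ℝ)).symm ⁻¹'
      (Set.univ.pi fun _ => Set.Ico (0 : ℝ) 1) := by
    ext x; simp [unitSquare]
  rw [h, (EuclideanSpace.volume_preserving_symm_measurableEquiv_toLp (Fin 2)).measure_preimage
    (MeasurableSet.univ_pi fun _ => measurableSet_Ico).nullMeasurableSet, volume_pi_pi]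
  simp

instance : IsProbabilityMeasure (volume.restrict unitSquare) :=
  ⟨by rw [Measure.restrict_apply_univ, volume_unitSquare]⟩

/-- The `L²` norm over a translated cell of a function with periodic modulus. -/
lemma eLpNorm_cell {u : Plane → ℂ} (m : Fin 2 → ℤ)
    (hu : ∀ᵐ x, ‖u (x + latticeVec m)‖ₑ = ‖u x‖ₑ) :
    eLpNorm u 2 (volume.restrict {x | x - latticeVec m ∈ unitSquare}) =
      eLpNorm u 2 (volume.restrict unitSquare) := by
  have hmp : MeasurePreserving (fun x => x + latticeVec m) (volume.restrict unitSquare)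
      (volume.restrict {x | x - latticeVec m ∈ unitSquare}) := by
    have h := (measurePreserving_add_right volume (latticeVec m)).restrict_preimage_emb
      (measurableEmbedding_addRight (latticeVec m)) {x | x - latticeVec m ∈ unitSquare}
    have hs : (fun x => x + latticeVec m) ⁻¹' {x | x - latticeVec m ∈ unitSquare} = unitSquare := by
      ext x; simp
    rwa [hs] at h
  have h1 : eLpNorm u 2 (volume.restrict {x | x - latticeVec m ∈ unitSquare}) =
      eLpNorm (u ∘ fun x => x + latticeVec m) 2 (volume.restrict unitSquare) := by
    rw [← hmp.map_eq, (measurableEmbedding_addRight (latticeVec m)).eLpNorm_map_measure]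
  rw [h1]
  exact eLpNorm_congr_enorm_ae (ae_restrict_of_ae hu)

/-! ### A smooth partition of unity -/

/-- A smooth bump on the line whose integer translates sum to one. -/
def bump (t : ℝ) : ℝ := Real.smoothTransition (t + 1) - Real.smoothTransition t

lemma bump_nonneg (t : ℝ) : 0 ≤ bump t :=
  sub_nonneg.2 (Real.smoothTransition.monotone (by linarith))

lemma bump_le_one (t : ℝ) : bump t ≤ 1 := by
  have := Real.smoothTransition.le_one (t + 1)
  have := Real.smoothTransition.nonneg t
  unfold bump; linarith

lemma bump_eq_zero {t : ℝ} (h : 1 ≤ |t|) : bump t = 0 := by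
  rcases le_abs.1 h with h | h
  · rw [bump, Real.smoothTransition.one_of_one_le h,
      Real.smoothTransition.one_of_one_le (by linarith), sub_self]
  · rw [bump, Real.smoothTransition.zero_of_nonpos (by linarith),
      Real.smoothTransition.zero_of_nonpos (by linarith), sub_self]

lemma contDiff_bump : ContDiff ℝ ∞ bump := by
  have h : ContDiff ℝ ∞ Real.smoothTransition := Real.smoothTransition.contDiff (n := ⊤)
  exact (h.comp (contDiff_id.add contDiff_const)).sub h

/-- At `t` only the translates by `⌊t⌋` and `⌊t⌋ + 1` can be nonzero. Their sum telescopes to the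
transition function at a point `≥ 1` minus its value at a point `≤ 0`. -/
lemma hasSum_bump (t : ℝ) : HasSum (fun n : ℤ => bump (t - n)) 1 := by
  have h : HasSum (fun n : ℤ => bump (t - n)) (∑ n ∈ {⌊t⌋, ⌊t⌋ + 1}, bump (t - n)) := by
    refine hasSum_sum_of_ne_finset_zero fun n hn => bump_eq_zero ?_
    simp only [Finset.mem_insert, Finset.mem_singleton, not_or] at hn
    have h1 := Int.floor_le t
    have h2 := Int.lt_floor_add_one t
    rw [le_abs]
    rcases lt_or_gt_of_ne hn.1 with h | h
    · left
      have : (n : ℝ) + 1 ≤ ⌊t⌋ := by exact_mod_cast h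
      linarith
    · right
      have : (⌊t⌋ : ℝ) + 2 ≤ n := by exact_mod_cast (show ⌊t⌋ + 2 ≤ n by omega)
      linarith
  convert h using 1
  rw [Finset.sum_pair (by omega)]
  have h1 := Int.floor_le t
  have h2 := Int.lt_floor_add_one t
  simp only [bump]
  push_cast
  rw [Real.smoothTransition.one_of_one_le (by linarith : 1 ≤ t - ⌊t⌋ + 1),
    Real.smoothTransition.zero_of_nonpos (by linarith : t - (⌊t⌋ + 1) ≤ 0),
    show t - (⌊t⌋ + 1) + 1 = t - ⌊t⌋ by ring]
  ring

/-- A smooth bump on the plane whose lattice translates sum to one. -/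
def bump2 (x : Plane) : ℝ := bump (x 0) * bump (x 1)

lemma bump2_nonneg (x : Plane) : 0 ≤ bump2 x := mul_nonneg (bump_nonneg _) (bump_nonneg _)

lemma bump2_le_one (x : Plane) : bump2 x ≤ 1 :=
  mul_le_one₀ (bump_le_one _) (bump_nonneg _) (bump_le_one _)

lemma bump2_eq_zero {x : Plane} (j : Fin 2) (h : 1 ≤ |x j|) : bump2 x = 0 := by
  fin_cases j
  · exact mul_eq_zero_of_left (bump_eq_zero h) _
  · exact mul_eq_zero_of_right _ (bump_eq_zero h)

lemma contDiff_bump2 : ContDiff ℝ ∞ bump2 := by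
  have h0 : ContDiff ℝ ∞ fun x : Plane => x 0 := by fun_prop
  have h1 : ContDiff ℝ ∞ fun x : Plane => x 1 := by fun_prop
  exact (contDiff_bump.comp h0).mul (contDiff_bump.comp h1)

lemma hasSum_finTwo_mul {f g : ℤ → ℝ} {s t : ℝ} (hf : HasSum f s) (hg : HasSum g t)
    (hf0 : ∀ n, 0 ≤ f n) (hg0 : ∀ n, 0 ≤ g n) :
    HasSum (fun l : Fin 2 → ℤ => f (l 0) * g (l 1)) (s * t) := by
  have h := hf.mul hg (hf.summable.mul_of_nonneg hg.summable hf0 hg0)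
  exact (finTwoArrowEquiv ℤ).hasSum_iff.2 h

lemma hasSum_bump2 (x : Plane) : HasSum (fun l : Fin 2 → ℤ => bump2 (x - latticeVec l)) 1 := by
  have := hasSum_finTwo_mul (hasSum_bump (x 0)) (hasSum_bump (x 1)) (fun _ => bump_nonneg _)
    (fun _ => bump_nonneg _)
  simpa [bump2, latticeVec_apply] using this

/-- The part near the lattice point `l` of a function on the plane. -/
def piece (l : Fin 2 → ℤ) (u : Plane → ℂ) (y : Plane) : ℂ := bump2 (y - latticeVec l) * u y

lemma hasSum_piece (u : Plane → ℂ) (y : Plane) : HasSum (fun l => piece l u y) (u y) := by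
  have h : HasSum (fun l : Fin 2 → ℤ => ((bump2 (y - latticeVec l) : ℝ) : ℂ)) ((1 : ℝ) : ℂ) :=
    Complex.hasSum_ofReal.2 (hasSum_bump2 y)
  simpa [piece] using h.mul_right (u y)

lemma hasSum_norm_piece (u : Plane → ℂ) (y : Plane) :
    HasSum (fun l => ‖piece l u y‖) ‖u y‖ := by
  have h := (hasSum_bump2 y).mul_right ‖u y‖
  simpa [piece, abs_of_nonneg (bump2_nonneg _)] using h

/-- The translated bump is at most one and lives in a square of side two, covered by the four cells
with corners `m i ∈ {l i - 1, l i}`. On each of them `u` has the same `L²` norm as on the unit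
square, because `|u|` is periodic. -/
lemma eLpNorm_piece_le {b : ℝ} {u : Plane → ℂ} (hu : IsMagInvariant b u) (hc : Continuous u)
    (l : Fin 2 → ℤ) :
    eLpNorm (piece l u) 2 volume ≤ 4 * eLpNorm u 2 (volume.restrict unitSquare) := by
  let s : Finset (Fin 2 → ℤ) := Fintype.piFinset fun i => {l i - 1, l i}
  let F : (Fin 2 → ℤ) → Plane → ℂ := fun m =>
    ({x | x - latticeVec m ∈ unitSquare}).indicator u
  have hmeas : ∀ m : Fin 2 → ℤ, MeasurableSet {x | x - latticeVec m ∈ unitSquare} := fun m =>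
    measurableSet_unitSquare.preimage (measurable_id.sub_const (latticeVec m))
  have hle : eLpNorm (piece l u) 2 volume ≤ eLpNorm (∑ m ∈ s, F m) 2 volume := by
    refine eLpNorm_mono fun y => ?_
    by_cases hy : floorVec y ∈ s
    · have h1 : (∑ m ∈ s, F m) y = u y := by
        rw [Finset.sum_apply, Finset.sum_eq_single_of_mem _ hy]
        · exact Set.indicator_of_mem (s := {x | x - latticeVec (floorVec y) ∈ unitSquare})
            (sub_floorVec_mem y) u
        · intro m _ hm
          exact Set.indicator_of_notMem (s := {x | x - latticeVec m ∈ unitSquare})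
            (fun h => hm (eq_floorVec_of_sub_mem h)) u
      rw [h1, piece, norm_mul, Complex.norm_real, Real.norm_of_nonneg (bump2_nonneg _)]
      exact mul_le_of_le_one_left (norm_nonneg _) (bump2_le_one _)
    · have h1 : bump2 (y - latticeVec l) = 0 := by
        by_contra hne
        apply hy
        simp only [s, Fintype.mem_piFinset, Finset.mem_insert, Finset.mem_singleton]
        intro i
        by_contra hcon
        apply hne
        refine bump2_eq_zero i ?_
        have h1 := Int.floor_le (y i)
        have h2 := Int.lt_floor_add_one (y i)
        simp only [PiLp.sub_apply, latticeVec_apply, floorVec] at hcon ⊢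
        rw [le_abs]
        rcases lt_or_ge (⌊y i⌋) (l i - 1) with h | h
        · right
          have : (⌊y i⌋ : ℝ) + 2 ≤ l i := by exact_mod_cast (show ⌊y i⌋ + 2 ≤ l i by omega)
          linarith
        · left
          have : (l i : ℝ) + 1 ≤ ⌊y i⌋ := by exact_mod_cast (show l i + 1 ≤ ⌊y i⌋ by omega)
          linarith
      rw [piece, h1]
      simp
  refine hle.trans ((eLpNorm_sum_le (fun m _ => (hc.aestronglyMeasurable.indicator (hmeas m)))
    (by norm_num)).trans ?_)
  have h2 : ∀ m ∈ s, eLpNorm (F m) 2 volume = eLpNorm u 2 (volume.restrict unitSquare) := by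
    intro m _
    rw [eLpNorm_indicator_eq_eLpNorm_restrict (hmeas m)]
    refine eLpNorm_cell m (ae_of_all _ fun x => ?_)
    rw [← ofReal_norm, ← ofReal_norm, hu.norm_add_lattice]
  rw [Finset.sum_congr rfl h2, Finset.sum_const, nsmul_eq_mul]
  gcongr
  have : s.card ≤ 4 := by
    rw [Fintype.card_piFinset]
    simp only [Fin.prod_univ_two]
    calc _ ≤ 2 * 2 := Nat.mul_le_mul Finset.card_le_two Finset.card_le_two
      _ = 4 := rfl
  exact_mod_cast this

/-- The triangle inequality for pointwise convergent series. -/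
lemma eLpNorm_le_tsum {α ι : Type*} [MeasurableSpace α] {μ : Measure α} [Countable ι]
    {F : ι → α → ℂ} {G : α → ℂ} (hF : ∀ i, AEStronglyMeasurable (F i) μ)
    (h : ∀ᵐ x ∂μ, HasSum (fun i => F i x) (G x)) :
    eLpNorm G 2 μ ≤ ∑' i, eLpNorm (F i) 2 μ := by
  refine Lp.eLpNorm_le_of_ae_tendsto (u := (atTop : Filter (Finset ι)))
    (f := fun s => ∑ i ∈ s, F i) (Eventually.of_forall fun s => ?_)
    (fun s => Finset.aestronglyMeasurable_sum s fun i _ => hF i) ?_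
  · exact (eLpNorm_sum_le (fun i _ => hF i) (by norm_num)).trans (ENNReal.sum_le_tsum s)
  · filter_upwards [h] with x hx
    simpa [HasSum] using hx

/-! ### Derivatives and norms of symbols -/

/-- The coordinate directions of `ℝ² × ℝ²`: `inl` in `x`, `inr` in `ξ`. -/
def dir : Fin 2 ⊕ Fin 2 → Plane × Plane
  | Sum.inl j => (EuclideanSpace.single j 1, 0)
  | Sum.inr j => (0, EuclideanSpace.single j 1)

/-- The partial derivative of a symbol in a coordinate direction. -/
def symD (d : Fin 2 ⊕ Fin 2) (a : Plane × Plane → ℂ) : Plane × Plane → ℂ :=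
  fun p => fderiv ℝ a p (dir d)

lemma contDiff_symD {a : Plane × Plane → ℂ} (ha : ContDiff ℝ ∞ a) (d : Fin 2 ⊕ Fin 2) :
    ContDiff ℝ ∞ (symD d a) :=
  (ha.fderiv_right (m := ∞) (by simp)).clm_apply contDiff_const

/-- The supremum norm, with values in `[0, ∞]`. -/
def supE (a : Plane × Plane → ℂ) : ℝ≥0∞ := ⨆ p, ‖a p‖ₑ

lemma le_supE (a : Plane × Plane → ℂ) (p : Plane × Plane) : ‖a p‖ₑ ≤ supE a :=
  le_iSup (fun p => ‖a p‖ₑ) p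

/-- The sum of the supremum norms of the derivatives of `a` along all sublists of a list of
directions. -/
def nrm : List (Fin 2 ⊕ Fin 2) → (Plane × Plane → ℂ) → ℝ≥0∞
  | [], a => supE a
  | d :: L, a => nrm L a + nrm L (symD d a)

lemma nrm_add_le (L : List (Fin 2 ⊕ Fin 2)) {a c : Plane × Plane → ℂ} (ha : ContDiff ℝ ∞ a)
    (hc : ContDiff ℝ ∞ c) : nrm L (fun p => a p + c p) ≤ nrm L a + nrm L c := by
  induction L generalizing a c with
  | nil =>
    exact iSup_le fun p => (enorm_add_le _ _).trans (add_le_add (le_supE a p) (le_supE c p))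
  | cons d L ih =>
    have h : symD d (fun p => a p + c p) = fun p => symD d a p + symD d c p := by
      funext p
      simp only [symD]
      rw [fderiv_fun_add (ha.differentiable (by simp) p) (hc.differentiable (by simp) p)]
      rfl
    simp only [nrm, h]
    refine (add_le_add (ih ha hc) (ih (contDiff_symD ha d) (contDiff_symD hc d))).trans ?_
    rw [add_add_add_comm]

/-- Smooth symbols that are compactly supported in `ξ`. -/
structure IsCptSymbol (a : Plane × Plane → ℂ) : Prop where
  smooth : ContDiff ℝ ∞ a
  periodic : ∀ (m : Fin 2 → ℤ) (x ξ : Plane), a (x + latticeVec m, ξ) = a (x, ξ)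
  cpt : ∃ ρ : ℝ, ∀ x ξ : Plane, ρ < ‖ξ‖ → a (x, ξ) = 0

lemma symD_periodic {a : Plane × Plane → ℂ}
    (ha : ∀ (m : Fin 2 → ℤ) (x ξ : Plane), a (x + latticeVec m, ξ) = a (x, ξ))
    (d : Fin 2 ⊕ Fin 2) (m : Fin 2 → ℤ) (x ξ : Plane) :
    symD d a (x + latticeVec m, ξ) = symD d a (x, ξ) := by
  have h : (fun p : Plane × Plane => a (p + (latticeVec m, 0))) = a := by
    funext p
    change a (p.1 + latticeVec m, p.2 + 0) = a p
    rw [add_zero]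
    exact ha m p.1 p.2
  have h2 := fderiv_comp_add_right (𝕜 := ℝ) (f := a) (x := (x, ξ)) (latticeVec m, (0 : Plane))
  rw [h] at h2
  simp only [symD, h2, Prod.mk_add_mk, add_zero]

lemma IsCptSymbol.symD {a : Plane × Plane → ℂ} (ha : IsCptSymbol a) (d : Fin 2 ⊕ Fin 2) :
    IsCptSymbol (symD d a) where
  smooth := contDiff_symD ha.smooth d
  periodic := symD_periodic ha.periodic d
  cpt := by
    obtain ⟨ρ, hρ⟩ := ha.cpt
    refine ⟨ρ, fun x ξ hξ => ?_⟩
    have ho : IsOpen {p : Plane × Plane | ρ < ‖p.2‖} :=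
      isOpen_lt continuous_const (by fun_prop)
    have h : a =ᶠ[𝓝 (x, ξ)] fun _ => 0 := by
      filter_upwards [ho.mem_nhds (show (x, ξ) ∈ {p : Plane × Plane | ρ < ‖p.2‖} from hξ)] with p hp
      exact hρ p.1 p.2 hp
    simp [MagneticTorus.symD, h.fderiv_eq]

/-- The measure of `𝕋² × ℝ²`. -/
def phaseVol : Measure (Plane × Plane) := (volume.restrict unitSquare).prod volume

lemma phaseVol_eq : (volume.restrict (unitSquare ×ˢ (Set.univ : Set Plane))) = phaseVol := by
  rw [phaseVol, Measure.volume_eq_prod, ← Measure.prod_restrict, Measure.restrict_univ]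

lemma IsCptSymbol.integrable {a : Plane × Plane → ℂ} (ha : IsCptSymbol a)
    {e : Plane × Plane → ℂ} (he : Continuous e) : Integrable (fun p => a p * e p) phaseVol := by
  obtain ⟨ρ, hρ⟩ := ha.cpt
  obtain ⟨K, hK, hs⟩ := unitSquare_subset_compact
  rw [← phaseVol_eq]
  have h1 : IntegrableOn (fun p => a p * e p) (K ×ˢ Metric.closedBall (0 : Plane) ρ) :=
    (ha.smooth.continuous.mul he).continuousOn.integrableOn_compact
      (hK.prod (isCompact_closedBall _ _))
  refine IntegrableOn.of_forall_sdiff_eq_zero h1 (measurableSet_unitSquare.prod MeasurableSet.univ) ?_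
  rintro ⟨x, ξ⟩ ⟨h2, h3⟩
  have : ρ < ‖ξ‖ := by
    by_contra hcon
    exact h3 ⟨hs h2.1, by simpa using hcon⟩
  simp [hρ x ξ this]

/-- The Fourier coefficient in `x` of a symbol. -/
def coeff (a : Plane × Plane → ℂ) (η ξ : Plane) : ℂ :=
  ∫ x in unitSquare, a (x, ξ) * Complex.exp (-Complex.I * (inner ℝ η x : ℝ))

lemma symbolFourier_eq_phaseVol (a : Plane × Plane → ℂ) (η ζ : Plane) :
    symbolFourier a η ζ = ∫ p, a p * (Complex.exp (-Complex.I * (inner ℝ η p.1 : ℝ)) *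
      Complex.exp (-Complex.I * (inner ℝ ζ p.2 : ℝ))) ∂phaseVol := by
  rw [symbolFourier, phaseVol_eq]
  simp only [mul_assoc]

lemma IsCptSymbol.symbolFourier_eq_coeff {a : Plane × Plane → ℂ} (ha : IsCptSymbol a)
    (η ζ : Plane) : symbolFourier a η ζ =
      ∫ ξ, coeff a η ξ * Complex.exp (-Complex.I * (inner ℝ ζ ξ : ℝ)) := by
  rw [symbolFourier_eq_phaseVol, phaseVol, integral_prod_symm]
  · congr 1 with ξ
    rw [coeff, ← integral_mul_const]
    simp only [mul_assoc]
  · exact ha.integrable (e := fun p => Complex.exp (-Complex.I * (inner ℝ η p.1 : ℝ)) *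
      Complex.exp (-Complex.I * (inner ℝ ζ p.2 : ℝ))) (by fun_prop)

lemma IsCptSymbol.symbolFourier_eq_iterated {a : Plane × Plane → ℂ} (ha : IsCptSymbol a)
    (η ζ : Plane) : symbolFourier a η ζ = ∫ x in unitSquare,
      Complex.exp (-Complex.I * (inner ℝ η x : ℝ)) *
        ∫ ξ, a (x, ξ) * Complex.exp (-Complex.I * (inner ℝ ζ ξ : ℝ)) := by
  rw [symbolFourier_eq_phaseVol, phaseVol, integral_prod]
  · congr 1 with x
    rw [← integral_const_mul]
    congr 1 with ξ
    ring
  · exact ha.integrable (e := fun p => Complex.exp (-Complex.I * (inner ℝ η p.1 : ℝ)) *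
      Complex.exp (-Complex.I * (inner ℝ ζ p.2 : ℝ))) (by fun_prop)

/-- Smooth dependence on the parameter is read off from convolutions: the integral is the value at
`0` of the indicator of the square convolved with `y ↦ χ(-y) F(-y, ξ)`, where `χ` is a cutoff equal
to one on the square. The kernel is smooth in `(ξ, y)` with support in a fixed compact set of `y`.
-/
lemma contDiff_setIntegral_unitSquare {F : Plane × Plane → ℂ} (hF : ContDiff ℝ ∞ F) :
    ContDiff ℝ ∞ fun ξ => ∫ x in unitSquare, F (x, ξ) := by
  obtain ⟨K, hK, hs⟩ := unitSquare_subset_compact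
  obtain ⟨χ, hχ, hχc, -, hχ1⟩ : ∃ χ : Plane → ℝ, ContDiff ℝ ∞ χ ∧ HasCompactSupport χ ∧
      (∀ x, 0 ≤ χ x) ∧ ∀ x ∈ K, χ x = 1 := by
    obtain ⟨r, hr⟩ := hK.isBounded.subset_ball (0 : Plane)
    let f : ContDiffBump (0 : Plane) := ⟨max r 1, max r 1 + 1, by positivity, by linarith⟩
    refine ⟨f, f.contDiff, f.hasCompactSupport, fun x => f.nonneg, fun x hx => ?_⟩
    exact f.one_of_mem_closedBall ((Metric.mem_ball.1 (hr hx)).le.trans (le_max_left _ _))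
  let f : Plane → ℂ := unitSquare.indicator fun _ => 1
  let g : Plane → Plane → ℂ := fun ξ y => (χ (-y) : ℂ) * F (-y, ξ)
  have hf : LocallyIntegrable f volume :=
    ((integrable_indicator_iff measurableSet_unitSquare).2
      (integrable_const (1 : ℂ))).locallyIntegrable
  have hg : ContDiffOn ℝ ∞ (Function.uncurry g) (Set.univ ×ˢ Set.univ) := by
    have h1 : ContDiff ℝ ∞ fun p : Plane × Plane => ((χ (-p.2) : ℝ) : ℂ) :=
      Complex.ofRealCLM.contDiff.comp (hχ.comp contDiff_snd.neg)
    exact (h1.mul (hF.comp (contDiff_snd.neg.prodMk contDiff_fst))).contDiffOn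
  obtain ⟨Φ, hΦ⟩ : ∃ Φ : Plane × Plane → ℂ, Φ = fun q =>
      MeasureTheory.convolution f (g q.1) (ContinuousLinearMap.mul ℝ ℂ) volume q.2 := ⟨_, rfl⟩
  have h : ContDiffOn ℝ ((⊤ : ℕ∞) : WithTop ℕ∞) Φ (Set.univ ×ˢ Set.univ) := by
    rw [hΦ]
    refine contDiffOn_convolution_right_with_param (ContinuousLinearMap.mul ℝ ℂ)
      (k := -tsupport χ) isOpen_univ hχc.isCompact.neg ?_ hf hg
    intro p x _ hx
    have : χ (-x) = 0 := image_eq_zero_of_notMem_tsupport fun h => hx (by simpa using h)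
    simp [g, this]
  rw [Set.univ_prod_univ, contDiffOn_univ] at h
  have e : (fun ξ => ∫ x in unitSquare, F (x, ξ)) = fun ξ => Φ (ξ, 0) := by
    funext ξ
    simp only [hΦ, convolution_def]
    rw [← integral_indicator measurableSet_unitSquare]
    congr 1 with x
    by_cases hx : x ∈ unitSquare
    · simp [f, g, hx, hχ1 x (hs hx)]
    · simp [f, hx]
  rw [e]
  exact h.comp (contDiff_id.prodMk contDiff_const)

lemma contDiff_exp_inner (η : Plane) :
    ContDiff ℝ ∞ fun x : Plane => Complex.exp (-Complex.I * (inner ℝ η x : ℝ)) := by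
  have h : ContDiff ℝ ∞ fun x : Plane => ((inner ℝ η x : ℝ) : ℂ) :=
    Complex.ofRealCLM.contDiff.comp (contDiff_const.inner ℝ contDiff_id)
  exact (contDiff_const.mul h).cexp

/-- The Fourier coefficient of a compactly supported symbol as a Schwartz function. -/
def IsCptSymbol.coeffS {a : Plane × Plane → ℂ} (ha : IsCptSymbol a) (η : Plane) :
    SchwartzMap Plane ℂ :=
  HasCompactSupport.toSchwartzMap (f := coeff a η) (by
    obtain ⟨ρ, hρ⟩ := ha.cpt
    refine HasCompactSupport.intro (isCompact_closedBall (0 : Plane) ρ) fun ξ hξ => ?_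
    have : ρ < ‖ξ‖ := by simpa using hξ
    simp [coeff, hρ _ ξ this])
    (contDiff_setIntegral_unitSquare
      (ha.smooth.mul ((contDiff_exp_inner η).comp contDiff_fst)))

lemma IsCptSymbol.coeffS_apply {a : Plane × Plane → ℂ} (ha : IsCptSymbol a) (η ξ : Plane) :
    ha.coeffS η ξ = coeff a η ξ := rfl

lemma enorm_coeff_le (a : Plane × Plane → ℂ) (η ξ : Plane) : ‖coeff a η ξ‖ₑ ≤ supE a := by
  refine (enorm_integral_le_lintegral_enorm _).trans ?_
  calc _ ≤ ∫⁻ _ in unitSquare, supE a := by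
        refine lintegral_mono fun x => ?_
        have h : ‖Complex.exp (-Complex.I * (inner ℝ η x : ℝ))‖ₑ = 1 := by
          have := enorm_exp_I_mul (-inner ℝ η x)
          rw [← this]; congr 2; push_cast; ring
        simp only [enorm_mul, h, mul_one]
        exact le_supE a _
    _ = supE a := by simp

open scoped FourierTransform in
-- The dilation by `(2π)⁻¹` matches the normalization `exp(-2πi ⟨·,·⟩)`. As the transform of a
-- Schwartz function, `symbolFourier a η` is continuous and integrable.
lemma IsCptSymbol.symbolFourier_eq_fourier {a : Plane × Plane → ℂ} (ha : IsCptSymbol a)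
    (η ζ : Plane) : symbolFourier a η ζ = 𝓕 (ha.coeffS η) ((2 * Real.pi)⁻¹ • ζ) := by
  rw [ha.symbolFourier_eq_coeff, SchwartzMap.fourier_coe, Real.fourier_eq']
  congr 1 with ξ
  rw [smul_eq_mul, mul_comm, coeffS_apply]
  congr 2
  rw [inner_smul_right, real_inner_comm]
  push_cast
  have : (Real.pi : ℂ) ≠ 0 := by exact_mod_cast Real.pi_ne_zero
  field_simp

lemma IsCptSymbol.continuous_symbolFourier {a : Plane × Plane → ℂ} (ha : IsCptSymbol a)
    (η : Plane) : Continuous (symbolFourier a η) := by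
  rw [show symbolFourier a η = _ from funext (ha.symbolFourier_eq_fourier η)]
  exact (SchwartzMap.continuous _).comp (continuous_const_smul _)

lemma IsCptSymbol.integrable_symbolFourier {a : Plane × Plane → ℂ} (ha : IsCptSymbol a)
    (η : Plane) : Integrable (symbolFourier a η) := by
  rw [show symbolFourier a η = _ from funext (ha.symbolFourier_eq_fourier η)]
  exact (SchwartzMap.integrable _).comp_smul (by positivity)

/-! ### Integration by parts -/

/-- Integration by parts against the constant function `1`. -/
lemma integral_fderiv_eq_zero_of_compact {f : Plane → ℂ} (hf : ContDiff ℝ ∞ f)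
    (hc : HasCompactSupport f) (v : Plane) : ∫ x, fderiv ℝ f x v = 0 := by
  have h1 : Continuous fun x => fderiv ℝ f x v :=
    (hf.continuous_fderiv (by simp)).clm_apply continuous_const
  have h2 : HasCompactSupport fun x => fderiv ℝ f x v := hc.fderiv_apply ℝ v
  have := integral_bilinear_hasLineDerivAt_right_eq_neg_left_of_integrable (μ := volume)
    (f := fun _ : Plane => (1 : ℂ)) (f' := fun _ => 0) (g := f) (g' := fun x => fderiv ℝ f x v)
    (v := v) (B := ContinuousLinearMap.mul ℝ ℂ) (by simp)
    (by simpa using h1.integrable_of_hasCompactSupport h2)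
    (by simpa using hf.continuous.integrable_of_hasCompactSupport hc)
    (fun x _ => by simpa using (hasFDerivAt_const (𝕜 := ℝ) (1 : ℂ) x).hasLineDerivAt v)
    (fun x _ => ((hf.differentiable (by simp) x).hasFDerivAt).hasLineDerivAt v)
  simpa using this

lemma hasFDerivAt_exp_inner (η x : Plane) :
    HasFDerivAt (fun x : Plane => Complex.exp (-Complex.I * (inner ℝ η x : ℝ)))
      (Complex.exp (-Complex.I * (inner ℝ η x : ℝ)) • (-Complex.I) •
        (Complex.ofRealCLM.comp (innerSL ℝ η))) x := by
  have h : HasFDerivAt (fun x : Plane => ((inner ℝ η x : ℝ) : ℂ))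
      (Complex.ofRealCLM.comp (innerSL ℝ η)) x :=
    (Complex.ofRealCLM.comp (innerSL ℝ η)).hasFDerivAt
  exact (h.const_mul (-Complex.I)).cexp

/-- For fixed `x`, the `ξ_j`-derivative of `a(x, ξ) exp(-i ζ · ξ)` integrates to zero. This exchange
of `ζ_j` for `∂_{ξ_j}` is the source of the decay in `l`. -/
lemma IsCptSymbol.symbolFourier_dXi {a : Plane × Plane → ℂ} (ha : IsCptSymbol a) (j : Fin 2)
    (η ζ : Plane) : symbolFourier (MagneticTorus.symD (Sum.inr j) a) η ζ =
      Complex.I * ζ j * symbolFourier a η ζ := by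
  rw [(ha.symD _).symbolFourier_eq_iterated, ha.symbolFourier_eq_iterated, ← integral_const_mul]
  congr 1 with x
  obtain ⟨ρ, hρ⟩ := ha.cpt
  set E : Plane → ℂ := fun ξ => Complex.exp (-Complex.I * (inner ℝ ζ ξ : ℝ)) with hE
  have hsm : ContDiff ℝ ∞ fun ξ => a (x, ξ) := ha.smooth.comp (contDiff_const.prodMk contDiff_id)
  have hcp : HasCompactSupport fun ξ => a (x, ξ) :=
    HasCompactSupport.intro (isCompact_closedBall (0 : Plane) ρ) fun ξ hξ =>
      hρ x ξ (by simpa using hξ)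
  have h0 := integral_fderiv_eq_zero_of_compact (hsm.mul (contDiff_exp_inner ζ))
    hcp.mul_right (EuclideanSpace.single j 1)
  have hd : ∀ ξ, fderiv ℝ (fun ξ => a (x, ξ) * E ξ) ξ (EuclideanSpace.single j 1) =
      MagneticTorus.symD (Sum.inr j) a (x, ξ) * E ξ -
        Complex.I * ζ j * (a (x, ξ) * E ξ) := by
    intro ξ
    have h1 : HasFDerivAt (fun ξ => a (x, ξ)) ((fderiv ℝ a (x, ξ)).comp
        (ContinuousLinearMap.inr ℝ Plane Plane)) ξ :=
      ((ha.smooth.differentiable (by simp) (x, ξ)).hasFDerivAt).comp ξ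
        (hasFDerivAt_prodMk_right x ξ)
    have h2 : HasFDerivAt (fun ξ => a (x, ξ) * E ξ) _ ξ := h1.mul (hasFDerivAt_exp_inner ζ ξ)
    rw [h2.fderiv]
    simp [MagneticTorus.symD, dir, hE, EuclideanSpace.inner_single_right]
    ring
  have hi1 : Integrable fun ξ => MagneticTorus.symD (Sum.inr j) a (x, ξ) * E ξ := by
    obtain ⟨ρ', hρ'⟩ := (ha.symD (Sum.inr j)).cpt
    refine Continuous.integrable_of_hasCompactSupport ?_ (HasCompactSupport.mul_right ?_)
    · exact ((ha.symD (Sum.inr j)).smooth.continuous.comp (by fun_prop)).mul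
        (contDiff_exp_inner ζ).continuous
    · exact HasCompactSupport.intro (isCompact_closedBall (0 : Plane) ρ') fun ξ hξ =>
        hρ' x ξ (by simpa using hξ)
  have hi2 : Integrable fun ξ => a (x, ξ) * E ξ :=
    (hsm.continuous.mul (contDiff_exp_inner ζ).continuous).integrable_of_hasCompactSupport
      hcp.mul_right
  rw [integral_congr_ae (ae_of_all _ hd), integral_sub hi1 (hi2.const_mul _),
    integral_const_mul, sub_eq_zero] at h0
  rw [h0]
  ring

/-- Divergence theorem on the unit box for the field `G e_j`: the contributions of opposite faces
cancel by periodicity. -/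
lemma integral_unitSquare_fderiv_eq_zero {G : Plane → ℂ} (hG : ContDiff ℝ ∞ G)
    (hp : ∀ (m : Fin 2 → ℤ) (x : Plane), G (x + latticeVec m) = G x) (j : Fin 2) :
    ∫ x in unitSquare, fderiv ℝ G x (EuclideanSpace.single j 1) = 0 := by
  let L : (Fin 2 → ℝ) ≃L[ℝ] Plane := (EuclideanSpace.equiv (Fin 2) ℝ).symm
  have hGd : ∀ x, HasFDerivAt G (fderiv ℝ G x) x := fun x =>
    (hG.differentiable (by simp) x).hasFDerivAt
  have hcont : Continuous fun y : Fin 2 → ℝ => fderiv ℝ G (L y) (EuclideanSpace.single j 1) :=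
    ((hG.continuous_fderiv (by simp)).clm_apply continuous_const).comp L.continuous
  have h1 : ∫ x in unitSquare, fderiv ℝ G x (EuclideanSpace.single j 1) =
      ∫ y in Set.Icc (0 : Fin 2 → ℝ) 1, fderiv ℝ G (L y) (EuclideanSpace.single j 1) := by
    have hs : unitSquare = (MeasurableEquiv.toLp 2 (Fin 2 → ℝ)).symm ⁻¹'
        (Set.univ.pi fun _ => Set.Ico (0 : ℝ) 1) := by
      ext x; simp [unitSquare]
    have h2 := (EuclideanSpace.volume_preserving_symm_measurableEquiv_toLp
      (Fin 2)).setIntegral_preimage_emb (MeasurableEquiv.measurableEmbedding _)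
      (fun y : Fin 2 → ℝ => fderiv ℝ G (L y) (EuclideanSpace.single j 1))
      (Set.univ.pi fun _ => Set.Ico (0 : ℝ) 1)
    rw [← hs] at h2
    refine Eq.trans ?_ (h2.trans ?_)
    · rfl
    · refine setIntegral_congr_set ?_
      exact Measure.univ_pi_Ico_ae_eq_Icc (f := (0 : Fin 2 → ℝ)) (g := 1)
  rw [h1]
  have h2 := integral_divergence_of_hasFDerivAt_off_countable' (n := 1) (E := ℂ)
    (0 : Fin 2 → ℝ) 1 (fun i => zero_le_one)
    (fun i y => if i = j then G (L y) else 0)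
    (fun i y => if i = j then (fderiv ℝ G (L y)).comp (L : (Fin 2 → ℝ) →L[ℝ] Plane) else 0)
    ∅ Set.countable_empty ?_ ?_ ?_
  · have hL : L (Pi.single j 1) = EuclideanSpace.single j (1 : ℝ) := rfl
    have h3 : ∀ y : Fin 2 → ℝ, (∑ i : Fin (1 + 1), (if i = j then (fderiv ℝ G (L y)).comp
        (L : (Fin 2 → ℝ) →L[ℝ] Plane) else 0) (Pi.single i 1)) =
        fderiv ℝ G (L y) (EuclideanSpace.single j 1) := by
      intro y
      rw [Finset.sum_eq_single j]
      · simp [hL]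
      · intro i _ hi; simp [hi]
      · simp
    simp only [h3] at h2
    rw [h2]
    refine Finset.sum_eq_zero fun i _ => ?_
    rw [sub_eq_zero]
    congr 1 with y
    by_cases hij : i = j
    · subst hij
      simp only [if_true]
      have := hp (Pi.single i 1) (L (i.insertNth (0 : ℝ) y))
      rw [latticeVec_single, ← hL, ← map_add] at this
      simp only [Pi.zero_apply, Pi.one_apply]
      rw [← this]
      congr 2
      refine funext fun k => ?_
      by_cases hk : k = i
      · subst hk; simp
      · obtain ⟨k', rfl⟩ := Fin.exists_succAbove_eq hk
        simp
    · simp [hij]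
  · intro i
    by_cases hij : i = j
    · simp only [hij, if_true]
      exact (hG.continuous.comp L.continuous).continuousOn
    · simp only [hij, if_false]
      exact continuousOn_const
  · intro y _ i
    by_cases hij : i = j
    · simp only [hij, if_true]
      exact (hGd (L y)).comp y L.hasFDerivAt
    · simp only [hij, if_false]
      exact hasFDerivAt_const _ _
  · refine Continuous.integrableOn_Icc ?_
    refine continuous_finsetSum _ fun i _ => ?_
    by_cases hij : i = j
    · simp only [hij, if_true]
      exact ((((hG.continuous_fderiv (by simp)).comp L.continuous).clm_comp continuous_const).clm_apply continuous_const)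
    · simp only [hij, if_false]
      exact continuous_const

lemma inner_freq_latticeVec (k m : Fin 2 → ℤ) :
    inner ℝ (freq k) (latticeVec m) = ((k 0 * m 0 + k 1 * m 1 : ℤ) : ℝ) * (2 * Real.pi) := by
  simp [freq, PiLp.inner_apply, Fin.sum_univ_two, latticeVec_apply]
  ring

lemma exp_freq_add_lattice (k m : Fin 2 → ℤ) (x : Plane) :
    Complex.exp (-Complex.I * (inner ℝ (freq k) (x + latticeVec m) : ℝ)) =
      Complex.exp (-Complex.I * (inner ℝ (freq k) x : ℝ)) := by
  rw [inner_add_right, inner_freq_latticeVec, Complex.exp_eq_exp_iff_exists_int]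
  refine ⟨-(k 0 * m 0 + k 1 * m 1), ?_⟩
  push_cast
  ring

/-- Integration by parts on the torus. There is no boundary term because `exp(-i η · x)` is periodic
for `η = freq k`; this is the source of the decay in `k`. -/
lemma IsCptSymbol.symbolFourier_dX {a : Plane × Plane → ℂ} (ha : IsCptSymbol a) (j : Fin 2)
    (k : Fin 2 → ℤ) (ζ : Plane) : symbolFourier (MagneticTorus.symD (Sum.inl j) a) (freq k) ζ =
      Complex.I * (2 * Real.pi * k j) * symbolFourier a (freq k) ζ := by
  rw [(ha.symD _).symbolFourier_eq_coeff, ha.symbolFourier_eq_coeff, ← integral_const_mul]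
  congr 1 with ξ
  rw [← mul_assoc]
  congr 1
  set E : Plane → ℂ := fun x => Complex.exp (-Complex.I * (inner ℝ (freq k) x : ℝ)) with hE
  have hsm : ContDiff ℝ ∞ fun x => a (x, ξ) := ha.smooth.comp (contDiff_id.prodMk contDiff_const)
  have h0 := integral_unitSquare_fderiv_eq_zero (hsm.mul (contDiff_exp_inner (freq k)))
    (fun m x => by simp only [ha.periodic, exp_freq_add_lattice]) j
  have hd : ∀ x, fderiv ℝ (fun x => a (x, ξ) * E x) x (EuclideanSpace.single j 1) =
      MagneticTorus.symD (Sum.inl j) a (x, ξ) * E x -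
        Complex.I * (2 * Real.pi * k j) * (a (x, ξ) * E x) := by
    intro x
    have h1 : HasFDerivAt (fun x => a (x, ξ)) ((fderiv ℝ a (x, ξ)).comp
        (ContinuousLinearMap.inl ℝ Plane Plane)) x :=
      ((ha.smooth.differentiable (by simp) (x, ξ)).hasFDerivAt).comp x
        (hasFDerivAt_prodMk_left x ξ)
    have h2 : HasFDerivAt (fun x => a (x, ξ) * E x) _ x :=
      h1.mul (hasFDerivAt_exp_inner (freq k) x)
    rw [h2.fderiv]
    simp [MagneticTorus.symD, dir, hE, EuclideanSpace.inner_single_right, freq, latticeVec_apply]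
    ring
  obtain ⟨K, hK, hs⟩ := unitSquare_subset_compact
  have hi : ∀ {f : Plane → ℂ}, Continuous f → IntegrableOn f unitSquare := fun hf =>
    (hf.continuousOn.integrableOn_compact hK).mono_set hs
  have hi1 : IntegrableOn (fun x => MagneticTorus.symD (Sum.inl j) a (x, ξ) * E x) unitSquare :=
    hi (((ha.symD (Sum.inl j)).smooth.continuous.comp (by fun_prop)).mul
        (contDiff_exp_inner _).continuous)
  have hi2 : IntegrableOn (fun x => a (x, ξ) * E x) unitSquare :=
    hi (hsm.continuous.mul (contDiff_exp_inner _).continuous)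
  rw [integral_congr_ae (ae_of_all _ hd), integral_sub hi1 (hi2.const_mul _),
    integral_const_mul, sub_eq_zero] at h0
  exact h0

/-! ### The terms of the quantization series for `h = 1` -/

/-- The phase of the Weyl operator with `h = 1`. -/
def weylPhase (b : ℝ) (η x ζ : Plane) : ℂ :=
  Complex.exp (Complex.I * (b / 2 * wedge ζ x : ℝ)) *
    Complex.exp (Complex.I * (inner ℝ η (x + (1 / 2 : ℝ) • ζ) : ℝ))

lemma quantIntegrand_one (b : ℝ) (a : Plane × Plane → ℂ) (w : Plane → ℂ) (x η ζ : Plane) :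
    quantIntegrand 1 b a w x η ζ = symbolFourier a η ζ * (weylPhase b η x ζ * w (x + ζ)) := by
  simp [quantIntegrand, weylOp, weylPhase]

lemma norm_weylPhase (b : ℝ) (η x ζ : Plane) : ‖weylPhase b η x ζ‖ = 1 := by
  rw [weylPhase, norm_mul, norm_exp_I_mul, norm_exp_I_mul, one_mul]

@[fun_prop]
lemma continuous_weylPhase (b : ℝ) (η : Plane) {X : Type*} [TopologicalSpace X] {f g : X → Plane}
    (hf : Continuous f) (hg : Continuous g) : Continuous fun z => weylPhase b η (f z) (g z) := by
  unfold weylPhase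
  fun_prop

lemma contDiff_weylPhase (b : ℝ) (η x : Plane) : ContDiff ℝ ∞ (weylPhase b η x) := by
  have h1 : ContDiff ℝ ∞ fun ζ : Plane => ((b / 2 * wedge ζ x : ℝ) : ℂ) :=
    Complex.ofRealCLM.contDiff.comp (contDiff_const.mul (contDiff_wedge_left x))
  have h3 : ContDiff ℝ ∞ fun ζ : Plane => x + (1 / 2 : ℝ) • ζ :=
    contDiff_const.add (contDiff_id.const_smul _)
  have h4 : ContDiff ℝ ∞ fun ζ : Plane => (inner ℝ η (x + (1 / 2 : ℝ) • ζ) : ℝ) :=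
    contDiff_const.inner ℝ h3
  have h2 : ContDiff ℝ ∞ fun ζ : Plane => ((inner ℝ η (x + (1 / 2 : ℝ) • ζ) : ℝ) : ℂ) :=
    Complex.ofRealCLM.contDiff.comp h4
  have h5 : ContDiff ℝ ∞ fun ζ : Plane => Complex.exp (Complex.I * (b / 2 * wedge ζ x : ℝ)) :=
    (contDiff_const.mul h1).cexp
  have h6 : ContDiff ℝ ∞ fun ζ : Plane =>
      Complex.exp (Complex.I * (inner ℝ η (x + (1 / 2 : ℝ) • ζ) : ℝ)) :=
    (contDiff_const.mul h2).cexp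
  exact h5.mul h6

/-- The term with frequency `k` of the quantization series, for `h = 1`. -/
def quantTerm (b : ℝ) (a : Plane × Plane → ℂ) (w : Plane → ℂ) (k : Fin 2 → ℤ) (x : Plane) : ℂ :=
  ∫ ζ, quantIntegrand 1 b a w x (freq k) ζ

lemma IsCptSymbol.integrable_quantIntegrand {a : Plane × Plane → ℂ} (ha : IsCptSymbol a) (b : ℝ)
    {w : Plane → ℂ} (hw : Continuous w) (hb : ∃ C : ℝ, ∀ y, ‖w y‖ ≤ C) (x η : Plane) :
    Integrable (quantIntegrand 1 b a w x η) := by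
  obtain ⟨C, hC⟩ := hb
  rw [show quantIntegrand 1 b a w x η = _ from funext (quantIntegrand_one b a w x η)]
  refine (ha.integrable_symbolFourier η).mul_bdd (c := C) ?_ (ae_of_all _ fun ζ => ?_)
  · exact Continuous.aestronglyMeasurable (by fun_prop)
  · rw [norm_mul, norm_weylPhase, one_mul]
    exact hC _

lemma IsCptSymbol.stronglyMeasurable_quantTerm {a : Plane × Plane → ℂ} (ha : IsCptSymbol a)
    (b : ℝ) {w : Plane → ℂ} (hw : Continuous w) (k : Fin 2 → ℤ) :
    StronglyMeasurable (quantTerm b a w k) := by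
  have hS := ha.continuous_symbolFourier (freq k)
  have h : Continuous fun p : Plane × Plane => quantIntegrand 1 b a w p.1 (freq k) p.2 := by
    simp only [quantIntegrand_one]
    exact (hS.comp continuous_snd).mul ((continuous_weylPhase b _ continuous_fst
      continuous_snd).mul (hw.comp (continuous_fst.add continuous_snd)))
  exact h.stronglyMeasurable.integral_prod_right'

lemma IsCptSymbol.quantTerm_dX {a : Plane × Plane → ℂ} (ha : IsCptSymbol a) (b : ℝ)
    (w : Plane → ℂ) (j : Fin 2) (k : Fin 2 → ℤ) (x : Plane) :
    quantTerm b (MagneticTorus.symD (Sum.inl j) a) w k x =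
      Complex.I * (2 * Real.pi * k j) * quantTerm b a w k x := by
  rw [quantTerm, quantTerm, ← integral_const_mul]
  congr 1 with ζ
  rw [quantIntegrand, ha.symbolFourier_dX, quantIntegrand, mul_assoc]

/-- With `y = x + ζ` the point where `w` is evaluated, `l_j = ζ_j + x_j - (y_j - l_j)`, and `ζ_j`
times the Fourier transform of the symbol is that of `-i ∂_{ξ_j} a`. When `w` is supported near `l`,
the weight `y_j - l_j` is harmless, so a power of `l_j` costs one derivative in `ξ_j`. -/
lemma IsCptSymbol.quantTerm_lattice {a : Plane × Plane → ℂ} (ha : IsCptSymbol a) (b : ℝ)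
    {w : Plane → ℂ} (hw : Continuous w) (hc : HasCompactSupport w) (j : Fin 2)
    (l k : Fin 2 → ℤ) (x : Plane) :
    (l j : ℂ) * quantTerm b a w k x =
      -Complex.I * quantTerm b (MagneticTorus.symD (Sum.inr j) a) w k x +
        x j * quantTerm b a w k x -
        quantTerm b a (fun y => ((y j - l j : ℝ) : ℂ) * w y) k x := by
  have hb : ∀ {v : Plane → ℂ}, Continuous v → HasCompactSupport v → ∃ C : ℝ, ∀ y, ‖v y‖ ≤ C :=
    fun hv hs => hv.bounded_above_of_compact_support hs |>.imp fun C hC y => hC y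
  have hw' : Continuous fun y : Plane => ((y j - l j : ℝ) : ℂ) * w y := by fun_prop
  have i1 := (ha.symD (Sum.inr j)).integrable_quantIntegrand b hw (hb hw hc) x (freq k)
  have i2 := ha.integrable_quantIntegrand b hw (hb hw hc) x (freq k)
  have i3 := ha.integrable_quantIntegrand b hw' (hb hw' hc.mul_left) x (freq k)
  have i4 : Integrable fun ζ =>
      -Complex.I * quantIntegrand 1 b (MagneticTorus.symD (Sum.inr j) a) w x (freq k) ζ +
        x j * quantIntegrand 1 b a w x (freq k) ζ := (i1.const_mul _).add (i2.const_mul _)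
  simp only [quantTerm]
  rw [← integral_const_mul, ← integral_const_mul, ← integral_const_mul,
    ← integral_add (i1.const_mul _) (i2.const_mul _), ← integral_sub i4 i3]
  congr 1 with ζ
  simp only [quantIntegrand_one, ha.symbolFourier_dXi, PiLp.add_apply]
  push_cast
  linear_combination ((ζ j : ℂ) * symbolFourier a (freq k) ζ *
    (weylPhase b (freq k) x ζ * w (x + ζ))) * Complex.I_sq

/-! ### The terms as integrals over phase space -/

/-- The unnormalized Fourier transform. -/
def planeFourier (F : Plane → ℂ) (ξ : Plane) : ℂ :=
  ∫ ζ, F ζ * Complex.exp (-Complex.I * (inner ℝ ζ ξ : ℝ))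

open scoped FourierTransform in
lemma planeFourier_eq (F : Plane → ℂ) (ξ : Plane) :
    planeFourier F ξ = 𝓕 F ((2 * Real.pi)⁻¹ • ξ) := by
  rw [Real.fourier_eq', planeFourier]
  congr 1 with ζ
  rw [smul_eq_mul, mul_comm]
  congr 2
  rw [inner_smul_right]
  push_cast
  have : (Real.pi : ℂ) ≠ 0 := by exact_mod_cast Real.pi_ne_zero
  field_simp

lemma planeFourier_integrable {F : Plane → ℂ} (hF : ContDiff ℝ ∞ F) (hc : HasCompactSupport F) :
    Integrable (planeFourier F) := by
  have h : planeFourier F = fun ξ =>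
      (FourierTransform.fourier (hc.toSchwartzMap hF)) ((2 * Real.pi)⁻¹ • ξ) := by
    funext ξ
    rw [planeFourier_eq]; rfl
  rw [h]
  exact (SchwartzMap.integrable _).comp_smul (by positivity)

instance : SFinite phaseVol := by
  unfold phaseVol; infer_instance

lemma norm_exp_neg_I_mul (t : ℝ) : ‖Complex.exp (-Complex.I * (t : ℂ))‖ = 1 := by
  rw [← norm_exp_I_mul (-t)]; congr 2; push_cast; ring

/-- Fubini moves the Fourier transform from the symbol to `F`. When `planeFourier F` is integrable,
the right-hand side makes sense for every bounded continuous symbol, which is the form that survives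
the limit of the truncations. -/
lemma IsCptSymbol.integral_symbolFourier_mul {a : Plane × Plane → ℂ} (ha : IsCptSymbol a)
    (η : Plane) {F : Plane → ℂ} (hF : Continuous F) (hi : Integrable F) :
    ∫ ζ, symbolFourier a η ζ * F ζ =
      ∫ p, a p * (Complex.exp (-Complex.I * (inner ℝ η p.1 : ℝ)) * planeFourier F p.2)
        ∂phaseVol := by
  have hac := ha.smooth.continuous
  have h1 : Integrable a phaseVol := by
    simpa using ha.integrable (e := fun _ => 1) continuous_const
  have h2 : Integrable (Function.uncurry fun (ζ : Plane) (p : Plane × Plane) =>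
      a p * (Complex.exp (-Complex.I * (inner ℝ η p.1 : ℝ)) *
        Complex.exp (-Complex.I * (inner ℝ ζ p.2 : ℝ))) * F ζ) (volume.prod phaseVol) := by
    refine (hi.mul_prod h1).mono ?_ (ae_of_all _ fun z => ?_)
    · have : Continuous (Function.uncurry fun (ζ : Plane) (p : Plane × Plane) =>
          a p * (Complex.exp (-Complex.I * (inner ℝ η p.1 : ℝ)) *
            Complex.exp (-Complex.I * (inner ℝ ζ p.2 : ℝ))) * F ζ) := by
        unfold Function.uncurry
        fun_prop
      exact this.aestronglyMeasurable
    · simp only [Function.uncurry, norm_mul, norm_exp_neg_I_mul]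
      rw [mul_one, mul_one, mul_comm]
  have h3 := integral_integral_swap h2
  simp only [symbolFourier_eq_phaseVol, ← integral_mul_const]
  rw [h3]
  congr 1 with p
  rw [planeFourier, ← integral_const_mul, ← integral_const_mul]
  congr 1 with ζ
  ring

/-- The function whose Fourier transform is tested against the symbol. -/
def testFun (b : ℝ) (w : Plane → ℂ) (k : Fin 2 → ℤ) (x ζ : Plane) : ℂ :=
  weylPhase b (freq k) x ζ * w (x + ζ)

lemma contDiff_testFun (b : ℝ) {w : Plane → ℂ} (hw : ContDiff ℝ ∞ w) (k : Fin 2 → ℤ) (x : Plane) :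
    ContDiff ℝ ∞ (testFun b w k x) :=
  (contDiff_weylPhase b _ x).mul (hw.comp (contDiff_const.add contDiff_id))

lemma hasCompactSupport_testFun (b : ℝ) {w : Plane → ℂ} (hw : HasCompactSupport w)
    (k : Fin 2 → ℤ) (x : Plane) : HasCompactSupport (testFun b w k x) :=
  (hw.comp_homeomorph (Homeomorph.addLeft x)).mul_left

/-- The term of the quantization series as an integral over phase space. -/
def phaseTerm (b : ℝ) (a : Plane × Plane → ℂ) (w : Plane → ℂ) (k : Fin 2 → ℤ) (x : Plane) : ℂ :=
  ∫ p, a p * (Complex.exp (-Complex.I * (inner ℝ (freq k) p.1 : ℝ)) *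
    planeFourier (testFun b w k x) p.2) ∂phaseVol

lemma IsCptSymbol.quantTerm_eq_phaseTerm {a : Plane × Plane → ℂ} (ha : IsCptSymbol a) (b : ℝ)
    {w : Plane → ℂ} (hw : ContDiff ℝ ∞ w) (hc : HasCompactSupport w) (k : Fin 2 → ℤ)
    (x : Plane) : quantTerm b a w k x = phaseTerm b a w k x := by
  simp only [quantTerm, quantIntegrand_one]
  exact ha.integral_symbolFourier_mul (freq k) (contDiff_testFun b hw k x).continuous
    ((contDiff_testFun b hw k x).continuous.integrable_of_hasCompactSupport
      (hasCompactSupport_testFun b hc k x))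

/-- The phase space integrand converges absolutely. -/
lemma integrable_planeFourier_snd {F : Plane → ℂ} (hF : Integrable F) :
    Integrable (fun p : Plane × Plane => F p.2) phaseVol := by
  have := (integrable_const (μ := volume.restrict unitSquare) (1 : ℂ)).mul_prod hF
  simpa [phaseVol] using this

lemma lintegral_snd_phaseVol {F : Plane → ℝ≥0∞} (hF : AEMeasurable F) :
    ∫⁻ p, F p.2 ∂phaseVol = ∫⁻ ξ, F ξ := by
  have := lintegral_prod_mul (μ := volume.restrict unitSquare) (ν := (volume : Measure Plane))
    (f := fun _ => 1) (g := F) aemeasurable_const hF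
  simpa [phaseVol] using this

lemma enorm_exp_neg_I_mul (t : ℝ) : ‖Complex.exp (-Complex.I * (t : ℂ))‖ₑ = 1 := by
  rw [← ofReal_norm, norm_exp_neg_I_mul, ENNReal.ofReal_one]

lemma enorm_phaseTerm_le (b : ℝ) (a : Plane × Plane → ℂ) {w : Plane → ℂ} (hw : ContDiff ℝ ∞ w)
    (hc : HasCompactSupport w) (k : Fin 2 → ℤ) (x : Plane) :
    ‖phaseTerm b a w k x‖ₑ ≤ (∫⁻ ξ, ‖planeFourier (testFun b w k x) ξ‖ₑ) * supE a := by
  have hi := planeFourier_integrable (contDiff_testFun b hw k x)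
    (hasCompactSupport_testFun b hc k x)
  refine (enorm_integral_le_lintegral_enorm _).trans ?_
  calc _ ≤ ∫⁻ p, ‖planeFourier (testFun b w k x) p.2‖ₑ * supE a ∂phaseVol := by
        refine lintegral_mono fun p => ?_
        rw [enorm_mul, enorm_mul, enorm_exp_neg_I_mul, one_mul, mul_comm]
        gcongr
        exact le_supE a p
    _ = _ := by
        rw [lintegral_mul_const'' _ (integrable_planeFourier_snd hi).aestronglyMeasurable.enorm,
          lintegral_snd_phaseVol hi.aestronglyMeasurable.enorm]

/-- Invariance of the `L¹` norm of the Fourier transform under modulation and translation. -/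
lemma lintegral_planeFourier_modulate {F G : Plane → ℂ} {c : ℂ} (hc : ‖c‖ₑ = 1) (ν y : Plane)
    (h : ∀ ζ, F ζ = c * Complex.exp (Complex.I * (inner ℝ ν ζ : ℝ)) * G (ζ + y)) :
    ∫⁻ ξ, ‖planeFourier F ξ‖ₑ = ∫⁻ ξ, ‖planeFourier G ξ‖ₑ := by
  -- The modulation by `ν` translates the Fourier transform; the translation by `y` multiplies it by
  -- a unimodular factor.
  have e : ∀ ξ, ‖planeFourier F ξ‖ₑ = ‖planeFourier G (ξ - ν)‖ₑ := by
    intro ξ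
    have h1 : planeFourier F ξ = (c * Complex.exp (Complex.I * (inner ℝ y (ξ - ν) : ℝ))) *
        planeFourier G (ξ - ν) := by
      have h2 := integral_add_right_eq_self (μ := (volume : Measure Plane)) (fun ζ =>
        (c * Complex.exp (Complex.I * (inner ℝ y (ξ - ν) : ℝ))) *
          (G ζ * Complex.exp (-Complex.I * (inner ℝ ζ (ξ - ν) : ℝ)))) y
      rw [planeFourier, planeFourier, ← integral_const_mul, ← h2]
      congr 1 with ζ
      rw [h ζ]
      have : Complex.exp (Complex.I * (inner ℝ ν ζ : ℝ)) *
          Complex.exp (-Complex.I * (inner ℝ ζ ξ : ℝ)) =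
          Complex.exp (Complex.I * (inner ℝ y (ξ - ν) : ℝ)) *
            Complex.exp (-Complex.I * (inner ℝ (ζ + y) (ξ - ν) : ℝ)) := by
        rw [← Complex.exp_add, ← Complex.exp_add]
        congr 1
        rw [inner_add_left, inner_sub_right ζ, real_inner_comm ν ζ]
        push_cast
        ring
      linear_combination c * G (ζ + y) * this
    rw [h1, enorm_mul, enorm_mul, hc, enorm_exp_I_mul, one_mul, one_mul]
  simp only [e]
  exact lintegral_sub_right_eq_self (fun ξ => ‖planeFourier G ξ‖ₑ) ν

/-! ### The `L²` bound of a single term -/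

lemma IsCptSymbol.supE_lt_top {a : Plane × Plane → ℂ} (ha : IsCptSymbol a) : supE a < ⊤ := by
  obtain ⟨ρ, hρ⟩ := ha.cpt
  obtain ⟨K, hK, hs⟩ := unitSquare_subset_compact
  obtain ⟨C, hC⟩ := (hK.prod (isCompact_closedBall (0 : Plane) ρ)).exists_bound_of_continuousOn
    ha.smooth.continuous.continuousOn
  refine lt_of_le_of_lt (iSup_le fun p => ?_) (ENNReal.ofReal_lt_top (r := max C 0))
  rw [← ofReal_norm]
  refine ENNReal.ofReal_le_ofReal ?_
  rcases lt_or_ge ρ ‖p.2‖ with h | h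
  · rw [show a p = 0 from hρ p.1 p.2 h, norm_zero]
    exact le_max_right _ _
  · have h1 := ha.periodic (floorVec p.1) (p.1 - latticeVec (floorVec p.1)) p.2
    rw [sub_add_cancel] at h1
    rw [show a p = _ from h1]
    exact (hC _ ⟨hs (sub_floorVec_mem _), by simpa using h⟩).trans (le_max_left _ _)

lemma eLpNorm_fourier (f : SchwartzMap Plane ℂ) :
    eLpNorm (FourierTransform.fourier f : SchwartzMap Plane ℂ) 2 volume = eLpNorm f 2 volume := by
  have h := SchwartzMap.norm_fourier_toL2_eq f
  generalize FourierTransform.fourier f = g at h ⊢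
  rw [SchwartzMap.norm_toLp, SchwartzMap.norm_toLp] at h
  have h1 : eLpNorm f 2 volume ≠ ⊤ := (f.memLp 2 volume).2.ne
  have h2 : eLpNorm g 2 volume ≠ ⊤ := (g.memLp 2 volume).2.ne
  exact (ENNReal.toReal_eq_toReal_iff' h2 h1).1 h

lemma eLpNorm_fourierInv (f : SchwartzMap Plane ℂ) :
    eLpNorm (FourierTransformInv.fourierInv f : SchwartzMap Plane ℂ) 2 volume =
      eLpNorm f 2 volume := by
  have h := eLpNorm_fourier (FourierTransformInv.fourierInv f : SchwartzMap Plane ℂ)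
  rw [FourierTransform.fourier_fourierInv_eq] at h
  exact h.symm

lemma eLpNorm_of_eq_smul {R : ℝ} (hR : 0 ≤ R) {f g : Plane → ℂ} (h : ∀ x, f x = R • g x) :
    eLpNorm f 2 volume = ENNReal.ofReal R * eLpNorm g 2 volume := by
  rw [show f = R • g from funext h, eLpNorm_const_smul, Real.enorm_eq_ofReal hR]

/-- The twisted convolution operators without twist are Fourier multipliers. -/
lemma IsCptSymbol.eLpNorm_multiplier_le {a : Plane × Plane → ℂ} (ha : IsCptSymbol a) (η : Plane)
    {w : Plane → ℂ} (hw : ContDiff ℝ ∞ w) (hc : HasCompactSupport w) :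
    eLpNorm (fun x => ∫ ζ, symbolFourier a η ζ * w (x + ζ)) 2 volume ≤
      ENNReal.ofReal ((2 * Real.pi) ^ 2) * supE a * eLpNorm w 2 volume := by
  obtain ⟨ρ, hρ⟩ := ha.cpt
  have h2π : 0 < 2 * Real.pi := by positivity
  let W : SchwartzMap Plane ℂ := hc.toSchwartzMap hw
  let FW : SchwartzMap Plane ℂ := FourierTransform.fourier W
  let g : Plane → ℂ := fun t => coeff a η ((2 * Real.pi) • t) * FW t
  have hgs : ContDiff ℝ ∞ g := by
    have h1 : ContDiff ℝ ∞ fun t : Plane => ha.coeffS η ((2 * Real.pi) • t) :=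
      ((ha.coeffS η).smooth ⊤).comp (contDiff_id.const_smul (2 * Real.pi))
    exact h1.mul (FW.smooth ⊤)
  have hgc : HasCompactSupport g := by
    refine HasCompactSupport.intro (isCompact_closedBall (0 : Plane) (ρ / (2 * Real.pi)))
      fun t ht => ?_
    have : ρ < ‖(2 * Real.pi) • t‖ := by
      rw [norm_smul, Real.norm_of_nonneg h2π.le, ← div_lt_iff₀' h2π]
      simpa using ht
    simp [g, coeff, hρ _ _ this]
  let H : SchwartzMap Plane ℂ := hgc.toSchwartzMap hgs
  -- Fubini and translation of `ζ` rewrite the operator as `∫ coeff a η ξ exp(i x · ξ) ŵ(ξ) dξ`. The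
  -- substitution `ξ = 2πt` then gives the inverse Fourier transform of `H`, with Jacobian `(2π)²`.
  have key : ∀ x, ∫ ζ, symbolFourier a η ζ * w (x + ζ) =
      ((2 * Real.pi) ^ 2 : ℝ) • (FourierTransformInv.fourierInv H : SchwartzMap Plane ℂ) x := by
    intro x
    have hS : Integrable (fun ξ => coeff a η ξ) := (ha.coeffS η).integrable
    have hSc : Continuous (fun ξ => coeff a η ξ) := (ha.coeffS η).continuous
    have hwx : Integrable (fun ζ => w (x + ζ)) :=
      (hw.continuous.integrable_of_hasCompactSupport hc).comp_add_left x
    have hwc := hw.continuous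
    have h2 : Integrable (Function.uncurry fun (ζ ξ : Plane) =>
        coeff a η ξ * Complex.exp (-Complex.I * (inner ℝ ζ ξ : ℝ)) * w (x + ζ))
        (volume.prod volume) := by
      refine (hwx.mul_prod hS).mono ?_ (ae_of_all _ fun z => ?_)
      · have : Continuous (Function.uncurry fun (ζ ξ : Plane) =>
            coeff a η ξ * Complex.exp (-Complex.I * (inner ℝ ζ ξ : ℝ)) * w (x + ζ)) := by
          unfold Function.uncurry
          fun_prop
        exact this.aestronglyMeasurable
      · simp only [Function.uncurry, norm_mul, norm_exp_neg_I_mul]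
        rw [mul_one, mul_comm]
    simp only [ha.symbolFourier_eq_coeff, ← integral_mul_const]
    rw [integral_integral_swap h2]
    have h3 : ∀ ξ, ∫ ζ, coeff a η ξ * Complex.exp (-Complex.I * (inner ℝ ζ ξ : ℝ)) * w (x + ζ) =
        coeff a η ξ * Complex.exp (Complex.I * (inner ℝ x ξ : ℝ)) *
          FW ((2 * Real.pi)⁻¹ • ξ) := by
      intro ξ
      have h4 : FW ((2 * Real.pi)⁻¹ • ξ) = planeFourier w ξ := (planeFourier_eq w ξ).symm
      rw [h4, planeFourier, ← integral_const_mul,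
        ← integral_add_left_eq_self (fun ζ => coeff a η ξ * Complex.exp (Complex.I * (inner ℝ x ξ : ℝ)) *
          (w ζ * Complex.exp (-Complex.I * (inner ℝ ζ ξ : ℝ)))) x]
      congr 1 with ζ
      have : Complex.exp (-Complex.I * (inner ℝ ζ ξ : ℝ)) =
          Complex.exp (Complex.I * (inner ℝ x ξ : ℝ)) *
            Complex.exp (-Complex.I * (inner ℝ (x + ζ) ξ : ℝ)) := by
        rw [← Complex.exp_add, inner_add_left]
        congr 1
        push_cast
        ring
      rw [this]
      ring
    simp only [h3]
    have h5 := Measure.integral_comp_smul (volume : Measure Plane) (fun ξ => coeff a η ξ *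
      Complex.exp (Complex.I * (inner ℝ x ξ : ℝ)) * FW ((2 * Real.pi)⁻¹ • ξ)) (2 * Real.pi)
    rw [finrank_euclideanSpace_fin, abs_of_pos (by positivity)] at h5
    rw [SchwartzMap.fourierInv_coe, Real.fourierInv_eq', ← inv_smul_eq_iff₀ (by positivity), ← h5]
    congr 1 with t
    change _ = Complex.exp _ • (coeff a η ((2 * Real.pi) • t) * FW t)
    rw [smul_smul, inv_mul_cancel₀ h2π.ne', one_smul, smul_eq_mul, inner_smul_right,
      real_inner_comm]
    have : Complex.I * ((2 * Real.pi * inner ℝ t x : ℝ) : ℂ) =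
      ((2 * Real.pi * inner ℝ t x : ℝ) : ℂ) * Complex.I := mul_comm _ _
    rw [this]
    ring
  have h6 : eLpNorm (fun x => ∫ ζ, symbolFourier a η ζ * w (x + ζ)) 2 volume =
      ENNReal.ofReal ((2 * Real.pi) ^ 2) * eLpNorm H 2 volume := by
    rw [← eLpNorm_fourierInv H]
    exact eLpNorm_of_eq_smul (by positivity) key
  rw [h6, mul_assoc]
  gcongr
  -- Plancherel on both sides of the multiplication by the coefficient, which is bounded by `supE
  -- a`.
  have h7 : eLpNorm w 2 volume = eLpNorm FW 2 volume := (eLpNorm_fourier W).symm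
  have hT := ha.supE_lt_top
  rw [h7]
  have h8 := eLpNorm_le_nnreal_smul_eLpNorm_of_ae_le_mul' (μ := (volume : Measure Plane))
    (f := (H : Plane → ℂ)) (g := (FW : Plane → ℂ)) (c := (supE a).toNNReal)
    (ae_of_all _ fun t => ?_) 2
  · rwa [ENNReal.smul_def, ENNReal.coe_toNNReal hT.ne] at h8
  · rw [ENNReal.coe_toNNReal hT.ne]
    change ‖coeff a η ((2 * Real.pi) • t) * FW t‖ₑ ≤ _
    rw [enorm_mul]
    gcongr
    exact enorm_coeff_le _ _ _

/-! ### Power series for the magnetic phase -/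

lemma hasSum_exp_series (z : ℂ) : HasSum (fun n : ℕ => z ^ n / n.factorial) (Complex.exp z) := by
  rw [Complex.exp_eq_exp_ℂ]
  exact NormedSpace.expSeries_div_hasSum_exp z

lemma hasSum_exp_series_real (z : ℝ) : HasSum (fun n : ℕ => z ^ n / n.factorial) (Real.exp z) := by
  rw [Real.exp_eq_exp_ℝ]
  exact NormedSpace.expSeries_div_hasSum_exp z

/-- The coefficients of a double exponential series. -/
def expCoeff (c : ℝ) (n : ℕ × ℕ) : ℝ := c ^ n.1 / n.1.factorial * (c ^ n.2 / n.2.factorial)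

lemma expCoeff_nonneg {c : ℝ} (hc : 0 ≤ c) (n : ℕ × ℕ) : 0 ≤ expCoeff c n := by
  unfold expCoeff; positivity

lemma hasSum_expCoeff {c : ℝ} (hc : 0 ≤ c) :
    HasSum (expCoeff c) (Real.exp c * Real.exp c) := by
  have h := hasSum_exp_series_real c
  exact h.mul h (h.summable.mul_of_nonneg h.summable (fun n => by positivity)
    (fun n => by positivity))

lemma summable_norm_exp_series (z : ℂ) : Summable fun n : ℕ => ‖z ^ n / (n.factorial : ℂ)‖ := by
  refine (hasSum_exp_series_real ‖z‖).summable.congr fun n => ?_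
  rw [norm_div, norm_pow, Complex.norm_natCast]

lemma hasSum_mul_of_summable_norm {f g : ℕ → ℂ} {s t : ℂ} (hf : HasSum f s) (hg : HasSum g t)
    (hf' : Summable fun n => ‖f n‖) (hg' : Summable fun n => ‖g n‖) :
    HasSum (fun n : ℕ × ℕ => f n.1 * g n.2) (s * t) :=
  hf.mul hg (summable_mul_of_summable_norm hf' hg')

lemma hasSum_exp_mul_exp (z w : ℂ) : HasSum (fun n : ℕ × ℕ =>
    z ^ n.1 / n.1.factorial * (w ^ n.2 / n.2.factorial)) (Complex.exp z * Complex.exp w) :=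
  hasSum_mul_of_summable_norm (f := fun n => z ^ n / n.factorial)
    (g := fun n => w ^ n / n.factorial) (hasSum_exp_series z) (hasSum_exp_series w)
    (summable_norm_exp_series z) (summable_norm_exp_series w)

/-- The polynomial weight `(y - l)^α`. -/
def mono (l : Fin 2 → ℤ) (α : ℕ × ℕ) (y : Plane) : ℝ := (y 0 - l 0) ^ α.1 * (y 1 - l 1) ^ α.2

lemma contDiff_mono (l : Fin 2 → ℤ) (α : ℕ × ℕ) : ContDiff ℝ ∞ (mono l α) := by
  unfold mono
  fun_prop

lemma abs_mono_le_one {l : Fin 2 → ℤ} {y : Plane} (h : ∀ j, |y j - l j| ≤ 1) (α : ℕ × ℕ) :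
    |mono l α y| ≤ 1 := by
  rw [mono, abs_mul, abs_pow, abs_pow]
  exact mul_le_one₀ (pow_le_one₀ (abs_nonneg _) (h 0)) (by positivity)
    (pow_le_one₀ (abs_nonneg _) (h 1))

/-- The `L²` bound of the term of frequency `k`, applied to a function supported near `l`. -/
lemma IsCptSymbol.eLpNorm_quantTerm_le {a : Plane × Plane → ℂ} (ha : IsCptSymbol a) (b : ℝ)
    {w : Plane → ℂ} (hw : ContDiff ℝ ∞ w) (hc : HasCompactSupport w) (l k : Fin 2 → ℤ)
    (hl : ∀ y, w y ≠ 0 → ∀ j, |y j - l j| ≤ 1) :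
    eLpNorm (quantTerm b a w k) 2 (volume.restrict unitSquare) ≤
      ENNReal.ofReal ((2 * Real.pi) ^ 2 * (Real.exp (|b| / 2) * Real.exp (|b| / 2))) *
        (eLpNorm w 2 volume * supE a) := by
  let S := symbolFourier a (freq k)
  have hSi : Integrable S := ha.integrable_symbolFourier _
  have hSc : Continuous S := ha.continuous_symbolFourier _
  -- Since `x + ζ / 2` is the midpoint of `x` and `y = x + ζ`, the factor `exp(i η · (x + ζ / 2))`
  -- is `E x * E y`: it separates with no expansion.
  let E : Plane → ℂ := fun y => Complex.exp (Complex.I * (inner ℝ ((1 / 2 : ℝ) • freq k) y : ℝ))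
  have hE1 : ∀ y, ‖E y‖ = 1 := fun y => norm_exp_I_mul _
  have hEs : ContDiff ℝ ∞ E := by
    have h : ContDiff ℝ ∞ fun y : Plane => ((inner ℝ ((1 / 2 : ℝ) • freq k) y : ℝ) : ℂ) :=
      Complex.ofRealCLM.contDiff.comp (contDiff_const.inner ℝ contDiff_id)
    exact (contDiff_const.mul h).cexp
  let W : ℕ × ℕ → Plane → ℂ := fun n y => mono l n y * (E y * w y)
  have hWs : ∀ n, ContDiff ℝ ∞ (W n) := fun n =>
    (Complex.ofRealCLM.contDiff.comp (contDiff_mono l n)).mul (hEs.mul hw)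
  have hWc : ∀ n, HasCompactSupport (W n) := fun n => (hc.mul_left).mul_left
  have hWn : ∀ n y, ‖W n y‖ ≤ ‖w y‖ := by
    intro n y
    by_cases h : w y = 0
    · simp [W, h]
    · simp only [W, norm_mul, hE1, Complex.norm_real, one_mul]
      exact mul_le_of_le_one_left (norm_nonneg _) (abs_mono_le_one (hl y h) n)
  let c : Plane → ℂ := fun x => Complex.exp (Complex.I * (b / 2 * wedge (latticeVec l) x : ℝ)) *
    E x
  have hc1 : ∀ x, ‖c x‖ = 1 := fun x => by rw [norm_mul, norm_exp_I_mul, hE1, one_mul]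
  -- The `x`-part of the general term of the double exponential series; its `y`-part is the monomial
  -- in `W n`.
  let β : ℕ × ℕ → Plane → ℂ := fun n x =>
    (Complex.I * (b / 2) * x 1) ^ n.1 / n.1.factorial *
      ((-(Complex.I * (b / 2)) * x 0) ^ n.2 / n.2.factorial)
  have hβ : ∀ n, ∀ x ∈ unitSquare, ‖β n x‖ ≤ expCoeff (|b| / 2) n := by
    intro n x hx
    have h0 : |x 0| ≤ 1 := abs_le.2 ⟨by linarith [(hx 0).1], (hx 0).2.le⟩
    have h1 : |x 1| ≤ 1 := abs_le.2 ⟨by linarith [(hx 1).1], (hx 1).2.le⟩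
    simp only [β, expCoeff, norm_mul, norm_div, norm_pow, norm_neg, Complex.norm_I, one_mul,
      Complex.norm_real, Real.norm_eq_abs, Complex.norm_natCast]
    have : ‖(2 : ℂ)‖ = 2 := by simp
    rw [this]
    gcongr
    · exact mul_le_of_le_one_right (by positivity) h1
    · exact mul_le_of_le_one_right (by positivity) h0
  let F : ℕ × ℕ → Plane → ℂ := fun n x => c x * β n x * ∫ ζ, S ζ * W n (x + ζ)
  have hTm : ∀ n, StronglyMeasurable fun x => ∫ ζ, S ζ * W n (x + ζ) := fun n => by
    have hcont : Continuous fun p : Plane × Plane => S p.2 * W n (p.1 + p.2) :=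
      (hSc.comp continuous_snd).mul ((hWs n).continuous.comp (continuous_fst.add continuous_snd))
    exact hcont.stronglyMeasurable.integral_prod_right'
  have hFm : ∀ n, AEStronglyMeasurable (F n) (volume.restrict unitSquare) := fun n => by
    have hcont : Continuous fun x => c x * β n x := by
      simp only [c, β, E]
      fun_prop
    exact hcont.aestronglyMeasurable.mul (hTm n).aestronglyMeasurable
  -- With `y = x + ζ`, `ζ ∧ x = y ∧ x = l ∧ x + (y 0 - l 0) * x 1 - (y 1 - l 1) * x 0`. Only the
  -- last two products couple `x` with `y`.
  have hphase : ∀ x ζ, weylPhase b (freq k) x ζ * w (x + ζ) =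
      c x * (Complex.exp (Complex.I * (b / 2) * x 1 * ((x + ζ) 0 - l 0 : ℝ)) *
        Complex.exp (-(Complex.I * (b / 2)) * x 0 * ((x + ζ) 1 - l 1 : ℝ))) *
        (E (x + ζ) * w (x + ζ)) := by
    intro x ζ
    simp only [← mul_assoc]
    congr 1
    simp only [weylPhase, c, E, ← Complex.exp_add]
    congr 1
    simp only [inner_add_right, inner_smul_right, inner_smul_left, wedge, latticeVec_apply,
      PiLp.add_apply]
    simp
    ring
  have hsum : ∀ x ∈ unitSquare, HasSum (fun n => F n x) (quantTerm b a w k x) := by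
    intro x hx
    have hint : ∀ n, Integrable fun ζ => c x * β n x * (S ζ * W n (x + ζ)) := by
      intro n
      obtain ⟨C, hC⟩ := (hWs n).continuous.bounded_above_of_compact_support (hWc n)
      exact (hSi.mul_bdd (c := C) ((hWs n).continuous.comp
        (continuous_const.add continuous_id)).aestronglyMeasurable
        (ae_of_all _ fun ζ => hC _)).const_mul _
    obtain ⟨C, hC⟩ := hw.continuous.bounded_above_of_compact_support hc
    have hint0 : Integrable fun ζ => ‖S ζ * w (x + ζ)‖ :=
      (hSi.mul_bdd (c := C) (hw.continuous.comp
        (continuous_const.add continuous_id)).aestronglyMeasurable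
        (ae_of_all _ fun ζ => hC _)).norm
    have hsm : Summable fun n => ∫ ζ, ‖c x * β n x * (S ζ * W n (x + ζ))‖ := by
      refine Summable.of_nonneg_of_le (fun n => by positivity) (fun n => ?_)
        ((hasSum_expCoeff (c := |b| / 2) (by positivity)).summable.mul_right
          (∫ ζ, ‖S ζ * w (x + ζ)‖))
      rw [← integral_const_mul]
      refine integral_mono (hint n).norm (hint0.const_mul _) fun ζ => ?_
      simp only [norm_mul, hc1, one_mul]
      gcongr
      · exact expCoeff_nonneg (by positivity) n
      · exact hβ n x hx
      · exact hWn n _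
    have h1 := hasSum_integral_of_summable_integral_norm hint hsm
    have h2 : ∫ ζ, ∑' n, c x * β n x * (S ζ * W n (x + ζ)) = quantTerm b a w k x := by
      rw [quantTerm]
      congr 1 with ζ
      rw [quantIntegrand_one, hphase]
      have h3 := hasSum_exp_mul_exp (Complex.I * (b / 2) * x 1 * ((x + ζ) 0 - l 0 : ℝ))
        (-(Complex.I * (b / 2)) * x 0 * ((x + ζ) 1 - l 1 : ℝ))
      have h4 := ((h3.mul_left (c x)).mul_right (E (x + ζ) * w (x + ζ))).mul_left (S ζ)
      rw [← h4.tsum_eq]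
      congr 1 with n
      simp only [β, W, mono, mul_pow _ (((x + ζ) _ - l _ : ℝ) : ℂ), Complex.ofReal_mul,
        Complex.ofReal_pow]
      ring
    rw [h2] at h1
    refine h1.congr_fun fun n => ?_
    simp only [F]
    rw [integral_const_mul]
  have h9 := eLpNorm_le_tsum hFm ((ae_restrict_iff' measurableSet_unitSquare).2
    (ae_of_all _ hsum))
  refine h9.trans ?_
  -- On the square the factor in front of the integral is at most `expCoeff (|b| / 2) n`. The
  -- integral itself is estimated on the whole plane as a Fourier multiplier applied to `W n`, where
  -- `|W n| ≤ |w|`.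
  have h10 : ∀ n, eLpNorm (F n) 2 (volume.restrict unitSquare) ≤
      ENNReal.ofReal (expCoeff (|b| / 2) n) *
        (ENNReal.ofReal ((2 * Real.pi) ^ 2) * supE a * eLpNorm w 2 volume) := by
    intro n
    calc _ ≤ ENNReal.ofReal (expCoeff (|b| / 2) n) * eLpNorm (fun x => ∫ ζ, S ζ * W n (x + ζ)) 2
          (volume.restrict unitSquare) := by
          refine eLpNorm_le_mul_eLpNorm_of_ae_le_mul
            ((ae_restrict_iff' measurableSet_unitSquare).2 (ae_of_all _ fun x hx => ?_)) 2
          simp only [F, norm_mul, hc1, one_mul]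
          gcongr
          exact hβ n x hx
      _ ≤ ENNReal.ofReal (expCoeff (|b| / 2) n) * eLpNorm (fun x => ∫ ζ, S ζ * W n (x + ζ)) 2
          volume := by
          gcongr
          exact Measure.restrict_le_self
      _ ≤ _ := by
          gcongr
          refine (ha.eLpNorm_multiplier_le (freq k) (hWs n) (hWc n)).trans ?_
          gcongr
          exact eLpNorm_mono (hWn n)
  refine (ENNReal.tsum_le_tsum h10).trans (le_of_eq ?_)
  have h11 := hasSum_expCoeff (c := |b| / 2) (by positivity)
  rw [ENNReal.tsum_mul_right, ← ENNReal.ofReal_tsum_of_nonneg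
    (fun n => expCoeff_nonneg (by positivity) n) h11.summable, h11.tsum_eq,
    ENNReal.ofReal_mul (p := (2 * Real.pi) ^ 2) (by positivity)]
  ring

/-! ### The norm of symbols used in the estimates -/

/-- The directions of differentiation that enter the bound. -/
def fullDirs : List (Fin 2 ⊕ Fin 2) :=
  [Sum.inr 1, Sum.inr 1, Sum.inr 0, Sum.inr 0, Sum.inl 1, Sum.inl 1, Sum.inl 0, Sum.inl 0]

lemma nrm_cons_cons_le {d : Fin 2 ⊕ Fin 2} {L : List (Fin 2 ⊕ Fin 2)} {a : Plane × Plane → ℂ}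
    {T : ℝ≥0∞} (h : ∀ i ≤ 2, nrm L ((symD d)^[i] a) ≤ T) : nrm (d :: d :: L) a ≤ 4 * T := by
  have h0 : nrm L a ≤ T := h 0 (by norm_num)
  have h1 : nrm L (symD d a) ≤ T := h 1 (by norm_num)
  have h2 : nrm L (symD d (symD d a)) ≤ T := h 2 le_rfl
  calc nrm (d :: d :: L) a ≤ T + T + (T + T) :=
        add_le_add (add_le_add h0 h1) (add_le_add h1 h2)
    _ = 4 * T := by ring

/-- `fullDirs` lists the directions in the order in which `symbolDeriv` applies them, so no partial
derivatives have to be commuted. Each of the four doubled directions contributes four terms, and `4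
^ 4 = 256`. -/
lemma nrm_fullDirs_le {a : Plane × Plane → ℂ} {T : ℝ≥0∞}
    (h : ∀ γ β : Fin 2 → ℕ, (∀ i, γ i ≤ 2) → (∀ i, β i ≤ 2) → supE (symbolDeriv γ β a) ≤ T) :
    nrm fullDirs a ≤ 256 * T := by
  have e : (256 : ℝ≥0∞) * T = 4 * (4 * (4 * (4 * T))) := by ring
  rw [e]
  refine nrm_cons_cons_le fun i1 h1 => nrm_cons_cons_le fun i2 h2 => nrm_cons_cons_le fun i3 h3 =>
    nrm_cons_cons_le fun i4 h4 => ?_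
  refine h ![i4, i3] ![i2, i1] ?_ ?_
  · intro i; fin_cases i <;> assumption
  · intro i; fin_cases i <;> assumption

lemma IsCptSymbol.nrm_lt_top (L : List (Fin 2 ⊕ Fin 2)) {a : Plane × Plane → ℂ}
    (ha : IsCptSymbol a) : nrm L a < ⊤ := by
  induction L generalizing a with
  | nil => exact ha.supE_lt_top
  | cons d L ih => exact ENNReal.add_lt_top.2 ⟨ih ha, ih (ha.symD d)⟩

/-! ### Truncation -/

lemma isCptSymbol_truncate {χ : Plane → ℝ} (hχ : ContDiff ℝ ∞ χ) (hc : HasCompactSupport χ)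
    {R : ℝ} (hR : 0 < R) {a : Plane × Plane → ℂ} (ha : ContDiff ℝ ∞ a)
    (hp : ∀ (m : Fin 2 → ℤ) (x ξ : Plane), a (x + latticeVec m, ξ) = a (x, ξ)) :
    IsCptSymbol (truncate χ R a) where
  smooth := by
    have h1 : ContDiff ℝ ∞ fun p : Plane × Plane => R⁻¹ • p.2 := contDiff_snd.const_smul _
    exact (Complex.ofRealCLM.contDiff.comp (hχ.comp h1)).mul ha
  periodic m x ξ := by simp [truncate, hp]
  cpt := by
    obtain ⟨r, hr⟩ := hc.isCompact.isBounded.subset_closedBall (0 : Plane)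
    refine ⟨R * r, fun x ξ h => ?_⟩
    have : χ (R⁻¹ • ξ) = 0 := by
      refine image_eq_zero_of_notMem_tsupport fun hmem => ?_
      have := mem_closedBall_zero_iff.1 (hr hmem)
      rw [norm_smul, norm_inv, Real.norm_of_nonneg hR.le, inv_mul_le_iff₀ hR] at this
      linarith
    simp [truncate, this]

lemma symD_const_mul_truncate {χ : Plane → ℝ} (hχ : ContDiff ℝ ∞ χ) (R s : ℝ)
    {a : Plane × Plane → ℂ} (ha : ContDiff ℝ ∞ a) (d : Fin 2 ⊕ Fin 2) :
    symD d (fun p => (s : ℂ) * truncate χ R a p) = fun p =>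
      (s : ℂ) * truncate χ R (symD d a) p +
        ((s * R⁻¹ : ℝ) : ℂ) * truncate (fun ξ => fderiv ℝ χ ξ (dir d).2) R a p := by
  funext p
  have h1 : HasFDerivAt (fun p : Plane × Plane => R⁻¹ • p.2)
      (R⁻¹ • ContinuousLinearMap.snd ℝ Plane Plane) p :=
    (R⁻¹ • ContinuousLinearMap.snd ℝ Plane Plane).hasFDerivAt
  have h2 : HasFDerivAt (fun p : Plane × Plane => χ (R⁻¹ • p.2))
      ((fderiv ℝ χ (R⁻¹ • p.2)).comp (R⁻¹ • ContinuousLinearMap.snd ℝ Plane Plane)) p :=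
    (hχ.differentiable (by simp) _).hasFDerivAt.comp p h1
  have h3 : HasFDerivAt (fun p : Plane × Plane => ((χ (R⁻¹ • p.2) : ℝ) : ℂ))
      (Complex.ofRealCLM.comp ((fderiv ℝ χ (R⁻¹ • p.2)).comp
        (R⁻¹ • ContinuousLinearMap.snd ℝ Plane Plane))) p :=
    Complex.ofRealCLM.hasFDerivAt.comp p h2
  have h4 : HasFDerivAt (fun p => (s : ℂ) * truncate χ R a p) _ p :=
    (h3.mul (ha.differentiable (by simp) p).hasFDerivAt).const_mul (s : ℂ)
  simp only [symD]
  rw [h4.fderiv]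
  simp [truncate, symD]
  ring

/-- A derivative that hits `χ(ξ / R)` produces `R⁻¹ ≤ 1` and replaces `χ` by a derivative of it,
still smooth and compactly supported. The scalar `s` collects these powers of `R⁻¹` so that the
induction closes; the point is a constant uniform in `R ≥ 1`. -/
lemma nrm_truncate_le (L : List (Fin 2 ⊕ Fin 2)) {χ : Plane → ℝ} (hχ : ContDiff ℝ ∞ χ)
    (hc : HasCompactSupport χ) : ∃ C : ℝ≥0, ∀ R s : ℝ, 1 ≤ R → |s| ≤ 1 →
      ∀ a : Plane × Plane → ℂ, ContDiff ℝ ∞ a →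
        nrm L (fun p => (s : ℂ) * truncate χ R a p) ≤ C * nrm L a := by
  induction L generalizing χ with
  | nil =>
    obtain ⟨C, hC⟩ := hχ.continuous.bounded_above_of_compact_support hc
    refine ⟨C.toNNReal, fun R s _ hs a _ => iSup_le fun p => ?_⟩
    simp only [truncate]
    rw [← mul_assoc, enorm_mul]
    gcongr
    · rw [← ofReal_norm, norm_mul, Complex.norm_real, Complex.norm_real]
      refine ENNReal.ofReal_le_ofReal ?_
      calc _ ≤ 1 * ‖χ (R⁻¹ • p.2)‖ := by gcongr; exact hs
        _ ≤ C := by rw [one_mul]; exact hC _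
    · exact le_supE a p
  | cons d L ih =>
    have hχ' : ContDiff ℝ ∞ fun ξ => fderiv ℝ χ ξ (dir d).2 :=
      (hχ.fderiv_right (m := ∞) (by simp)).clm_apply contDiff_const
    obtain ⟨C1, h1⟩ := ih hχ hc
    obtain ⟨C2, h2⟩ := ih hχ' (hc.fderiv_apply ℝ _)
    refine ⟨C1 + C2, fun R s hR hs a ha => ?_⟩
    have hsm : ∀ {ψ : Plane → ℝ} (_ : ContDiff ℝ ∞ ψ) (t : ℝ) {c : Plane × Plane → ℂ}
        (_ : ContDiff ℝ ∞ c), ContDiff ℝ ∞ fun p => (t : ℂ) * truncate ψ R c p := by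
      intro ψ hψ t c hc'
      have h3 : ContDiff ℝ ∞ fun p : Plane × Plane => R⁻¹ • p.2 := contDiff_snd.const_smul _
      have h4 : ContDiff ℝ ∞ fun p : Plane × Plane => ((ψ (R⁻¹ • p.2) : ℝ) : ℂ) :=
        Complex.ofRealCLM.contDiff.comp (hψ.comp h3)
      exact contDiff_const.mul (h4.mul hc')
    have hs' : |s * R⁻¹| ≤ 1 := by
      rw [abs_mul, abs_of_pos (by positivity : 0 < R⁻¹)]
      exact mul_le_one₀ hs (by positivity) (inv_le_one_of_one_le₀ hR)
    simp only [nrm]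
    rw [symD_const_mul_truncate hχ R s ha d]
    calc _ ≤ C1 * nrm L a + (C1 * nrm L (symD d a) + C2 * nrm L a) := by
          refine add_le_add (h1 R s hR hs a ha) ((nrm_add_le L (hsm hχ s (contDiff_symD ha d))
            (hsm hχ' _ ha)).trans (add_le_add (h1 R s hR hs _ (contDiff_symD ha d))
              (h2 R _ hR hs' a ha)))
      _ ≤ C1 * nrm L a + (C1 * nrm L (symD d a) + C2 * nrm L a) + C2 * nrm L (symD d a) :=
          le_self_add
      _ = _ := by push_cast; ring

/-! ### Decay in the frequency and in the position -/

/-- The growth of the constants in one step of the decay estimate. -/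
def stepConst (M : ℝ≥0) (e : ℕ × ℕ) (K : ℕ × ℕ → ℝ≥0) (α : ℕ × ℕ) : ℝ≥0 :=
  K α + M * K α + K (α + e)

/-- One gain of a factor `1 + W`, where `W` will be `|k_j|` or `|l_j|` and `Q` is the product of the
factors already gained. It costs one more direction in the norm. Since the weight may rise from `α`
to `α + e`, the constants must be kept for all `α` at once. -/
lemma decay_step {size : (Plane × Plane → ℂ) → ℕ × ℕ → ℝ≥0∞} {Q W c : ℝ≥0∞} {M : ℝ≥0}
    {d : Fin 2 ⊕ Fin 2} {e : ℕ × ℕ} {L : List (Fin 2 ⊕ Fin 2)} {K : ℕ × ℕ → ℝ≥0}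
    (h : ∀ a, IsCptSymbol a → ∀ α, W * size a α ≤
      size (symD d a) α + M * size a α + size a (α + e))
    (hK : ∀ a, IsCptSymbol a → ∀ α, Q * size a α ≤ K α * (c * nrm L a)) :
    ∀ a, IsCptSymbol a → ∀ α, Q * (1 + W) * size a α ≤
      (stepConst M e K α : ℝ≥0∞) * (c * nrm (d :: L) a) := by
  intro a ha α
  calc Q * (1 + W) * size a α = Q * size a α + Q * (W * size a α) := by ring
    _ ≤ Q * size a α + Q * (size (symD d a) α + M * size a α + size a (α + e)) := by
        gcongr
        exact h a ha α
    _ = Q * size a α + Q * size (symD d a) α + M * (Q * size a α) + Q * size a (α + e) := by ring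
    _ ≤ K α * (c * nrm L a) + K α * (c * nrm L (symD d a)) + M * (K α * (c * nrm L a)) +
        K (α + e) * (c * nrm L a) := by
        exact add_le_add (add_le_add (add_le_add (hK a ha α) (hK _ (ha.symD d) α))
          (mul_le_mul' le_rfl (hK a ha α))) (hK a ha _)
    -- Nonnegative terms are added to complete the product of `stepConst` with `nrm L a + nrm L
    -- (symD d a)`.
    _ ≤ K α * (c * nrm L a) + K α * (c * nrm L (symD d a)) + M * (K α * (c * nrm L a)) +
        K (α + e) * (c * nrm L a) +
        (M * (K α * (c * nrm L (symD d a))) + K (α + e) * (c * nrm L (symD d a))) := le_self_add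
    _ = _ := by
        simp only [nrm, stepConst]
        push_cast
        ring

/-- The summable weight in `l ∈ ℤ²`. -/
def omega (l : Fin 2 → ℤ) : ℝ := ((1 + |(l 0 : ℝ)|) ^ 2)⁻¹ * ((1 + |(l 1 : ℝ)|) ^ 2)⁻¹

lemma omega_pos (l : Fin 2 → ℤ) : 0 < omega l := by unfold omega; positivity

lemma summable_int_inv_sq : Summable fun n : ℤ => ((1 + |(n : ℝ)|) ^ 2)⁻¹ := by
  have h : Summable fun n : ℕ => ((1 + |(((n : ℤ)) : ℝ)|) ^ 2)⁻¹ := by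
    have h1 := (summable_nat_add_iff 1).2 (Real.summable_nat_pow_inv.2 (by norm_num : 1 < 2))
    refine h1.congr fun n => ?_
    have : |(((n : ℤ)) : ℝ)| = n := by simp
    rw [this]
    push_cast
    ring
  refine Summable.of_nat_of_neg h ?_
  simpa using h

lemma summable_omega : Summable omega :=
  (hasSum_finTwo_mul summable_int_inv_sq.hasSum summable_int_inv_sq.hasSum
    (fun n => by positivity) (fun n => by positivity)).summable

lemma summable_omega_mul :
    Summable fun p : (Fin 2 → ℤ) × (Fin 2 → ℤ) => omega p.1 * omega p.2 :=
  summable_omega.mul_of_nonneg summable_omega (fun l => (omega_pos l).le)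
    (fun l => (omega_pos l).le)

/-- The unit multi-indices. -/
def unitIdx : Fin 2 → ℕ × ℕ := ![(1, 0), (0, 1)]

/-- Two uses of `decay_step` for each of `k_0, k_1, l_0, l_1` turn a bound by `sup |a|` into one
with the summable weight. Here `size a α` stands for the size of a block whose localized piece
carries the weight `(y - l)^α`; it is left abstract so that it can be both a pointwise modulus and
an `L²` norm. -/
lemma decay (M : ℝ≥0) (K₀ : ℕ × ℕ → ℝ≥0) : ∃ K : ℝ≥0, ∀ (l k : Fin 2 → ℤ) (c : ℝ≥0∞)
    (size : (Plane × Plane → ℂ) → ℕ × ℕ → ℝ≥0∞),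
    (∀ a, IsCptSymbol a → ∀ α, size a α ≤ K₀ α * (c * supE a)) →
    (∀ j a, IsCptSymbol a → ∀ α, ‖(l j : ℝ)‖ₑ * size a α ≤
      size (symD (Sum.inr j) a) α + M * size a α + size a (α + unitIdx j)) →
    (∀ j a, IsCptSymbol a → ∀ α, ‖(k j : ℝ)‖ₑ * size a α ≤ size (symD (Sum.inl j) a) α) →
    ∀ a, IsCptSymbol a →
      size a 0 ≤ K * (c * nrm fullDirs a) * ENNReal.ofReal (omega k * omega l) := by
  -- The `k`-steps have neither the `M` term nor a raised weight, hence the parameters `0 0`.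
  let K1 := stepConst 0 0 (stepConst 0 0 (stepConst 0 0 (stepConst 0 0 K₀)))
  let K2 := stepConst M (unitIdx 1) (stepConst M (unitIdx 1)
    (stepConst M (unitIdx 0) (stepConst M (unitIdx 0) K1)))
  refine ⟨K2 0, fun l k c size h0 hl hk a ha => ?_⟩
  have hk' : ∀ j a, IsCptSymbol a → ∀ α, ‖(k j : ℝ)‖ₑ * size a α ≤
      size (symD (Sum.inl j) a) α + (0 : ℝ≥0) * size a α + size a (α + 0) := fun j a ha α =>
    (hk j a ha α).trans (by rw [add_assoc]; exact le_self_add)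
  have s0 : ∀ a, IsCptSymbol a → ∀ α, 1 * size a α ≤ K₀ α * (c * nrm [] a) := fun a ha α => by
    rw [one_mul]; exact h0 a ha α
  have s1 := decay_step (hk' 0) s0
  have s2 := decay_step (hk' 0) s1
  have s3 := decay_step (hk' 1) s2
  have s4 := decay_step (hk' 1) s3
  have s5 := decay_step (hl 0) s4
  have s6 := decay_step (hl 0) s5
  have s7 := decay_step (hl 1) s6
  have s8 := decay_step (hl 1) s7 a ha 0
  have hw : ∀ m : Fin 2 → ℤ, ∀ j, (1 + ‖(m j : ℝ)‖ₑ) = ENNReal.ofReal (1 + |(m j : ℝ)|) := by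
    intro m j
    rw [ENNReal.ofReal_add zero_le_one (abs_nonneg _), ENNReal.ofReal_one, ← ofReal_norm,
      Real.norm_eq_abs]
  have hP : 1 * (1 + ‖(k 0 : ℝ)‖ₑ) * (1 + ‖(k 0 : ℝ)‖ₑ) * (1 + ‖(k 1 : ℝ)‖ₑ) *
      (1 + ‖(k 1 : ℝ)‖ₑ) * (1 + ‖(l 0 : ℝ)‖ₑ) * (1 + ‖(l 0 : ℝ)‖ₑ) * (1 + ‖(l 1 : ℝ)‖ₑ) *
      (1 + ‖(l 1 : ℝ)‖ₑ) = (ENNReal.ofReal (omega k * omega l))⁻¹ := by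
    rw [← ENNReal.ofReal_inv_of_pos (mul_pos (omega_pos k) (omega_pos l))]
    simp only [hw]
    rw [one_mul]
    repeat rw [← ENNReal.ofReal_mul (by positivity)]
    congr 1
    simp only [omega, mul_inv, inv_inv]
    ring
  rw [hP] at s8
  have hpos : ENNReal.ofReal (omega k * omega l) ≠ 0 := by
    simpa using mul_pos (omega_pos k) (omega_pos l)
  calc size a 0 = (ENNReal.ofReal (omega k * omega l))⁻¹ * size a 0 *
        ENNReal.ofReal (omega k * omega l) := by
        rw [mul_right_comm, ENNReal.inv_mul_cancel hpos ENNReal.ofReal_ne_top, one_mul]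
    _ ≤ _ := by exact mul_le_mul' s8 le_rfl

/-! ### The localized pieces of a section -/

/-- The localized piece of `u` near `l`, with a polynomial weight. -/
def locPiece (l : Fin 2 → ℤ) (α : ℕ × ℕ) (u : Plane → ℂ) (y : Plane) : ℂ :=
  mono l α y * piece l u y

lemma locPiece_zero (l : Fin 2 → ℤ) (u : Plane → ℂ) : locPiece l 0 u = piece l u := by
  funext y
  simp [locPiece, mono]

lemma locPiece_add_unitIdx (l : Fin 2 → ℤ) (α : ℕ × ℕ) (u : Plane → ℂ) (j : Fin 2) :
    locPiece l (α + unitIdx j) u = fun y => ((y j - l j : ℝ) : ℂ) * locPiece l α u y := by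
  funext y
  fin_cases j
  · simp [locPiece, mono, unitIdx]; ring
  · simp [locPiece, mono, unitIdx]; ring

lemma contDiff_piece (l : Fin 2 → ℤ) {u : Plane → ℂ} (hu : ContDiff ℝ ∞ u) :
    ContDiff ℝ ∞ (piece l u) :=
  (Complex.ofRealCLM.contDiff.comp (contDiff_bump2.comp (contDiff_id.sub contDiff_const))).mul hu

lemma contDiff_locPiece (l : Fin 2 → ℤ) (α : ℕ × ℕ) {u : Plane → ℂ} (hu : ContDiff ℝ ∞ u) :
    ContDiff ℝ ∞ (locPiece l α u) :=
  (Complex.ofRealCLM.contDiff.comp (contDiff_mono l α)).mul (contDiff_piece l hu)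

lemma abs_le_one_of_piece_ne_zero {l : Fin 2 → ℤ} {u : Plane → ℂ} {y : Plane}
    (h : piece l u y ≠ 0) (j : Fin 2) : |y j - l j| ≤ 1 := by
  by_contra hcon
  refine h ?_
  rw [piece, bump2_eq_zero j (by simpa [latticeVec_apply] using (not_le.1 hcon).le)]
  simp

lemma hasCompactSupport_piece (l : Fin 2 → ℤ) (u : Plane → ℂ) :
    HasCompactSupport (piece l u) := by
  refine HasCompactSupport.intro (isCompact_closedBall (latticeVec l) 2) fun y hy => ?_
  by_contra hne
  refine hy ?_
  have h0 := abs_le.1 (abs_le_one_of_piece_ne_zero hne 0)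
  have h1 := abs_le.1 (abs_le_one_of_piece_ne_zero hne 1)
  rw [mem_closedBall_iff_norm, EuclideanSpace.norm_eq, Real.sqrt_le_left (by norm_num)]
  simp only [Fin.sum_univ_two, Real.norm_eq_abs, sq_abs, PiLp.sub_apply, latticeVec_apply]
  nlinarith [h0.1, h0.2, h1.1, h1.2]

lemma hasCompactSupport_locPiece (l : Fin 2 → ℤ) (α : ℕ × ℕ) (u : Plane → ℂ) :
    HasCompactSupport (locPiece l α u) := (hasCompactSupport_piece l u).mul_left

lemma norm_locPiece_le (l : Fin 2 → ℤ) (α : ℕ × ℕ) (u : Plane → ℂ) (y : Plane) :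
    ‖locPiece l α u y‖ ≤ ‖piece l u y‖ := by
  by_cases h : piece l u y = 0
  · simp [locPiece, h]
  · rw [locPiece, norm_mul, Complex.norm_real]
    exact mul_le_of_le_one_left (norm_nonneg _)
      (abs_mono_le_one (abs_le_one_of_piece_ne_zero h) α)

/-- Up to a unimodular phase, linear in `y` in its exponent, every piece is a translate of the one
at the origin. This makes bounds invariant under translation and modulation uniform in `l`. -/
lemma locPiece_translate {b : ℝ} {u : Plane → ℂ} (hu : IsMagInvariant b u) (l : Fin 2 → ℤ)
    (α : ℕ × ℕ) (y : Plane) :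
    locPiece l α u (y + latticeVec l) = magPhase b l y * locPiece 0 α u y := by
  simp only [locPiece, piece, mono, hu.add_lattice, latticeVec_zero, add_sub_cancel_right,
    PiLp.add_apply, latticeVec_apply, Pi.zero_apply, Int.cast_zero, sub_zero]
  ring

/-! ### Summability of the quantization series -/

lemma enorm_le_of_two_pi (n : ℤ) (z : ℂ) :
    ‖(n : ℝ)‖ₑ * ‖z‖ₑ ≤ ‖Complex.I * (2 * Real.pi * n) * z‖ₑ := by
  have : ‖(n : ℝ)‖ₑ ≤ ‖Complex.I * (2 * Real.pi * n)‖ₑ := by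
    rw [← ofReal_norm, ← ofReal_norm]
    refine ENNReal.ofReal_le_ofReal ?_
    simp only [norm_mul, Complex.norm_I, one_mul, Complex.norm_real, Complex.norm_intCast,
      Real.norm_eq_abs]
    rw [abs_of_pos Real.pi_pos]
    have h2 : ‖(2 : ℂ)‖ = 2 := by simp
    rw [h2]
    have := Real.pi_gt_three
    nlinarith [abs_nonneg (n : ℝ)]
  rw [enorm_mul]
  exact mul_le_mul' this le_rfl

/-- The pointwise decay of the terms of the quantization series. -/
lemma exists_enorm_quantTerm_le {b : ℝ} {u : Plane → ℂ} (hu : IsMagInvariant b u)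
    (hs : ContDiff ℝ ∞ u) (x : Plane) : ∃ K : ℝ≥0, ∀ (a : Plane × Plane → ℂ), IsCptSymbol a →
      ∀ l k : Fin 2 → ℤ, ‖quantTerm b a (piece l u) k x‖ₑ ≤
        K * nrm fullDirs a * ENNReal.ofReal (omega k * omega l) := by
  -- A model function independent of `k` and `l`: each `testFun` below is a modulated translate of
  -- it, so one Fourier `L¹` norm serves all blocks.
  let G : ℕ × ℕ → Plane → ℂ := fun α ζ =>
    Complex.exp (Complex.I * (b / 2 * wedge ζ x : ℝ)) * locPiece 0 α u ζ
  have hGs : ∀ α, ContDiff ℝ ∞ (G α) := fun α => by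
    have h1 : ContDiff ℝ ∞ fun ζ : Plane => ((b / 2 * wedge ζ x : ℝ) : ℂ) :=
      Complex.ofRealCLM.contDiff.comp (contDiff_const.mul (contDiff_wedge_left x))
    exact (contDiff_const.mul h1).cexp.mul (contDiff_locPiece 0 α hs)
  have hGc : ∀ α, HasCompactSupport (G α) := fun α => (hasCompactSupport_locPiece 0 α u).mul_left
  have hG : ∀ α, ∫⁻ ξ, ‖planeFourier (G α) ξ‖ₑ < ⊤ := fun α =>
    (planeFourier_integrable (hGs α) (hGc α)).2
  let K₀ : ℕ × ℕ → ℝ≥0 := fun α => (∫⁻ ξ, ‖planeFourier (G α) ξ‖ₑ).toNNReal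
  -- The factor `x_j` is bounded by `‖x‖`; the constant may depend on the point here.
  obtain ⟨K, hK⟩ := decay ‖x‖₊ K₀
  refine ⟨K, fun a ha l k => ?_⟩
  have h := hK l k 1 (fun a α => ‖quantTerm b a (locPiece l α u) k x‖ₑ) ?_ ?_ ?_ a ha
  · simpa [locPiece_zero] using h
  · intro a ha α
    rw [one_mul, ha.quantTerm_eq_phaseTerm b (contDiff_locPiece l α hs)
      (hasCompactSupport_locPiece l α u), ENNReal.coe_toNNReal (hG α).ne]
    refine (enorm_phaseTerm_le b a (contDiff_locPiece l α hs)
      (hasCompactSupport_locPiece l α u) k x).trans (le_of_eq ?_)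
    congr 1
    refine lintegral_planeFourier_modulate
      (c := Complex.exp (Complex.I * (b / 2 * wedge (latticeVec l) x + inner ℝ (freq k) x +
        b / 2 * (l 0 * l 1 + wedge (latticeVec l) x) : ℝ))) (enorm_exp_I_mul _)
      -- The modulation frequency comes from `exp(i η · ζ / 2)` and from `l ∧ ζ = perp l · ζ` in the
      -- phase of the translated piece; the shift by `x - l` brings the piece back to the origin.
      ((1 / 2 : ℝ) • freq k + (b / 2) • perp (latticeVec l)) (x - latticeVec l) fun ζ => ?_
    have h1 : x + ζ = (ζ + (x - latticeVec l)) + latticeVec l := by abel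
    simp only [testFun, G]
    rw [h1, locPiece_translate hu, weylPhase, magPhase]
    simp only [← mul_assoc]
    congr 1
    simp only [← Complex.exp_add]
    congr 1
    simp only [wedge_add_left, wedge_sub_left, wedge_add_right, wedge_sub_right, wedge_self,
      inner_add_left, inner_add_right, inner_smul_left, inner_smul_right,
      wedge_eq_inner (latticeVec l) ζ]
    simp
    ring
  · intro j a ha α
    have h1 := ha.quantTerm_lattice b (contDiff_locPiece l α hs).continuous
      (hasCompactSupport_locPiece l α u) j l k x
    rw [← locPiece_add_unitIdx] at h1
    have h2 : ‖(l j : ℝ)‖ₑ * ‖quantTerm b a (locPiece l α u) k x‖ₑ =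
        ‖(l j : ℂ) * quantTerm b a (locPiece l α u) k x‖ₑ := by
      rw [enorm_mul, ← ofReal_norm, ← ofReal_norm (l j : ℂ)]
      simp
    rw [h2, h1]
    refine (enorm_sub_le).trans (add_le_add ((enorm_add_le _ _).trans (add_le_add ?_ ?_)) le_rfl)
    · rw [enorm_mul, enorm_neg, ← ofReal_norm Complex.I]
      simp
    · rw [enorm_mul]
      refine mul_le_mul' ?_ le_rfl
      rw [← ofReal_norm, Complex.norm_real, show ((‖x‖₊ : ℝ≥0) : ℝ≥0∞) = ENNReal.ofReal ‖x‖ from (ofReal_norm x).symm]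
      exact ENNReal.ofReal_le_ofReal (PiLp.norm_apply_le x j)
  · intro j a ha α
    rw [ha.quantTerm_dX]
    exact enorm_le_of_two_pi _ _

/-- The decay in `L²` of the terms of the quantization series. -/
lemma exists_eLpNorm_quantTerm_le (b : ℝ) : ∃ K : ℝ≥0, ∀ (u : Plane → ℂ), IsMagInvariant b u →
    ContDiff ℝ ∞ u → ∀ (a : Plane × Plane → ℂ), IsCptSymbol a → ∀ l k : Fin 2 → ℤ,
      eLpNorm (quantTerm b a (piece l u) k) 2 (volume.restrict unitSquare) ≤
        K * (eLpNorm u 2 (volume.restrict unitSquare) * nrm fullDirs a) *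
          ENNReal.ofReal (omega k * omega l) := by
  let C : ℝ := (2 * Real.pi) ^ 2 * (Real.exp (|b| / 2) * Real.exp (|b| / 2))
  -- Now `|x_j| ≤ 1` on the unit square, so `M = 1`. `C` is the constant of
  -- `IsCptSymbol.eLpNorm_quantTerm_le` and `4` that of `eLpNorm_piece_le`.
  obtain ⟨K, hK⟩ := decay 1 (fun _ => C.toNNReal * 4)
  refine ⟨K, fun u hu hs a ha l k => ?_⟩
  have hm : ∀ a, IsCptSymbol a → ∀ α, AEStronglyMeasurable (quantTerm b a (locPiece l α u) k)
      (volume.restrict unitSquare) := fun a ha α =>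
    (ha.stronglyMeasurable_quantTerm b (contDiff_locPiece l α hs).continuous
      k).aestronglyMeasurable
  have h := hK l k (eLpNorm u 2 (volume.restrict unitSquare))
    (fun a α => eLpNorm (quantTerm b a (locPiece l α u) k) 2 (volume.restrict unitSquare))
    ?_ ?_ ?_ a ha
  · simpa [locPiece_zero] using h
  · intro a ha α
    refine (ha.eLpNorm_quantTerm_le b (contDiff_locPiece l α hs)
      (hasCompactSupport_locPiece l α u) l k fun y hy j => ?_).trans ?_
    · exact abs_le_one_of_piece_ne_zero (fun h : piece l u y = 0 => hy (by simp [locPiece, h])) j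
    · have h1 : eLpNorm (locPiece l α u) 2 volume ≤
          4 * eLpNorm u 2 (volume.restrict unitSquare) :=
        (eLpNorm_mono (norm_locPiece_le l α u)).trans (eLpNorm_piece_le hu hs.continuous l)
      calc _ ≤ ENNReal.ofReal C *
            (4 * eLpNorm u 2 (volume.restrict unitSquare) * supE a) :=
            mul_le_mul' le_rfl (mul_le_mul' h1 le_rfl)
        _ = _ := by
            rw [ENNReal.coe_mul, ENNReal.ofReal]
            simp only [ENNReal.coe_ofNat]
            ring
  · intro j a ha α
    have h1 : ((l j : ℂ) • quantTerm b a (locPiece l α u) k) =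
        ((-Complex.I) • quantTerm b (symD (Sum.inr j) a) (locPiece l α u) k +
          fun x => (x j : ℂ) * quantTerm b a (locPiece l α u) k x) -
          quantTerm b a (locPiece l (α + unitIdx j) u) k := by
      funext x
      have := ha.quantTerm_lattice b (contDiff_locPiece l α hs).continuous
        (hasCompactSupport_locPiece l α u) j l k x
      rw [← locPiece_add_unitIdx] at this
      simpa using this
    have h2 : ‖(l j : ℝ)‖ₑ * eLpNorm (quantTerm b a (locPiece l α u) k) 2
        (volume.restrict unitSquare) = eLpNorm ((l j : ℂ) • quantTerm b a (locPiece l α u) k) 2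
        (volume.restrict unitSquare) := by
      rw [eLpNorm_const_smul, ← ofReal_norm, ← ofReal_norm (l j : ℂ)]
      simp
    rw [h2, h1]
    have hc : Continuous fun x : Plane => (x j : ℂ) := by fun_prop
    have m1 := (hm _ (ha.symD (Sum.inr j)) α).const_smul (-Complex.I)
    have m2 : AEStronglyMeasurable (fun x : Plane => (x j : ℂ) *
        quantTerm b a (locPiece l α u) k x) (volume.restrict unitSquare) :=
      hc.aestronglyMeasurable.mul (hm a ha α)
    refine (eLpNorm_sub_le (m1.add m2) (hm a ha _) (by norm_num)).trans
      (add_le_add ((eLpNorm_add_le m1 m2 (by norm_num)).trans (add_le_add ?_ ?_)) le_rfl)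
    · rw [eLpNorm_const_smul, enorm_neg, ← ofReal_norm Complex.I]
      simp
    · rw [ENNReal.coe_one, one_mul]
      refine eLpNorm_mono_ae ((ae_restrict_iff' measurableSet_unitSquare).2
        (ae_of_all _ fun x hx => ?_))
      rw [norm_mul, Complex.norm_real]
      refine mul_le_of_le_one_left (norm_nonneg _) ?_
      rw [Real.norm_of_nonneg (hx j).1]
      exact (hx j).2.le
  · intro j a ha α
    have h1 : quantTerm b (symD (Sum.inl j) a) (locPiece l α u) k =
        (Complex.I * (2 * Real.pi * k j)) • quantTerm b a (locPiece l α u) k :=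
      funext fun x => ha.quantTerm_dX b _ j k x
    rw [h1, eLpNorm_const_smul]
    refine mul_le_mul' ?_ le_rfl
    simpa using enorm_le_of_two_pi (k j) 1

/-! ### The quantization of compactly supported symbols -/

/-- Dominated convergence: the bumps are nonnegative, so the moduli of the pieces sum exactly to
`|u|`, an integrable majorant after multiplication by the Fourier transform. -/
lemma IsCptSymbol.hasSum_quantTerm_piece {a : Plane × Plane → ℂ} (ha : IsCptSymbol a) (b : ℝ)
    {u : Plane → ℂ} (hc : Continuous u) (hb : ∃ C : ℝ, ∀ y, ‖u y‖ ≤ C) (k : Fin 2 → ℤ)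
    (x : Plane) : HasSum (fun l => quantTerm b a (piece l u) k x) (quantTerm b a u k x) := by
  have hpc : ∀ l, Continuous (piece l u) := fun l => by
    have h : Continuous bump2 := contDiff_bump2.continuous
    unfold piece
    fun_prop
  have hS := ha.continuous_symbolFourier (freq k)
  have hn : ∀ (w : Plane → ℂ) (ζ : Plane), ‖quantIntegrand 1 b a w x (freq k) ζ‖ =
      ‖symbolFourier a (freq k) ζ‖ * ‖w (x + ζ)‖ := fun w ζ => by
    rw [quantIntegrand_one, norm_mul, norm_mul, norm_weylPhase, one_mul]
  have hsum : ∀ ζ, HasSum (fun l => ‖symbolFourier a (freq k) ζ‖ * ‖piece l u (x + ζ)‖)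
      (‖symbolFourier a (freq k) ζ‖ * ‖u (x + ζ)‖) := fun ζ =>
    (hasSum_norm_piece u (x + ζ)).mul_left _
  refine hasSum_integral_of_dominated_convergence
    (fun l ζ => ‖symbolFourier a (freq k) ζ‖ * ‖piece l u (x + ζ)‖) (fun l => ?_)
    (fun l => ae_of_all _ fun ζ => (hn _ ζ).le) (ae_of_all _ fun ζ => (hsum ζ).summable) ?_
    (ae_of_all _ fun ζ => ?_)
  · rw [show quantIntegrand 1 b a (piece l u) x (freq k) = _ from
      funext (quantIntegrand_one b a (piece l u) x (freq k))]
    have := hpc l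
    exact Continuous.aestronglyMeasurable (by fun_prop)
  · have e : (fun ζ => ∑' l, ‖symbolFourier a (freq k) ζ‖ * ‖piece l u (x + ζ)‖) =
        fun ζ => ‖quantIntegrand 1 b a u x (freq k) ζ‖ := by
      funext ζ
      rw [(hsum ζ).tsum_eq, hn]
    rw [e]
    exact (ha.integrable_quantIntegrand b hc hb x (freq k)).norm
  · simp only [quantIntegrand_one]
    exact ((hasSum_piece u (x + ζ)).mul_left _).mul_left _

/-- The quantization of a compactly supported symbol, for `h = 1`. -/
def opVal (b : ℝ) (a : Plane × Plane → ℂ) (u : Plane → ℂ) (x : Plane) : ℂ :=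
  (1 / (2 * Real.pi) ^ 2 : ℂ) *
    ∑' p : (Fin 2 → ℤ) × (Fin 2 → ℤ), quantTerm b a (piece p.2 u) p.1 x

lemma IsCptSymbol.summable_quantTerm {a : Plane × Plane → ℂ} (ha : IsCptSymbol a) {b : ℝ}
    {u : Plane → ℂ} (hu : IsMagInvariant b u) (hs : ContDiff ℝ ∞ u) (x : Plane) :
    Summable fun p : (Fin 2 → ℤ) × (Fin 2 → ℤ) => quantTerm b a (piece p.2 u) p.1 x := by
  obtain ⟨K, hK⟩ := exists_enorm_quantTerm_le hu hs x
  have hfin : (K : ℝ≥0∞) * nrm fullDirs a ≠ ⊤ :=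
    ENNReal.mul_ne_top ENNReal.coe_ne_top (ha.nrm_lt_top _).ne
  refine Summable.of_norm_bounded
    (summable_omega_mul.mul_left ((K : ℝ≥0∞) * nrm fullDirs a).toReal) fun p => ?_
  have h := hK a ha p.2 p.1
  rw [← ofReal_norm, ← ENNReal.ofReal_toReal hfin,
    ← ENNReal.ofReal_mul ENNReal.toReal_nonneg] at h
  exact (ENNReal.ofReal_le_ofReal_iff (mul_nonneg ENNReal.toReal_nonneg
    (mul_pos (omega_pos _) (omega_pos _)).le)).1 h

/-- The double series over `(k, l)` converges absolutely; summing over `l` first recovers the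
defining series over `k`. -/
lemma IsCptSymbol.hasQuantSum {a : Plane × Plane → ℂ} (ha : IsCptSymbol a) {b : ℝ}
    {u : Plane → ℂ} (hu : IsMagInvariant b u) (hs : ContDiff ℝ ∞ u) (x : Plane) :
    HasQuantSum 1 b a u x (opVal b a u x) := by
  have hb := hu.bounded hs.continuous
  refine ⟨fun k => ha.integrable_quantIntegrand b hs.continuous hb x (freq k), ?_⟩
  exact ((ha.summable_quantTerm hu hs x).hasSum.prod_fiberwise fun k =>
    ha.hasSum_quantTerm_piece b hs.continuous hb k x).mul_left _

lemma IsCptSymbol.aestronglyMeasurable_opVal {a : Plane × Plane → ℂ} (ha : IsCptSymbol a) {b : ℝ}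
    {u : Plane → ℂ} (hu : IsMagInvariant b u) (hs : ContDiff ℝ ∞ u) :
    AEStronglyMeasurable (opVal b a u) volume := by
  refine AEStronglyMeasurable.const_mul ?_ _
  refine aestronglyMeasurable_of_tendsto_ae (atTop : Filter (Finset ((Fin 2 → ℤ) × (Fin 2 → ℤ))))
    (f := fun s => ∑ p ∈ s, quantTerm b a (piece p.2 u) p.1)
    (fun s => Finset.aestronglyMeasurable_sum s fun p _ =>
      (ha.stronglyMeasurable_quantTerm b (contDiff_piece p.2 hs).continuous
        p.1).aestronglyMeasurable) (ae_of_all _ fun x => ?_)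
  simpa [HasSum] using (ha.summable_quantTerm hu hs x).hasSum

lemma norm_two_pi_const_le : ‖(1 / (2 * Real.pi) ^ 2 : ℂ)‖ ≤ 1 := by
  have h2 : ‖(2 : ℂ)‖ = 2 := by simp
  rw [norm_div, norm_one, norm_pow, norm_mul, Complex.norm_real, h2,
    Real.norm_of_nonneg Real.pi_pos.le]
  have := Real.pi_gt_three
  exact div_le_one_of_le₀ (one_le_pow₀ (by linarith)) (by positivity)

/-- Only the triangle inequality over blocks is used, since the weights `omega k * omega l` are
summable. -/
lemma exists_eLpNorm_opVal_le (b : ℝ) : ∃ K : ℝ≥0, ∀ (u : Plane → ℂ), IsMagInvariant b u →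
    ContDiff ℝ ∞ u → ∀ (a : Plane × Plane → ℂ), IsCptSymbol a →
      eLpNorm (opVal b a u) 2 (volume.restrict unitSquare) ≤
        K * (eLpNorm u 2 (volume.restrict unitSquare) * nrm fullDirs a) := by
  obtain ⟨K, hK⟩ := exists_eLpNorm_quantTerm_le b
  obtain ⟨T, hT⟩ : ∃ T : ℝ≥0, ∑' p : (Fin 2 → ℤ) × (Fin 2 → ℤ),
      ENNReal.ofReal (omega p.1 * omega p.2) = T :=
    ⟨_, (ENNReal.ofReal_tsum_of_nonneg (fun p : (Fin 2 → ℤ) × (Fin 2 → ℤ) =>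
      (mul_pos (omega_pos p.1) (omega_pos p.2)).le) summable_omega_mul).symm⟩
  refine ⟨K * T, fun u hu hs a ha => ?_⟩
  let F : (Fin 2 → ℤ) × (Fin 2 → ℤ) → Plane → ℂ := fun p => quantTerm b a (piece p.2 u) p.1
  have h1 : eLpNorm (opVal b a u) 2 (volume.restrict unitSquare) ≤
      eLpNorm (fun x => ∑' p, F p x) 2 (volume.restrict unitSquare) := by
    refine eLpNorm_mono fun x => ?_
    rw [opVal, norm_mul]
    exact mul_le_of_le_one_left (norm_nonneg _) norm_two_pi_const_le
  have hF : ∀ p, AEStronglyMeasurable (F p) (volume.restrict unitSquare) := fun p =>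
    (ha.stronglyMeasurable_quantTerm b (contDiff_piece p.2 hs).continuous
      p.1).aestronglyMeasurable
  have h2 := eLpNorm_le_tsum hF (G := fun x => ∑' p, F p x)
    (ae_of_all _ fun x => (ha.summable_quantTerm hu hs x).hasSum)
  have h3 : ∑' p, eLpNorm (F p) 2 (volume.restrict unitSquare) ≤
      ∑' p : (Fin 2 → ℤ) × (Fin 2 → ℤ),
        K * (eLpNorm u 2 (volume.restrict unitSquare) * nrm fullDirs a) *
          ENNReal.ofReal (omega p.1 * omega p.2) :=
    ENNReal.tsum_le_tsum fun p => hK u hu hs a ha p.2 p.1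
  rw [ENNReal.tsum_mul_left, hT] at h3
  refine h1.trans (h2.trans (h3.trans (le_of_eq ?_)))
  rw [ENNReal.coe_mul]
  ring

/-! ### The oscillatory limit -/

/-- The quantization of a symbol of class `S⁰`, for `h = 1`. -/
def limVal (b : ℝ) (a : Plane × Plane → ℂ) (u : Plane → ℂ) (x : Plane) : ℂ :=
  (1 / (2 * Real.pi) ^ 2 : ℂ) *
    ∑' p : (Fin 2 → ℤ) × (Fin 2 → ℤ), phaseTerm b a (piece p.2 u) p.1 x

/-- Smooth periodic symbols for which the bounding norm is finite. -/
structure IsFinSymbol (a : Plane × Plane → ℂ) : Prop where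
  smooth : ContDiff ℝ ∞ a
  periodic : ∀ (m : Fin 2 → ℤ) (x ξ : Plane), a (x + latticeVec m, ξ) = a (x, ξ)
  finite : nrm fullDirs a < ⊤

lemma supE_le_nrm (L : List (Fin 2 ⊕ Fin 2)) (a : Plane × Plane → ℂ) : supE a ≤ nrm L a := by
  induction L generalizing a with
  | nil => exact le_rfl
  | cons d L ih => exact (ih a).trans le_self_add

lemma IsFinSymbol.norm_le {a : Plane × Plane → ℂ} (ha : IsFinSymbol a) (p : Plane × Plane) :
    ‖a p‖ ≤ (supE a).toReal := by
  have hfin := ((supE_le_nrm fullDirs a).trans_lt ha.finite).ne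
  rw [← ENNReal.ofReal_le_ofReal_iff ENNReal.toReal_nonneg, ENNReal.ofReal_toReal hfin,
    ofReal_norm]
  exact le_supE a p

/-- The integrands are dominated by a constant times `|planeFourier (testFun b w k x)|`, because `a`
and `χ` are bounded. -/
lemma IsFinSymbol.tendsto_phaseTerm {a : Plane × Plane → ℂ} (ha : IsFinSymbol a) (b : ℝ)
    {w : Plane → ℂ} (hw : ContDiff ℝ ∞ w) (hwc : HasCompactSupport w) (k : Fin 2 → ℤ) (x : Plane)
    {χ : Plane → ℝ} (hχ : ContDiff ℝ ∞ χ) (hc : HasCompactSupport χ) (h0 : χ 0 = 1) :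
    Tendsto (fun R => phaseTerm b (truncate χ R a) w k x) atTop (𝓝 (phaseTerm b a w k x)) := by
  have hi := planeFourier_integrable (contDiff_testFun b hw k x)
    (hasCompactSupport_testFun b hwc k x)
  have hi2 := integrable_planeFourier_snd hi
  obtain ⟨C, hC⟩ := hχ.continuous.bounded_above_of_compact_support hc
  have hac := ha.smooth.continuous
  have hχc := hχ.continuous
  refine tendsto_integral_filter_of_dominated_convergence
    (fun p => C * (supE a).toReal * ‖planeFourier (testFun b w k x) p.2‖)
    (Eventually.of_forall fun R => ?_) (Eventually.of_forall fun R => ae_of_all _ fun p => ?_)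
    (hi2.norm.const_mul _) (ae_of_all _ fun p => ?_)
  · have h1 : Continuous (truncate χ R a) := by
      unfold truncate
      fun_prop
    have h2 : Continuous fun p : Plane × Plane =>
        Complex.exp (-Complex.I * (inner ℝ (freq k) p.1 : ℝ)) := by fun_prop
    exact h1.aestronglyMeasurable.mul (h2.aestronglyMeasurable.mul hi2.aestronglyMeasurable)
  · rw [norm_mul, norm_mul, norm_exp_neg_I_mul, one_mul, truncate, norm_mul, Complex.norm_real]
    gcongr
    · exact (norm_nonneg _).trans (hC 0)
    · exact hC _
    · exact ha.norm_le p
  · refine Tendsto.mul_const _ ?_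
    have h1 : Tendsto (fun R : ℝ => R⁻¹ • p.2) atTop (𝓝 0) := by
      simpa using (tendsto_inv_atTop_zero (𝕜 := ℝ)).smul_const p.2
    have h2 : Tendsto (fun R : ℝ => χ (R⁻¹ • p.2)) atTop (𝓝 1) := by
      rw [← h0]
      exact (hχc.tendsto 0).comp h1
    have h3 : Tendsto (fun R : ℝ => ((χ (R⁻¹ • p.2) : ℝ) : ℂ) * a p) atTop
        (𝓝 (((1 : ℝ) : ℂ) * a p)) :=
      ((Complex.continuous_ofReal.tendsto 1).comp h2).mul_const _
    simpa [truncate] using h3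

lemma IsFinSymbol.exists_nrm_truncate_le {χ : Plane → ℝ} (hχ : ContDiff ℝ ∞ χ)
    (hc : HasCompactSupport χ) : ∃ C : ℝ≥0, ∀ a : Plane × Plane → ℂ, IsFinSymbol a →
      ∀ R : ℝ, 1 ≤ R → nrm fullDirs (truncate χ R a) ≤ C * nrm fullDirs a := by
  obtain ⟨C, hC⟩ := nrm_truncate_le fullDirs hχ hc
  refine ⟨C, fun a ha R hR => ?_⟩
  simpa using hC R 1 hR (by simp) a ha.smooth

lemma IsFinSymbol.truncate {a : Plane × Plane → ℂ} (ha : IsFinSymbol a) {χ : Plane → ℝ}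
    (hχ : ContDiff ℝ ∞ χ) (hc : HasCompactSupport χ) {R : ℝ} (hR : 0 < R) :
    IsCptSymbol (truncate χ R a) :=
  isCptSymbol_truncate hχ hc hR ha.smooth ha.periodic

/-- Each block converges, with a summable majorant uniform in `R ≥ 1`. The limit does not involve
`χ`, which is the independence of the cutoff. -/
lemma IsFinSymbol.tendsto_opVal {a : Plane × Plane → ℂ} (ha : IsFinSymbol a) {b : ℝ}
    {u : Plane → ℂ} (hu : IsMagInvariant b u) (hs : ContDiff ℝ ∞ u) (x : Plane)
    {χ : Plane → ℝ} (hχ : ContDiff ℝ ∞ χ) (hc : HasCompactSupport χ) (h0 : χ 0 = 1) :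
    Tendsto (fun R => opVal b (MagneticTorus.truncate χ R a) u x) atTop
      (𝓝 (limVal b a u x)) := by
  refine Tendsto.const_mul _ ?_
  obtain ⟨K, hK⟩ := exists_enorm_quantTerm_le hu hs x
  obtain ⟨C, hC⟩ := IsFinSymbol.exists_nrm_truncate_le hχ hc
  have hfin : (K : ℝ≥0∞) * (C * nrm fullDirs a) ≠ ⊤ :=
    ENNReal.mul_ne_top ENNReal.coe_ne_top (ENNReal.mul_ne_top ENNReal.coe_ne_top ha.finite.ne)
  refine tendsto_tsum_of_dominated_convergence
    (summable_omega_mul.mul_left ((K : ℝ≥0∞) * (C * nrm fullDirs a)).toReal) (fun p => ?_) ?_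
  · refine (ha.tendsto_phaseTerm b (contDiff_piece p.2 hs) (hasCompactSupport_piece p.2 u)
      p.1 x hχ hc h0).congr' ?_
    filter_upwards [eventually_gt_atTop 0] with R hR
    exact ((ha.truncate hχ hc hR).quantTerm_eq_phaseTerm b (contDiff_piece p.2 hs)
      (hasCompactSupport_piece p.2 u) p.1 x).symm
  · filter_upwards [eventually_ge_atTop 1] with R hR p
    have h := (hK _ (ha.truncate hχ hc (zero_lt_one.trans_le hR)) p.2 p.1).trans
      (mul_le_mul' (mul_le_mul' le_rfl (hC a ha R hR)) le_rfl)
    rw [← ofReal_norm, ← ENNReal.ofReal_toReal hfin,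
      ← ENNReal.ofReal_mul ENNReal.toReal_nonneg] at h
    exact (ENNReal.ofReal_le_ofReal_iff (mul_nonneg ENNReal.toReal_nonneg
      (mul_pos (omega_pos _) (omega_pos _)).le)).1 h

lemma IsFinSymbol.isQuantValue {a : Plane × Plane → ℂ} (ha : IsFinSymbol a) {b : ℝ}
    {u : Plane → ℂ} (hu : IsMagInvariant b u) (hs : ContDiff ℝ ∞ u) :
    IsQuantValue 1 b a u (limVal b a u) := fun χ hχ hc h0 x =>
  ⟨fun R => opVal b (MagneticTorus.truncate χ R a) u x,
    fun _ hR => (ha.truncate hχ hc hR).hasQuantSum hu hs x, ha.tendsto_opVal hu hs x hχ hc h0⟩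

lemma exists_cutoff : ∃ χ : Plane → ℝ, ContDiff ℝ ∞ χ ∧ HasCompactSupport χ ∧ χ 0 = 1 := by
  let f : ContDiffBump (0 : Plane) := ⟨1, 2, one_pos, by norm_num⟩
  exact ⟨f, f.contDiff, f.hasCompactSupport, f.one_of_mem_closedBall
    (Metric.mem_closedBall_self f.rIn_pos.le)⟩

lemma IsFinSymbol.aestronglyMeasurable_limVal {a : Plane × Plane → ℂ} (ha : IsFinSymbol a) {b : ℝ}
    {u : Plane → ℂ} (hu : IsMagInvariant b u) (hs : ContDiff ℝ ∞ u) :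
    AEStronglyMeasurable (limVal b a u) volume := by
  obtain ⟨χ, hχ, hc, h0⟩ := exists_cutoff
  have hpos : ∀ n : ℕ, (0 : ℝ) < (n : ℝ) + 1 := fun n => by positivity
  refine aestronglyMeasurable_of_tendsto_ae (atTop : Filter ℕ)
    (f := fun n => opVal b (MagneticTorus.truncate χ ((n : ℝ) + 1) a) u)
    (fun n => (ha.truncate hχ hc (hpos n)).aestronglyMeasurable_opVal hu hs)
    (ae_of_all _ fun x => ?_)
  exact (ha.tendsto_opVal hu hs x hχ hc h0).comp
    (tendsto_natCast_atTop_atTop.atTop_add tendsto_const_nhds)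

/-- The `L²` bound on smooth sections. -/
lemma exists_eLpNorm_limVal_le (b : ℝ) : ∃ K : ℝ≥0, ∀ (u : Plane → ℂ), IsMagInvariant b u →
    ContDiff ℝ ∞ u → ∀ (a : Plane × Plane → ℂ), IsFinSymbol a →
      eLpNorm (limVal b a u) 2 (volume.restrict unitSquare) ≤
        K * nrm fullDirs a * eLpNorm u 2 (volume.restrict unitSquare) := by
  obtain ⟨χ, hχ, hc, h0⟩ := exists_cutoff
  obtain ⟨K, hK⟩ := exists_eLpNorm_opVal_le b
  obtain ⟨C, hC⟩ := IsFinSymbol.exists_nrm_truncate_le hχ hc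
  refine ⟨K * C, fun u hu hs a ha => ?_⟩
  have hpos : ∀ n : ℕ, (0 : ℝ) < (n : ℝ) + 1 := fun n => by positivity
  -- Fatou along `R = n + 1`, a sequence that stays in the range `R ≥ 1` of the uniform bound.
  refine Lp.eLpNorm_le_of_ae_tendsto (u := (atTop : Filter ℕ))
    (f := fun n => opVal b (MagneticTorus.truncate χ ((n : ℝ) + 1) a) u)
    (Eventually.of_forall fun n => ?_)
    (fun n => ((ha.truncate hχ hc (hpos n)).aestronglyMeasurable_opVal hu hs).restrict)
    (ae_of_all _ fun x => ?_)
  · refine (hK u hu hs _ (ha.truncate hχ hc (hpos n))).trans ?_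
    have h1 := hC a ha ((n : ℝ) + 1) (by simp)
    calc _ ≤ (K : ℝ≥0∞) * (eLpNorm u 2 (volume.restrict unitSquare) * (C * nrm fullDirs a)) :=
          mul_le_mul' le_rfl (mul_le_mul' le_rfl h1)
      _ = _ := by
          rw [ENNReal.coe_mul]
          ring
  · exact (ha.tendsto_opVal hu hs x hχ hc h0).comp
      (tendsto_natCast_atTop_atTop.atTop_add tendsto_const_nhds)

/-! ### Uniqueness, linearity and invariance of the quantization -/

lemma HasQuantSum.unique {h b : ℝ} {a : Plane × Plane → ℂ} {u : Plane → ℂ} {x : Plane} {z z' : ℂ}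
    (h1 : HasQuantSum h b a u x z) (h2 : HasQuantSum h b a u x z') : z = z' :=
  h1.2.unique h2.2

lemma IsQuantValue.unique {h b : ℝ} {a : Plane × Plane → ℂ} {u v v' : Plane → ℂ}
    (h1 : IsQuantValue h b a u v) (h2 : IsQuantValue h b a u v') : v = v' := by
  obtain ⟨χ, hχ, hc, h0⟩ := exists_cutoff
  funext x
  obtain ⟨s, hs, hs'⟩ := h1 χ hχ hc h0 x
  obtain ⟨t, ht, ht'⟩ := h2 χ hχ hc h0 x
  refine tendsto_nhds_unique (hs'.congr' ?_) ht'
  filter_upwards [eventually_gt_atTop 0] with R hR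
  exact (hs R hR).unique (ht R hR)

lemma HasQuantSum.add {h b : ℝ} {a : Plane × Plane → ℂ} {u u' : Plane → ℂ} {x : Plane} {z z' : ℂ}
    (h1 : HasQuantSum h b a u x z) (h2 : HasQuantSum h b a u' x z') :
    HasQuantSum h b a (fun y => u y + u' y) x (z + z') := by
  have e : ∀ η ζ, quantIntegrand h b a (fun y => u y + u' y) x η ζ =
      quantIntegrand h b a u x η ζ + quantIntegrand h b a u' x η ζ := fun η ζ => by
    simp only [quantIntegrand, weylOp]; ring
  refine ⟨fun k => ?_, ?_⟩
  · exact ((h1.1 k).add (h2.1 k)).congr (ae_of_all _ fun ζ => (e _ ζ).symm)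
  · refine (h1.2.add h2.2).congr_fun fun k => ?_
    simp only [e]
    rw [integral_add (h1.1 k) (h2.1 k), mul_add]

lemma HasQuantSum.const_mul {h b : ℝ} {a : Plane × Plane → ℂ} {u : Plane → ℂ} {x : Plane} {z : ℂ}
    (c : ℂ) (h1 : HasQuantSum h b a u x z) :
    HasQuantSum h b a (fun y => c * u y) x (c * z) := by
  have e : ∀ η ζ, quantIntegrand h b a (fun y => c * u y) x η ζ =
      c * quantIntegrand h b a u x η ζ := fun η ζ => by
    simp only [quantIntegrand, weylOp]; ring
  refine ⟨fun k => ?_, ?_⟩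
  · exact ((h1.1 k).const_mul c).congr (ae_of_all _ fun ζ => (e _ ζ).symm)
  · refine (h1.2.mul_left c).congr_fun fun k => ?_
    simp only [e]
    rw [integral_const_mul]
    ring

lemma IsQuantValue.add {h b : ℝ} {a : Plane × Plane → ℂ} {u u' v v' : Plane → ℂ}
    (h1 : IsQuantValue h b a u v) (h2 : IsQuantValue h b a u' v') :
    IsQuantValue h b a (fun y => u y + u' y) (fun y => v y + v' y) := by
  intro χ hχ hc h0 x
  obtain ⟨s, hs, hs'⟩ := h1 χ hχ hc h0 x
  obtain ⟨t, ht, ht'⟩ := h2 χ hχ hc h0 x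
  exact ⟨fun R => s R + t R, fun R hR => (hs R hR).add (ht R hR), hs'.add ht'⟩

lemma IsQuantValue.const_mul {h b : ℝ} {a : Plane × Plane → ℂ} {u v : Plane → ℂ} (c : ℂ)
    (h1 : IsQuantValue h b a u v) :
    IsQuantValue h b a (fun y => c * u y) (fun y => c * v y) := by
  intro χ hχ hc h0 x
  obtain ⟨s, hs, hs'⟩ := h1 χ hχ hc h0 x
  exact ⟨fun R => c * s R, fun R hR => (hs R hR).const_mul c, hs'.const_mul c⟩

/-- Weyl operators commute with the magnetic translations: the two cross terms in `ζ` and `e` agree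
by antisymmetry of the wedge, and `exp(i η · e) = 1` because `η ∈ 2πℤ²`. -/
lemma weylOp_add_single (h : ℝ) {b : ℝ} {u : Plane → ℂ} (hu : IsMagInvariant b u) (k : Fin 2 → ℤ)
    (ζ x : Plane) (j : Fin 2) : weylOp h b (freq k) ζ u x =
      Complex.exp (Complex.I * (b / 2 * wedge (latticeVec (Pi.single j 1)) x : ℝ)) *
        weylOp h b (freq k) ζ u (x - latticeVec (Pi.single j 1)) := by
  set e := latticeVec (Pi.single j 1) with he
  have h1 : u (x + h • ζ) = Complex.exp (Complex.I * (b / 2 * wedge e (x - e + h • ζ) : ℝ)) *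
      u (x - e + h • ζ) := by
    rw [← hu.add_single j, ← he]
    congr 1
    abel
  have h2 : Complex.exp (Complex.I * (inner ℝ (freq k) (x + (h / 2) • ζ) : ℝ)) =
      Complex.exp (Complex.I * (inner ℝ (freq k) (x - e + (h / 2) • ζ) : ℝ)) := by
    have h3 : x + (h / 2) • ζ = (x - e + (h / 2) • ζ) + e := by abel
    rw [h3, inner_add_right, he, inner_freq_latticeVec, Complex.exp_eq_exp_iff_exists_int]
    refine ⟨k 0 * (Pi.single j 1 : Fin 2 → ℤ) 0 + k 1 * (Pi.single j 1 : Fin 2 → ℤ) 1, ?_⟩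
    push_cast
    ring
  simp only [weylOp, h1, h2]
  have h4 : Complex.exp (Complex.I * (h * b / 2 * wedge ζ x : ℝ)) *
      Complex.exp (Complex.I * (b / 2 * wedge e (x - e + h • ζ) : ℝ)) =
      Complex.exp (Complex.I * (b / 2 * wedge e x : ℝ)) *
        Complex.exp (Complex.I * (h * b / 2 * wedge ζ (x - e) : ℝ)) := by
    rw [← Complex.exp_add, ← Complex.exp_add]
    congr 1
    simp [wedge]
    ring
  linear_combination (Complex.exp (Complex.I *
    (inner ℝ (freq k) (x - e + (h / 2) • ζ) : ℝ)) * u (x - e + h • ζ)) * h4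

/-- The magnetic translate of `v` is again a value of the quantization at `u`, so uniqueness
identifies it with `v` at every point. -/
lemma IsQuantValue.isMagInvariant {h b : ℝ} {a : Plane × Plane → ℂ} {u v : Plane → ℂ}
    (hu : IsMagInvariant b u) (hv : IsQuantValue h b a u v) : IsMagInvariant b v := by
  intro j
  refine IsQuantValue.unique (h := h) (a := a) (u := u) (b := b) ?_ hv
  intro χ hχ hc h0 x
  obtain ⟨s, hs, hs'⟩ := hv χ hχ hc h0 (x - latticeVec (Pi.single j 1))
  refine ⟨fun R => Complex.exp (Complex.I *
    (b / 2 * wedge (latticeVec (Pi.single j 1)) x : ℝ)) * s R, fun R hR => ?_, hs'.const_mul _⟩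
  set c := Complex.exp (Complex.I * (b / 2 * wedge (latticeVec (Pi.single j 1)) x : ℝ))
  have e : ∀ k ζ, quantIntegrand h b (truncate χ R a) u x (freq k) ζ =
      c * quantIntegrand h b (truncate χ R a) u (x - latticeVec (Pi.single j 1)) (freq k) ζ :=
    fun k ζ => by
      rw [quantIntegrand, quantIntegrand, weylOp_add_single h hu k ζ x j]
      ring
  have h1 := hs R hR
  refine ⟨fun k => ?_, ?_⟩
  · exact ((h1.1 k).const_mul c).congr (ae_of_all _ fun ζ => (e k ζ).symm)
  · refine (h1.2.mul_left c).congr_fun fun k => ?_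
    simp only [e]
    rw [integral_const_mul]
    ring

/-! ### The space `L²(𝕋², L)` -/

lemma L2Section.ext_ae {b : ℝ} {u v : L2Section b}
    (h : u.toAEEqFun =ᵐ[volume] v.toAEEqFun) : u = v :=
  Subtype.ext (AEEqFun.ext h)

lemma L2Section.norm_eq {b : ℝ} (u : L2Section b) :
    ‖u‖ = (eLpNorm u.toAEEqFun 2 (volume.restrict unitSquare)).toReal :=
  Lp.norm_toLp u.toAEEqFun u.memLp_unitSquare

lemma L2Section.norm_restrict {b : ℝ} (u : L2Section b) : ‖L2Section.restrict b u‖ = ‖u‖ := rfl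

lemma isometry_restrict (b : ℝ) : Isometry (L2Section.restrict b) :=
  AddMonoidHomClass.isometry_of_norm _ L2Section.norm_restrict

/-- A compact set meets finitely many cells, and on each of them the norm is that on the unit
square. -/
lemma IsMagInvariant.memLp_restrict {b : ℝ} {v : Plane → ℂ} (hv : IsMagInvariant b v)
    (hm : AEStronglyMeasurable v volume) (hfin : eLpNorm v 2 (volume.restrict unitSquare) < ⊤)
    {K : Set Plane} (hK : IsCompact K) : MemLp v 2 (volume.restrict K) := by
  obtain ⟨C, hC⟩ := hK.isBounded.subset_closedBall (0 : Plane)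
  obtain ⟨N, hN⟩ := exists_nat_ge (C + 1)
  let s : Finset (Fin 2 → ℤ) := Fintype.piFinset fun _ => Finset.Icc (-N : ℤ) N
  let cell : (Fin 2 → ℤ) → Set Plane := fun m => {x | x - latticeVec m ∈ unitSquare}
  have hmeas : ∀ m, MeasurableSet (cell m) := fun m =>
    measurableSet_unitSquare.preimage (measurable_id.sub_const (latticeVec m))
  have hcell : ∀ m ∈ s, MemLp ((cell m).indicator v) 2 volume := fun m _ => by
    refine (memLp_indicator_iff_restrict (hmeas m)).2 ⟨hm.restrict, ?_⟩
    rw [eLpNorm_cell m (ae_of_all _ fun x => ?_)]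
    · exact hfin
    · rw [← ofReal_norm, ← ofReal_norm, hv.norm_add_lattice]
  have hsum : MemLp (fun x => ∑ m ∈ s, (cell m).indicator v x) 2 volume :=
    memLp_finsetSum s hcell
  refine (hsum.mono_measure Measure.restrict_le_self).ae_eq ?_
  filter_upwards [ae_restrict_mem hK.measurableSet] with x hx
  have hxs : floorVec x ∈ s := by
    simp only [s, Fintype.mem_piFinset, Finset.mem_Icc]
    intro i
    have h1 : |x i| ≤ C := (PiLp.norm_apply_le x i).trans (by simpa using hC hx)
    have h2 := abs_le.1 h1
    constructor
    · refine Int.le_floor.2 ?_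
      push_cast
      linarith [h2.1]
    · refine Int.floor_le_iff.2 ?_
      push_cast
      linarith [h2.2]
  rw [Finset.sum_eq_single_of_mem _ hxs]
  · exact Set.indicator_of_mem (s := cell (floorVec x)) (sub_floorVec_mem x) v
  · intro m _ hm
    exact Set.indicator_of_notMem (s := cell m) (fun h => hm (eq_floorVec_of_sub_mem h)) v

/-- The element of `L²(𝕋², L)` defined by an invariant function. -/
def IsMagInvariant.toSection {b : ℝ} {v : Plane → ℂ} (hv : IsMagInvariant b v)
    (hm : AEStronglyMeasurable v volume) (hfin : eLpNorm v 2 (volume.restrict unitSquare) < ⊤) :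
    L2Section b :=
  ⟨AEEqFun.mk v hm, fun _ hK => (memLp_congr_ae (ae_restrict_of_ae (AEEqFun.coeFn_mk v hm))).2
      (hv.memLp_restrict hm hfin hK), fun j => by
    filter_upwards [AEEqFun.coeFn_mk v hm,
      ae_translate (AEEqFun.coeFn_mk v hm) (latticeVec (Pi.single j 1))] with x h1 h2
    rw [h1, magTranslate, h2]
    exact congrFun (hv j) x⟩

lemma IsMagInvariant.coeFn_toSection {b : ℝ} {v : Plane → ℂ} (hv : IsMagInvariant b v)
    (hm : AEStronglyMeasurable v volume) (hfin : eLpNorm v 2 (volume.restrict unitSquare) < ⊤) :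
    (hv.toSection hm hfin).toAEEqFun =ᵐ[volume] v :=
  AEEqFun.coeFn_mk v hm

lemma L2Section.norm_eq_of_ae {b : ℝ} {u : L2Section b} {v : Plane → ℂ}
    (h : u.toAEEqFun =ᵐ[volume] v) :
    ‖u‖ = (eLpNorm v 2 (volume.restrict unitSquare)).toReal := by
  rw [u.norm_eq, eLpNorm_congr_ae (ae_restrict_of_ae h)]

lemma SmoothSection.coeFn_toL2 {b : ℝ} (u : SmoothSection b) :
    u.toL2.toAEEqFun =ᵐ[volume] u.toFun :=
  AEEqFun.coeFn_mk _ _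

/-! ### Extension from the fundamental domain -/

/-- The invariant extension of a function on the fundamental domain. -/
def magExt (b : ℝ) (f : Plane → ℂ) (x : Plane) : ℂ :=
  magPhase b (floorVec x) (x - latticeVec (floorVec x)) * f (x - latticeVec (floorVec x))

lemma magExt_of_mem (b : ℝ) (f : Plane → ℂ) {x : Plane} (hx : x ∈ unitSquare) :
    magExt b f x = f x := by
  simp [magExt, floorVec_eq_zero hx, latticeVec_zero, magPhase, wedge]

/-- The one place where the flux must lie in `2πℤ`. The first generator reproduces the phases
exactly, whereas the second leaves the factor `exp(-i b m_0)`, with `m` the cell of the point. -/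
lemma isMagInvariant_magExt {b : ℝ} (hb : ∃ n : ℤ, b = 2 * Real.pi * n) (f : Plane → ℂ) :
    IsMagInvariant b (magExt b f) := by
  obtain ⟨n, rfl⟩ := hb
  intro j
  funext x
  obtain ⟨m, y, hm, hx⟩ : ∃ m y, floorVec x = m ∧ x = y + latticeVec m :=
    ⟨floorVec x, x - latticeVec (floorVec x), rfl, by simp⟩
  have hf : floorVec (x - latticeVec (Pi.single j 1)) = m - Pi.single j 1 := by
    rw [← hm, sub_eq_add_neg, ← latticeVec_neg, floorVec_add, sub_eq_add_neg]
  have hy : x - latticeVec m = y := by rw [hx]; simp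
  have hy2 : x - latticeVec (Pi.single j 1) - latticeVec (m - Pi.single j 1) = y := by
    rw [latticeVec_sub, hx]; abel
  simp only [magTranslate, magExt, hm, hf, hy, hy2]
  rw [← mul_assoc, magPhase, magPhase, ← Complex.exp_add]
  congr 1
  fin_cases j
  · congr 1
    rw [hx]
    simp [wedge, latticeVec_apply]
    ring
  · rw [Complex.exp_eq_exp_iff_exists_int]
    refine ⟨-(n * m 0), ?_⟩
    rw [hx]
    simp [wedge, latticeVec_apply]
    ring

lemma measurable_floorVec : Measurable floorVec := by
  refine measurable_pi_iff.2 fun i => ?_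
  exact Int.measurable_floor.comp (by fun_prop : Measurable fun x : Plane => x i)

lemma measurable_comp_floorVec {F : (Fin 2 → ℤ) → Plane → ℂ} (hF : ∀ m, Measurable (F m)) :
    Measurable fun x => F (floorVec x) x := by
  have h : Measurable fun p : (Fin 2 → ℤ) × Plane => F p.1 p.2 :=
    measurable_from_prod_countable_right hF
  exact h.comp (measurable_floorVec.prodMk measurable_id)

lemma measurable_magExt (b : ℝ) {f : Plane → ℂ} (hf : Measurable f) :
    Measurable (magExt b f) :=
  measurable_comp_floorVec (F := fun m x => magPhase b m (x - latticeVec m) * f (x - latticeVec m))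
    fun m => ((contDiff_magPhase b m).continuous.measurable.mul hf).comp
      (measurable_id.sub_const (latticeVec m))

/-- `magExt` supplies the preimage. With the isometry this identifies `L²(𝕋², L)` with `L²` of the
square, whence completeness. -/
lemma restrict_surjective {b : ℝ} (hb : ∃ n : ℤ, b = 2 * Real.pi * n) :
    Function.Surjective (L2Section.restrict b) := by
  intro f
  have hm := measurable_magExt b (Lp.stronglyMeasurable f).measurable
  have he : magExt b f =ᵐ[volume.restrict unitSquare] f := by
    filter_upwards [ae_restrict_mem measurableSet_unitSquare] with x hx using magExt_of_mem b f hx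
  have hfin : eLpNorm (magExt b f) 2 (volume.restrict unitSquare) < ⊤ := by
    rw [eLpNorm_congr_ae he]
    exact Lp.eLpNorm_lt_top f
  obtain ⟨v, hv⟩ : ∃ v : L2Section b, v.toAEEqFun =ᵐ[volume] magExt b f :=
    ⟨_, (isMagInvariant_magExt hb f).coeFn_toSection hm.aestronglyMeasurable hfin⟩
  refine ⟨v, Lp.ext ?_⟩
  have h1 : v.toAEEqFun =ᵐ[volume.restrict unitSquare] magExt b f := ae_restrict_of_ae hv
  exact v.memLp_unitSquare.coeFn_toLp.trans (h1.trans he)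

lemma completeSpace_L2Section {b : ℝ} (hb : ∃ n : ℤ, b = 2 * Real.pi * n) :
    CompleteSpace (L2Section b) := by
  rw [completeSpace_iff_isComplete_range (isometry_restrict b).isUniformInducing,
    (restrict_surjective hb).range_eq]
  exact completeSpace_iff_isComplete_univ.1 inferInstance

/-- As `g` is smooth on the plane and vanishes off the square, its translated copies have no seams.
Near `x₀` the extension is the finite sum of the copies attached to the three by three block of
cells around that point. -/
lemma contDiff_magExt (b : ℝ) {g : Plane → ℂ} (hg : ContDiff ℝ ∞ g)
    (hs : ∀ x, x ∉ unitSquare → g x = 0) : ContDiff ℝ ∞ (magExt b g) := by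
  refine contDiff_iff_contDiffAt.2 fun x₀ => ?_
  let M : Finset (Fin 2 → ℤ) := Fintype.piFinset fun i => Finset.Icc (⌊x₀ i⌋ - 1) (⌊x₀ i⌋ + 1)
  have h1 : ContDiff ℝ ∞ fun x : Plane =>
      ∑ m ∈ M, magPhase b m (x - latticeVec m) * g (x - latticeVec m) := by
    refine ContDiff.sum fun m _ => ?_
    exact ((contDiff_magPhase b m).mul hg).comp (contDiff_id.sub contDiff_const)
  refine h1.contDiffAt.congr_of_eventuallyEq ?_
  filter_upwards [Metric.ball_mem_nhds x₀ one_pos] with x hx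
  have hxM : floorVec x ∈ M := by
    simp only [M, Fintype.mem_piFinset, Finset.mem_Icc]
    intro i
    have h2 : |x i - x₀ i| < 1 :=
      (PiLp.norm_apply_le (x - x₀) i).trans_lt (by simpa [dist_eq_norm] using hx)
    have h3 := abs_lt.1 h2
    have h4 := Int.floor_le (x₀ i)
    have h5 := Int.lt_floor_add_one (x₀ i)
    constructor
    · refine Int.le_floor.2 ?_
      push_cast
      linarith [h3.1]
    · refine Int.floor_le_iff.2 ?_
      push_cast
      linarith [h3.2]
  rw [Finset.sum_eq_single_of_mem _ hxM]
  · rfl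
  · intro m _ hm
    rw [hs _ fun h => hm (eq_floorVec_of_sub_mem h), mul_zero]

/-! ### Density of the smooth sections -/

/-- The space of smooth invariant functions. -/
def smoothSubmodule (b : ℝ) : Submodule ℂ (Plane → ℂ) where
  carrier := {u | ContDiff ℝ ∞ u ∧ IsMagInvariant b u}
  add_mem' := by
    rintro u v ⟨hu, hu'⟩ ⟨hv, hv'⟩
    refine ⟨hu.add hv, fun j => ?_⟩
    conv_rhs => rw [← hu' j, ← hv' j]
    funext x
    simp [magTranslate, mul_add]
  zero_mem' := ⟨contDiff_const, fun j => by funext x; simp [magTranslate]⟩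
  smul_mem' := by
    rintro c u ⟨hu, hu'⟩
    refine ⟨hu.const_smul c, fun j => ?_⟩
    conv_rhs => rw [← hu' j]
    funext x
    simp [magTranslate, mul_left_comm]

/-- A smooth invariant function as a smooth section. -/
def smoothSection {b : ℝ} (u : smoothSubmodule b) : SmoothSection b := ⟨u.1, u.2.1, u.2.2⟩

/-- The inclusion of the smooth invariant functions in `L²(𝕋², L)` as a linear map. -/
def smoothToL2 (b : ℝ) : smoothSubmodule b →ₗ[ℂ] L2Section b where
  toFun u := (smoothSection u).toL2
  map_add' _ _ := rfl
  map_smul' _ _ := rfl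

lemma ae_unitSquare_mem_interior : ∀ᵐ x : Plane, x ∈ unitSquare →
    x ∈ {x : Plane | ∀ i, x i ∈ Set.Ioo (0 : ℝ) 1} := by
  have h1 : (Set.univ.pi fun _ : Fin 2 => Set.Ico (0 : ℝ) 1) =ᵐ[volume]
      (Set.univ.pi fun _ : Fin 2 => Set.Ioo (0 : ℝ) 1) :=
    (Measure.univ_pi_Ico_ae_eq_Icc (f := (0 : Fin 2 → ℝ)) (g := 1)).trans
      (Measure.univ_pi_Ioo_ae_eq_Icc (f := (0 : Fin 2 → ℝ)) (g := 1)).symm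
  have h2 := (EuclideanSpace.volume_preserving_symm_measurableEquiv_toLp
    (Fin 2)).quasiMeasurePreserving.preimage_ae_eq h1
  filter_upwards [h2.mem_iff] with x hx hx2
  simpa using hx.1 (by simpa [unitSquare] using hx2)

/-- An `f` orthogonal to the smooth sections is tested against the invariant extensions of real test
functions supported in the open square. This forces `f = 0` almost everywhere there, and the
boundary of the square is null. -/
lemma denseRange_smoothToL2 {b : ℝ} (hb : ∃ n : ℤ, b = 2 * Real.pi * n) :
    DenseRange (smoothToL2 b) := by
  let T : smoothSubmodule b →ₗ[ℂ] Lp ℂ 2 (volume.restrict unitSquare) :=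
    (L2Section.restrict b).comp (smoothToL2 b)
  have hT : DenseRange T := by
    have : (LinearMap.range T).topologicalClosure = ⊤ := by
      rw [Submodule.topologicalClosure_eq_top_iff, Submodule.eq_bot_iff]
      intro f hf
      have hf2 : ∀ᵐ x : Plane, x ∈ {x : Plane | ∀ i, x i ∈ Set.Ioo (0 : ℝ) 1} → f x = 0 := by
        have ho : IsOpen {x : Plane | ∀ i, x i ∈ Set.Ioo (0 : ℝ) 1} := by
          simp only [Set.ofPred_forall]
          exact isOpen_iInter_of_finite fun i => isOpen_Ioo.preimage (by fun_prop)
        have hsub : {x : Plane | ∀ i, x i ∈ Set.Ioo (0 : ℝ) 1} ⊆ unitSquare := fun x hx i =>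
          Set.Ioo_subset_Ico_self (hx i)
        have hfi : IntegrableOn f unitSquare := (Lp.memLp f).integrable (by norm_num)
        refine ho.ae_eq_zero_of_integral_contDiff_smul_eq_zero
          (hfi.mono_set hsub).locallyIntegrableOn fun g hg hgc hgs => ?_
        have hgz : ∀ x, x ∉ unitSquare → ((g x : ℝ) : ℂ) = 0 := fun x hx => by
          rw [image_eq_zero_of_notMem_tsupport fun h => hx (hsub (hgs h)), Complex.ofReal_zero]
        let u : smoothSubmodule b := ⟨magExt b fun x => (g x : ℂ),
          contDiff_magExt b (Complex.ofRealCLM.contDiff.comp hg) hgz,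
          isMagInvariant_magExt hb _⟩
        have h1 := (Submodule.mem_orthogonal _ _).1 hf (T u) ⟨u, rfl⟩
        rw [L2.inner_def] at h1
        have h2 : ∫ x in unitSquare, g x • f x = 0 := by
          rw [← h1]
          refine integral_congr_ae ?_
          filter_upwards [(smoothToL2 b u).memLp_unitSquare.coeFn_toLp,
            ae_restrict_of_ae (smoothSection u).coeFn_toL2,
            ae_restrict_mem measurableSet_unitSquare] with x hx1 hx2 hx3
          have : T u x = (g x : ℂ) := by
            refine hx1.trans (hx2.trans ?_)
            exact magExt_of_mem b (fun x => (g x : ℂ)) hx3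
          rw [this]
          simp [mul_comm]
        rw [← h2, ← setIntegral_eq_integral_of_forall_compl_eq_zero]
        intro x hx
        have := hgz x hx
        rw [Complex.ofReal_eq_zero] at this
        rw [this, zero_smul]
      refine Lp.ext ?_
      refine EventuallyEq.trans ?_ (Lp.coeFn_zero _ _ _).symm
      refine (ae_restrict_iff' measurableSet_unitSquare).2 ?_
      filter_upwards [hf2, ae_unitSquare_mem_interior] with x h1 h2 h3 using h1 (h2 h3)
    have h2 := (Submodule.dense_iff_topologicalClosure_eq_top).2 this
    rwa [LinearMap.coe_range] at h2
  intro v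
  rw [(isometry_restrict b).isUniformInducing.isInducing.closure_eq_preimage_closure_image,
    Set.mem_preimage, ← Set.range_comp]
  exact hT _

/-! ### Quantizations at `h = 1` -/

lemma IsFinSymbol.eLpNorm_limVal_lt_top {a : Plane × Plane → ℂ} (ha : IsFinSymbol a) {b : ℝ}
    (u : smoothSubmodule b) : eLpNorm (limVal b a u) 2 (volume.restrict unitSquare) < ⊤ := by
  obtain ⟨K, hK⟩ := exists_eLpNorm_limVal_le b
  refine (hK u u.2.2 u.2.1 a ha).trans_lt (ENNReal.mul_lt_top
    (ENNReal.mul_lt_top ENNReal.coe_lt_top ha.finite) ?_)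
  exact (eLpNorm_congr_ae (ae_restrict_of_ae (smoothSection u).coeFn_toL2)).symm.trans_lt
    (smoothSection u).toL2.memLp_unitSquare.2

/-- The quantization of a symbol on smooth invariant functions, as an element of
`L²(𝕋², L)`. -/
def IsFinSymbol.limSection {a : Plane × Plane → ℂ} (ha : IsFinSymbol a) {b : ℝ}
    (u : smoothSubmodule b) : L2Section b :=
  ((ha.isQuantValue u.2.2 u.2.1).isMagInvariant u.2.2).toSection
    (ha.aestronglyMeasurable_limVal u.2.2 u.2.1) (ha.eLpNorm_limVal_lt_top u)

lemma IsFinSymbol.coeFn_limSection {a : Plane × Plane → ℂ} (ha : IsFinSymbol a) {b : ℝ}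
    (u : smoothSubmodule b) : (ha.limSection u).toAEEqFun =ᵐ[volume] limVal b a u :=
  IsMagInvariant.coeFn_toSection _ _ _

/-- The quantization of a symbol as a linear map on the smooth invariant functions. -/
def IsFinSymbol.limMap {a : Plane × Plane → ℂ} (ha : IsFinSymbol a) (b : ℝ) :
    smoothSubmodule b →ₗ[ℂ] L2Section b where
  toFun := ha.limSection
  map_add' u w := by
    refine L2Section.ext_ae ?_
    -- Linearity comes from uniqueness of the oscillatory value rather than from the series defining
    -- `limVal`.
    have h : limVal b a (u + w : smoothSubmodule b) = fun y => limVal b a u y + limVal b a w y :=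
      (ha.isQuantValue (u + w).2.2 (u + w).2.1).unique
        ((ha.isQuantValue u.2.2 u.2.1).add (ha.isQuantValue w.2.2 w.2.1))
    have h2 : (ha.limSection u + ha.limSection w).toAEEqFun =ᵐ[volume]
        ⇑(ha.limSection u).toAEEqFun + ⇑(ha.limSection w).toAEEqFun := AEEqFun.coeFn_add _ _
    filter_upwards [h2, ha.coeFn_limSection u, ha.coeFn_limSection w,
      ha.coeFn_limSection (u + w)] with x h2 h3 h4 h5
    rw [h2, h5, Pi.add_apply, h3, h4, h]
  map_smul' c u := by
    refine L2Section.ext_ae ?_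
    have h : limVal b a (c • u : smoothSubmodule b) = fun y => c * limVal b a u y :=
      (ha.isQuantValue (c • u).2.2 (c • u).2.1).unique
        ((ha.isQuantValue u.2.2 u.2.1).const_mul c)
    have h2 : (c • ha.limSection u).toAEEqFun =ᵐ[volume] c • ⇑(ha.limSection u).toAEEqFun :=
      AEEqFun.coeFn_smul _ _
    filter_upwards [h2, ha.coeFn_limSection u, ha.coeFn_limSection (c • u)] with x h2 h3 h5
    rw [RingHom.id_apply, h2, h5, Pi.smul_apply, h3, h, smul_eq_mul]

lemma exists_norm_limMap_le (b : ℝ) : ∃ K : ℝ≥0, ∀ {a : Plane × Plane → ℂ} (ha : IsFinSymbol a)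
    (u : smoothSubmodule b),
    ‖ha.limMap b u‖ ≤ K * (nrm fullDirs a).toReal * ‖smoothToL2 b u‖ := by
  obtain ⟨K, hK⟩ := exists_eLpNorm_limVal_le b
  refine ⟨K, fun {a} ha u => ?_⟩
  have h1 : ‖ha.limMap b u‖ = _ := L2Section.norm_eq_of_ae (ha.coeFn_limSection u)
  have h2 : ‖smoothToL2 b u‖ = _ := L2Section.norm_eq_of_ae (smoothSection u).coeFn_toL2
  have h3 : eLpNorm u.1 2 (volume.restrict unitSquare) ≠ ⊤ :=
    ((eLpNorm_congr_ae (ae_restrict_of_ae (smoothSection u).coeFn_toL2)).symm.trans_lt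
      (smoothSection u).toL2.memLp_unitSquare.2).ne
  rw [h1, h2, ← ENNReal.coe_toReal, ← ENNReal.toReal_mul, ← ENNReal.toReal_mul]
  exact ENNReal.toReal_mono (ENNReal.mul_ne_top
    (ENNReal.mul_ne_top ENNReal.coe_ne_top ha.finite.ne) h3) (hK u u.2.2 u.2.1 a ha)

/-- Turns the pointwise definition into an identity on the dense subspace of smooth sections, where
extension and uniqueness are formal. -/
lemma IsFinSymbol.isQuantization_iff {a : Plane × Plane → ℂ} (ha : IsFinSymbol a) {b : ℝ}
    (A : L2Section b →L[ℂ] L2Section b) :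
    IsQuantization 1 b a A ↔ ∀ u, A (smoothToL2 b u) = ha.limMap b u := by
  constructor
  · intro hA u
    obtain ⟨v, hv, hAv⟩ := hA (smoothSection u)
    rw [hv.unique (ha.isQuantValue u.2.2 u.2.1)] at hAv
    exact L2Section.ext_ae (hAv.trans (ha.coeFn_limSection u).symm)
  · intro hA u
    let w : smoothSubmodule b := ⟨u.toFun, u.smooth, u.invariant⟩
    refine ⟨limVal b a u.toFun, ha.isQuantValue u.invariant u.smooth, ?_⟩
    have h : A u.toL2 = ha.limMap b w := hA w
    rw [h]
    exact ha.coeFn_limSection w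

lemma IsFinSymbol.existsUnique_isQuantization {a : Plane × Plane → ℂ} (ha : IsFinSymbol a) {b : ℝ}
    (hb : ∃ n : ℤ, b = 2 * Real.pi * n) :
    ∃! A : L2Section b →L[ℂ] L2Section b, IsQuantization 1 b a A := by
  have := completeSpace_L2Section hb
  obtain ⟨K, hK⟩ := exists_norm_limMap_le b
  simp only [ha.isQuantization_iff]
  refine ⟨(ha.limMap b).extendOfNorm (smoothToL2 b),
    LinearMap.extendOfNorm_eq (denseRange_smoothToL2 hb) ⟨_, hK ha⟩, fun A hA => ?_⟩
  refine ContinuousLinearMap.coeFn_injective ((denseRange_smoothToL2 hb).equalizer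
    A.continuous (ContinuousLinearMap.continuous _) (funext fun u => ?_))
  exact (hA u).trans (LinearMap.extendOfNorm_eq (denseRange_smoothToL2 hb) ⟨_, hK ha⟩ u).symm

lemma exists_norm_isQuantization_le {b : ℝ} (hb : ∃ n : ℤ, b = 2 * Real.pi * n) :
    ∃ K : ℝ≥0, ∀ {a : Plane × Plane → ℂ}, IsFinSymbol a →
      ∀ A : L2Section b →L[ℂ] L2Section b, IsQuantization 1 b a A →
        ‖A‖ ≤ K * (nrm fullDirs a).toReal := by
  obtain ⟨K, hK⟩ := exists_norm_limMap_le b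
  refine ⟨K, fun {a} ha A hA => A.opNorm_le_bound (by positivity) fun w => ?_⟩
  rw [ha.isQuantization_iff] at hA
  refine (denseRange_smoothToL2 hb).induction_on
    (p := fun w => ‖A w‖ ≤ K * (nrm fullDirs a).toReal * ‖w‖) w ?_ fun u => ?_
  · exact isClosed_le (by fun_prop) (by fun_prop)
  · rw [hA u]
    exact hK ha u

/-! ### Symbols in `S⁰` -/

lemma IsSymbol.norm_symbolDeriv_le {a : Plane × Plane → ℂ} (ha : IsSymbol a) (γ β : Fin 2 → ℕ)
    (p : Plane × Plane) : ‖symbolDeriv γ β a p‖ ≤ supNorm (symbolDeriv γ β a) := by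
  obtain ⟨C, hC⟩ := ha.bounded γ β
  exact le_ciSup (f := fun p => ‖symbolDeriv γ β a p‖) ⟨C, Set.forall_mem_range.2 hC⟩ p

lemma supNorm_nonneg (f : Plane × Plane → ℂ) : 0 ≤ supNorm f :=
  Real.iSup_nonneg fun _ => norm_nonneg _

lemma mem_multiIndexPairs {N : ℕ} {γ β : Fin 2 → ℕ} (h : len γ + len β ≤ N) :
    (γ, β) ∈ multiIndexPairs N := by
  simp only [multiIndexPairs, Finset.mem_filter, Finset.mem_product, Fintype.mem_piFinset,
    Finset.mem_range, Fin.forall_fin_two]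
  unfold len at *
  omega

/-- At most two derivatives in each of four directions occur, so total order `8` suffices. -/
lemma IsSymbol.nrm_fullDirs_le {a : Plane × Plane → ℂ} (ha : IsSymbol a) {N : ℕ} (hN : 8 ≤ N) :
    nrm fullDirs a ≤ ENNReal.ofReal (256 *
      ∑ p ∈ multiIndexPairs N, supNorm (symbolDeriv p.1 p.2 a)) := by
  rw [ENNReal.ofReal_mul (by norm_num), ENNReal.ofReal_ofNat]
  refine MagneticTorus.nrm_fullDirs_le fun γ β hγ hβ => iSup_le fun p => ?_
  rw [← ofReal_norm]
  refine ENNReal.ofReal_le_ofReal ((ha.norm_symbolDeriv_le γ β p).trans ?_)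
  have h0 := hγ 0
  have h1 := hγ 1
  have h2 := hβ 0
  have h3 := hβ 1
  have hmem : (γ, β) ∈ multiIndexPairs N := mem_multiIndexPairs (by unfold len; omega)
  exact Finset.single_le_sum (f := fun p => supNorm (symbolDeriv p.1 p.2 a))
    (fun p _ => supNorm_nonneg _) hmem

lemma IsSymbol.isFinSymbol {a : Plane × Plane → ℂ} (ha : IsSymbol a) : IsFinSymbol a :=
  ⟨ha.smooth, ha.periodic, (ha.nrm_fullDirs_le le_rfl).trans_lt ENNReal.ofReal_lt_top⟩

/-! ### Dilations in `ξ` -/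

/-- The symbol `a(x, h ξ)`. -/
def dilate (h : ℝ) (a : Plane × Plane → ℂ) : Plane × Plane → ℂ := fun p => a (p.1, h • p.2)

lemma contDiff_dilate (h : ℝ) {a : Plane × Plane → ℂ} (ha : ContDiff ℝ ∞ a) :
    ContDiff ℝ ∞ (dilate h a) :=
  ha.comp (contDiff_fst.prodMk (contDiff_snd.const_smul h))

lemma fderiv_const_mul_dilate (h c : ℝ) {a : Plane × Plane → ℂ} (ha : ContDiff ℝ ∞ a)
    (p v : Plane × Plane) : fderiv ℝ (fun p => (c : ℂ) * dilate h a p) p v =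
      c * fderiv ℝ a (p.1, h • p.2) (v.1, h • v.2) := by
  let T : Plane × Plane →L[ℝ] Plane × Plane :=
    (ContinuousLinearMap.fst ℝ Plane Plane).prod (h • ContinuousLinearMap.snd ℝ Plane Plane)
  have h1 : HasFDerivAt (dilate h a) ((fderiv ℝ a (T p)).comp T) p :=
    (ha.differentiable (by simp) (T p)).hasFDerivAt.comp p T.hasFDerivAt
  rw [(h1.const_mul (c : ℂ)).fderiv]
  rfl

lemma dX_const_mul_dilate (j : Fin 2) (h c : ℝ) {a : Plane × Plane → ℂ} (ha : ContDiff ℝ ∞ a) :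
    dX j (fun p => (c : ℂ) * dilate h a p) = fun p => (c : ℂ) * dilate h (dX j a) p := by
  funext p
  rw [dX, fderiv_const_mul_dilate h c ha]
  simp [dilate, dX]

/-- The prefactor `c` keeps the form stable under iteration, each step contributing one factor `h`.
-/
lemma dXi_const_mul_dilate (j : Fin 2) (h c : ℝ) {a : Plane × Plane → ℂ} (ha : ContDiff ℝ ∞ a) :
    dXi j (fun p => (c : ℂ) * dilate h a p) =
      fun p => ((h * c : ℝ) : ℂ) * dilate h (dXi j a) p := by
  funext p
  rw [dXi, fderiv_const_mul_dilate h c ha]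
  have : ((0 : Plane), h • (EuclideanSpace.single j 1 : Plane)) =
      h • ((0 : Plane), (EuclideanSpace.single j 1 : Plane)) := by simp
  simp only [dilate, dXi, this, map_smul, Complex.real_smul]
  push_cast
  ring

lemma contDiff_iterate_dX (j : Fin 2) (n : ℕ) {a : Plane × Plane → ℂ} (ha : ContDiff ℝ ∞ a) :
    ContDiff ℝ ∞ ((dX j)^[n] a) := by
  induction n generalizing a with
  | zero => exact ha
  | succ n ih => exact ih (contDiff_symD ha (Sum.inl j))

lemma contDiff_iterate_dXi (j : Fin 2) (n : ℕ) {a : Plane × Plane → ℂ} (ha : ContDiff ℝ ∞ a) :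
    ContDiff ℝ ∞ ((dXi j)^[n] a) := by
  induction n generalizing a with
  | zero => exact ha
  | succ n ih => exact ih (contDiff_symD ha (Sum.inr j))

lemma iterate_dX_const_mul_dilate (j : Fin 2) (n : ℕ) (h c : ℝ) {a : Plane × Plane → ℂ}
    (ha : ContDiff ℝ ∞ a) : (dX j)^[n] (fun p => (c : ℂ) * dilate h a p) =
      fun p => (c : ℂ) * dilate h ((dX j)^[n] a) p := by
  induction n generalizing a with
  | zero => rfl
  | succ n ih =>
    rw [Function.iterate_succ_apply, Function.iterate_succ_apply, dX_const_mul_dilate j h c ha]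
    exact ih (contDiff_symD ha (Sum.inl j))

lemma iterate_dXi_const_mul_dilate (j : Fin 2) (n : ℕ) (h c : ℝ) {a : Plane × Plane → ℂ}
    (ha : ContDiff ℝ ∞ a) : (dXi j)^[n] (fun p => (c : ℂ) * dilate h a p) =
      fun p => ((h ^ n * c : ℝ) : ℂ) * dilate h ((dXi j)^[n] a) p := by
  induction n generalizing a c with
  | zero => simp
  | succ n ih =>
    rw [Function.iterate_succ_apply, Function.iterate_succ_apply, dXi_const_mul_dilate j h c ha,
      pow_succ, mul_assoc]
    exact ih _ (contDiff_symD ha (Sum.inr j))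

lemma symbolDeriv_dilate (γ β : Fin 2 → ℕ) (h : ℝ) {a : Plane × Plane → ℂ}
    (ha : ContDiff ℝ ∞ a) : symbolDeriv γ β (dilate h a) =
      fun p => ((h ^ len β : ℝ) : ℂ) * dilate h (symbolDeriv γ β a) p := by
  have h0 : dilate h a = fun p => ((1 : ℝ) : ℂ) * dilate h a p := by simp
  have h1 := contDiff_iterate_dXi 1 (β 1) ha
  have h2 := contDiff_iterate_dXi 0 (β 0) h1
  have h3 := contDiff_iterate_dX 1 (γ 1) h2
  rw [symbolDeriv, h0, iterate_dXi_const_mul_dilate 1 _ h _ ha,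
    iterate_dXi_const_mul_dilate 0 _ h _ h1, iterate_dX_const_mul_dilate 1 _ h _ h2,
    iterate_dX_const_mul_dilate 0 _ h _ h3, mul_one, ← pow_add]
  rfl

lemma supNorm_symbolDeriv_dilate (γ β : Fin 2 → ℕ) {h : ℝ} (hh : 0 < h) {a : Plane × Plane → ℂ}
    (ha : ContDiff ℝ ∞ a) :
    supNorm (symbolDeriv γ β (dilate h a)) = h ^ len β * supNorm (symbolDeriv γ β a) := by
  have hs : Function.Surjective fun p : Plane × Plane => (p.1, h • p.2) := fun p =>
    ⟨(p.1, h⁻¹ • p.2), by simp [smul_smul, hh.ne']⟩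
  rw [symbolDeriv_dilate γ β h ha, supNorm, supNorm,
    ← hs.iSup_comp (g := fun p => ‖symbolDeriv γ β a p‖), Real.mul_iSup_of_nonneg (by positivity)]
  refine iSup_congr fun p => ?_
  rw [norm_mul, Complex.norm_real, Real.norm_of_nonneg (by positivity)]
  rfl

lemma IsSymbol.dilate {a : Plane × Plane → ℂ} (ha : IsSymbol a) (h : ℝ) :
    IsSymbol (dilate h a) where
  smooth := contDiff_dilate h ha.smooth
  periodic m x ξ := ha.periodic m x (h • ξ)
  bounded γ β := by
    obtain ⟨C, hC⟩ := ha.bounded γ β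
    refine ⟨|h ^ len β| * C, fun p => ?_⟩
    rw [symbolDeriv_dilate γ β h ha.smooth, norm_mul, Complex.norm_real, Real.norm_eq_abs]
    exact mul_le_mul_of_nonneg_left (hC _) (abs_nonneg _)

lemma IsCptSymbol.dilate {a : Plane × Plane → ℂ} (ha : IsCptSymbol a) {h : ℝ} (hh : 0 < h) :
    IsCptSymbol (dilate h a) where
  smooth := contDiff_dilate h ha.smooth
  periodic m x ξ := ha.periodic m x (h • ξ)
  cpt := by
    obtain ⟨ρ, hρ⟩ := ha.cpt
    refine ⟨h⁻¹ * ρ, fun x ξ hξ => hρ x (h • ξ) ?_⟩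
    rw [norm_smul, Real.norm_of_nonneg hh.le]
    rwa [inv_mul_lt_iff₀ hh] at hξ

lemma finrank_plane : Module.finrank ℝ Plane = 2 := by simp

lemma IsCptSymbol.symbolFourier_dilate {a : Plane × Plane → ℂ} (ha : IsCptSymbol a) {h : ℝ}
    (hh : 0 < h) (η ζ : Plane) : symbolFourier (MagneticTorus.dilate h a) η ζ =
      ((h ^ 2)⁻¹ : ℝ) * symbolFourier a η (h⁻¹ • ζ) := by
  rw [(ha.dilate hh).symbolFourier_eq_coeff, ha.symbolFourier_eq_coeff, ← Complex.real_smul]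
  have h1 := Measure.integral_comp_smul_of_nonneg volume
    (fun ξ => coeff a η ξ * Complex.exp (-Complex.I * (inner ℝ (h⁻¹ • ζ) ξ : ℝ))) h
    (hR := hh.le)
  rw [finrank_plane] at h1
  rw [← h1]
  congr 1 with ξ
  rw [inner_smul_left, inner_smul_right]
  simp only [map_inv₀, conj_trivial]
  rw [inv_mul_cancel_left₀ hh.ne']
  rfl

/-- Both phases and the translation depend on `h` and `ζ` only through `h ζ`; this is what removes
the semiclassical parameter. -/
lemma weylOp_one_smul (h b : ℝ) (η ζ : Plane) (u : Plane → ℂ) :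
    weylOp 1 b η (h • ζ) u = weylOp h b η ζ u := by
  funext x
  have h1 : wedge (h • ζ) x = h * wedge ζ x := by simp [wedge]; ring
  have h2 : ((1 : ℝ) / 2) • h • ζ = (h / 2) • ζ := by rw [smul_smul]; congr 1; ring
  simp only [weylOp, h1, h2, one_smul]
  congr 5
  ring

lemma IsCptSymbol.quantIntegrand_dilate {a : Plane × Plane → ℂ} (ha : IsCptSymbol a) {h : ℝ}
    (hh : 0 < h) (b : ℝ) (u : Plane → ℂ) (x η ζ : Plane) :
    quantIntegrand 1 b (MagneticTorus.dilate h a) u x η ζ =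
      ((h ^ 2)⁻¹ : ℝ) * quantIntegrand h b a u x η (h⁻¹ • ζ) := by
  rw [quantIntegrand, quantIntegrand, ha.symbolFourier_dilate hh, ← weylOp_one_smul h,
    smul_inv_smul₀ hh.ne', mul_assoc]

/-- The factor `h⁻²` from the Fourier transform of the dilated symbol cancels the Jacobian `h²` of
`ζ ↦ h⁻¹ ζ` in the plane. -/
lemma IsCptSymbol.hasQuantSum_dilate_iff {a : Plane × Plane → ℂ} (ha : IsCptSymbol a) {h : ℝ}
    (hh : 0 < h) (b : ℝ) (u : Plane → ℂ) (x : Plane) (z : ℂ) :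
    HasQuantSum 1 b (MagneticTorus.dilate h a) u x z ↔ HasQuantSum h b a u x z := by
  have hc : (((h ^ 2)⁻¹ : ℝ) : ℂ) ≠ 0 := by
    exact_mod_cast (inv_pos.2 (pow_pos hh 2)).ne'
  refine and_congr (forall_congr' fun k => ?_) ?_
  · rw [show quantIntegrand 1 b (MagneticTorus.dilate h a) u x (freq k) = _ from
      funext (ha.quantIntegrand_dilate hh b u x (freq k)),
      integrable_const_mul_iff (IsUnit.mk0 _ hc)]
    exact integrable_comp_smul_iff volume (quantIntegrand h b a u x (freq k)) (inv_ne_zero hh.ne')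
  · have h1 : ∀ k, ∫ ζ, quantIntegrand 1 b (MagneticTorus.dilate h a) u x (freq k) ζ =
        ∫ ζ, quantIntegrand h b a u x (freq k) ζ := fun k => by
      simp only [ha.quantIntegrand_dilate hh]
      rw [integral_const_mul, Measure.integral_comp_inv_smul_of_nonneg volume
        (quantIntegrand h b a u x (freq k)) hh.le, finrank_plane, Complex.real_smul, ← mul_assoc,
        ← Complex.ofReal_mul, inv_mul_cancel₀ (pow_pos hh 2).ne', Complex.ofReal_one, one_mul]
    simp only [h1]

lemma dilate_truncate (χ : Plane → ℝ) (h R : ℝ) (hh : 0 < h) (a : Plane × Plane → ℂ) :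
    dilate h (truncate χ (h * R) a) = truncate χ R (dilate h a) := by
  funext p
  simp only [dilate, truncate, smul_smul]
  congr 4
  rw [mul_inv, mul_right_comm, inv_mul_cancel₀ hh.ne', one_mul]

/-- Truncating the dilated symbol at scale `R` is dilating the symbol truncated at scale `h R`. For
fixed `h > 0` both scales tend to infinity together. -/
lemma isQuantValue_dilate_iff {a : Plane × Plane → ℂ} (ha : IsSymbol a) {h : ℝ} (hh : 0 < h)
    {b : ℝ} {u v : Plane → ℂ} : IsQuantValue 1 b (dilate h a) u v ↔ IsQuantValue h b a u v := by
  have key : ∀ χ : Plane → ℝ, ContDiff ℝ ∞ χ → HasCompactSupport χ → ∀ R : ℝ, 0 < R → ∀ x z,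
      (HasQuantSum 1 b (truncate χ R (dilate h a)) u x z ↔
        HasQuantSum h b (truncate χ (h * R) a) u x z) := fun χ hχ hc R hR x z => by
    rw [← dilate_truncate χ h R hh]
    exact (ha.isFinSymbol.truncate hχ hc (mul_pos hh hR)).hasQuantSum_dilate_iff hh b u x z
  constructor
  · intro hv χ hχ hc h0 x
    obtain ⟨s, hs, hs'⟩ := hv χ hχ hc h0 x
    refine ⟨fun R => s (h⁻¹ * R), fun R hR => ?_,
      hs'.comp (tendsto_id.const_mul_atTop (inv_pos.2 hh))⟩
    have hR' : 0 < h⁻¹ * R := mul_pos (inv_pos.2 hh) hR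
    have := (key χ hχ hc _ hR' x _).1 (hs _ hR')
    rwa [mul_inv_cancel_left₀ hh.ne'] at this
  · intro hv χ hχ hc h0 x
    obtain ⟨s, hs, hs'⟩ := hv χ hχ hc h0 x
    exact ⟨fun R => s (h * R), fun R hR =>
      (key χ hχ hc R hR x _).2 (hs _ (mul_pos hh hR)),
      hs'.comp (tendsto_id.const_mul_atTop hh)⟩

lemma isQuantization_dilate_iff {a : Plane × Plane → ℂ} (ha : IsSymbol a) {h : ℝ} (hh : 0 < h)
    {b : ℝ} (A : L2Section b →L[ℂ] L2Section b) :
    IsQuantization 1 b (dilate h a) A ↔ IsQuantization h b a A := by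
  simp only [IsQuantization, isQuantValue_dilate_iff ha hh]

lemma exists_norm_isQuantization_le_sum {b : ℝ} (hb : ∃ n : ℤ, b = 2 * Real.pi * n) :
    ∃ C₀ : ℝ, 0 < C₀ ∧ ∀ a : Plane × Plane → ℂ, IsSymbol a → ∀ h : ℝ, 0 < h →
      ∀ A : L2Section b →L[ℂ] L2Section b, IsQuantization h b a A →
        ‖A‖ ≤ C₀ * ∑ p ∈ multiIndexPairs 8, h ^ len p.2 * supNorm (symbolDeriv p.1 p.2 a) := by
  obtain ⟨K, hK⟩ := exists_norm_isQuantization_le hb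
  -- The summand `1` makes the constant positive even if `K = 0`; `256` comes from comparing `nrm
  -- fullDirs` with the sum of supremum norms.
  refine ⟨K * 256 + 1, by positivity, fun a ha h hh A hA => ?_⟩
  have hd := ha.dilate h
  have h1 := hK hd.isFinSymbol A ((isQuantization_dilate_iff ha hh A).2 hA)
  have h2 := ENNReal.toReal_mono ENNReal.ofReal_ne_top (hd.nrm_fullDirs_le (le_refl 8))
  have h3 : 0 ≤ ∑ p ∈ multiIndexPairs 8, supNorm (symbolDeriv p.1 p.2 (dilate h a)) :=
    Finset.sum_nonneg fun _ _ => supNorm_nonneg _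
  rw [ENNReal.toReal_ofReal (mul_nonneg (by norm_num) h3)] at h2
  have h4 : ∑ p ∈ multiIndexPairs 8, supNorm (symbolDeriv p.1 p.2 (dilate h a)) =
      ∑ p ∈ multiIndexPairs 8, h ^ len p.2 * supNorm (symbolDeriv p.1 p.2 a) :=
    Finset.sum_congr rfl fun p _ => supNorm_symbolDeriv_dilate p.1 p.2 hh ha.smooth
  rw [← h4]
  calc ‖A‖ ≤ _ := h1
    _ ≤ _ := mul_le_mul_of_nonneg_left h2 K.2
    _ ≤ _ := by rw [← mul_assoc, add_mul, one_mul]; linarith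

end MagneticTorus

end

theorem mainTheorem6 (B : MagneticTorus.Plane → ℝ) (hB : MagneticTorus.IsMagneticField B)
    (hflux : ∃ n : ℤ, MagneticTorus.flux B = 2 * Real.pi * n) :
    (∀ a : MagneticTorus.Plane × MagneticTorus.Plane → ℂ, MagneticTorus.IsSymbol a →
      ∀ h : ℝ, 0 < h → h ≤ 1 →
        ∃! A : MagneticTorus.L2Section (MagneticTorus.flux B) →L[ℂ]
            MagneticTorus.L2Section (MagneticTorus.flux B),
          MagneticTorus.IsQuantization h (MagneticTorus.flux B) a A) ∧
    ∃ (C₀ : ℝ) (N₀ : ℕ), 0 < C₀ ∧ 0 < N₀ ∧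
      ∀ a : MagneticTorus.Plane × MagneticTorus.Plane → ℂ, MagneticTorus.IsSymbol a →
        (∀ A : MagneticTorus.L2Section (MagneticTorus.flux B) →L[ℂ]
            MagneticTorus.L2Section (MagneticTorus.flux B),
          MagneticTorus.IsQuantization 1 (MagneticTorus.flux B) a A →
            ‖A‖ ≤ C₀ * ∑ p ∈ MagneticTorus.multiIndexPairs N₀,
              MagneticTorus.supNorm (MagneticTorus.symbolDeriv p.1 p.2 a)) ∧
        ∀ h : ℝ, 0 < h → h ≤ 1 →
          ∀ A : MagneticTorus.L2Section (MagneticTorus.flux B) →L[ℂ]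
              MagneticTorus.L2Section (MagneticTorus.flux B),
            MagneticTorus.IsQuantization h (MagneticTorus.flux B) a A →
              ‖A‖ ≤ C₀ * ∑ p ∈ MagneticTorus.multiIndexPairs N₀,
                h ^ MagneticTorus.len p.2 *
                  MagneticTorus.supNorm (MagneticTorus.symbolDeriv p.1 p.2 a) := by
  refine ⟨fun a ha h hh _ => ?_, ?_⟩
  · simp only [← MagneticTorus.isQuantization_dilate_iff ha hh]
    exact (ha.dilate h).isFinSymbol.existsUnique_isQuantization hflux
  · obtain ⟨C₀, hC₀, hC⟩ := MagneticTorus.exists_norm_isQuantization_le_sum hflux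
    -- The case `h = 1` is the general estimate with all powers of `h` equal to one.
    refine ⟨C₀, 8, hC₀, by norm_num, fun a ha => ⟨fun A hA => ?_, fun h hh _ => hC a ha h hh⟩⟩
    simpa using hC a ha 1 one_pos A hA
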